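/- Consider a linear system $\dot x = Ax+Bu$, $y=Cx$ with $A\in\mathbb R^{n\times n}$, $B\in\mathbb R^{n\times N}$, $C\in\mathbb R^{N\times n}$, and suppose that $(A,B,C)$ is a minimal realization (one of least state dimension) of its transfer function matrix $G(s)=C(sI-A)^{-1}B$, and that $G$ is negative imaginary (NI), that is: (1) $G$ has no pole at $0$ and none in $\mathrm{Re}\,s>0$; (2) $j\,(G(j\omega)-G(j\omega)^*)\ge 0$ for all $\omega>0$ such that $j\omega$ is not a pole of $G$; (3) every pole $j\omega_0$ of $G$ with $\omega_0>0$ is simple, and $\lim_{s\to j\omega_0}(s-j\omega_0)\,jG(s)$ is Hermitian positive semidefinite. For $k>0$ and $\omega\ge 0$, the hybrid integrator-gain system (HIGS) with gain $k$ and integrator frequency $\omega$ has input $e$, state $x_h$ and output $u=x_h$; it satisfies the sector constraint $(e,u,\dot e)\in\mathcal F=\{eu\ge \frac1k u^2\}$ and the equations $$\dot x_h=\omega e \ \text{ if } (e,u,\dot e)\in\mathcal F_1,\qquad x_h=ke\ \text{ if } (e,u,\dot e)\in\mathcal F_2,$$ where $\mathcal F_2=\{u=ke,\ \omega e^2>ke\dot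 e\}$ and $\mathcal F_1=\mathcal F\setminus\mathcal F_2$ (signals are absolutely continuous, and the two mode equations hold at almost every time). A multi-HIGS is a parallel bank of $N$ HIGS with gains $k_{h,i}$ and integrator frequencies $\omega_{h,i}$, with vector input $E_h$, state $X_h$ and output $U_h=X_h$. Then there exist $k_{h,i}>0$ and $\omega_{h,i}\ge 0$ $(i=1,\dots,N)$ such that the positive feedback interconnection of the system with the corresponding multi-HIGS, given by $u=U_h=X_h$ and $E_h=y=Cx$, is asymptotically stable: for every $\varepsilon>0$ there is $\delta>0$ such that every closed-loop trajectory on an interval $[0,T]$ with $\|x(0)\|<\delta$ and $\|X_h(0)\|<\delta$ satisfies $\|x(t)\|<\varepsilon$ and $\|X_h(t)\|<\varepsilon$ on $[0,T]$, and every closed-loop trajectory on $[0,\infty)$ satisfies $x(t)\to0$ and $X_h(t)\to0$ as $t\to\infty$. -/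

import Mathlib

open scoped Matrix Topology ComplexOrder
open MeasureTheory Filter Set

noncomputable section

namespace MultiHIGS

/-! ### Linear plants -/

/-- The transfer function matrix `G(s) = C (sI - A)⁻¹ B` of the system `ẋ = Ax + Bu`, `y = Cx`
(the value at an eigenvalue `s` of `A` is a junk value and plays no role below). -/
def transferMatrix {n N : ℕ} (A : Matrix (Fin n) (Fin n) ℝ) (B : Matrix (Fin n) (Fin N) ℝ)
    (C : Matrix (Fin N) (Fin n) ℝ) (s : ℂ) : Matrix (Fin N) (Fin N) ℂ :=
  C.map Complex.ofReal * (s • (1 : Matrix (Fin n) (Fin n) ℂ) - A.map Complex.ofReal)⁻¹ *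
    B.map Complex.ofReal

/-- `s` is not an eigenvalue of `A`. -/
def IsRegularPoint {n : ℕ} (A : Matrix (Fin n) (Fin n) ℝ) (s : ℂ) : Prop :=
  (s • (1 : Matrix (Fin n) (Fin n) ℂ) - A.map Complex.ofReal).det ≠ 0

/-- Two realizations, possibly with different state dimensions, have the same transfer function
matrix: the two rational matrices agree wherever both resolvents exist, that is, at all but
finitely many `s`. -/
def SameTransfer {n m N : ℕ} (A : Matrix (Fin n) (Fin n) ℝ) (B : Matrix (Fin n) (Fin N) ℝ)
    (C : Matrix (Fin N) (Fin n) ℝ) (A' : Matrix (Fin m) (Fin m) ℝ)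
    (B' : Matrix (Fin m) (Fin N) ℝ) (C' : Matrix (Fin N) (Fin m) ℝ) : Prop :=
  ∀ s : ℂ, IsRegularPoint A s → IsRegularPoint A' s →
    transferMatrix A B C s = transferMatrix A' B' C' s

/-- `(A, B, C)` is a minimal realization: no realization of the same transfer function matrix has
a smaller state dimension. -/
def IsMinimalRealization {n N : ℕ} (A : Matrix (Fin n) (Fin n) ℝ)
    (B : Matrix (Fin n) (Fin N) ℝ) (C : Matrix (Fin N) (Fin n) ℝ) : Prop :=
  ∀ (m : ℕ) (A' : Matrix (Fin m) (Fin m) ℝ) (B' : Matrix (Fin m) (Fin N) ℝ)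
    (C' : Matrix (Fin N) (Fin m) ℝ), SameTransfer A B C A' B' C' → n ≤ m

/-- `s₀` is a pole of the rational matrix `G`: some entry has a pole there. -/
def IsPole {N : ℕ} (G : ℂ → Matrix (Fin N) (Fin N) ℂ) (s₀ : ℂ) : Prop :=
  ∃ i j, meromorphicOrderAt (fun s => G s i j) s₀ < 0

/-- Negative imaginary (NI) square transfer function matrices (`G` is meant to be real-rational
and proper, as every `transferMatrix A B C` is). -/
structure IsNegativeImaginary {N : ℕ} (G : ℂ → Matrix (Fin N) (Fin N) ℂ) : Prop where
  /-- no pole at the origin -/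
  no_pole_zero : ¬ IsPole G 0
  /-- no poles in the open right half plane -/
  no_pole_right : ∀ s : ℂ, 0 < s.re → ¬ IsPole G s
  /-- `j (G(jω) - G(jω)*) ≥ 0` for all `ω > 0` such that `jω` is not a pole -/
  nonneg : ∀ w : ℝ, 0 < w → ¬ IsPole G (w * Complex.I) →
    (Complex.I • (G (w * Complex.I) - (G (w * Complex.I))ᴴ)).PosSemidef
  /-- a pole `jω₀` with `ω₀ > 0` is simple, and the limit of `(s - jω₀) j G(s)` as `s → jω₀`
  is Hermitian and positive semidefinite -/
  residue : ∀ w : ℝ, 0 < w → IsPole G (w * Complex.I) →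
    ∃ K : Matrix (Fin N) (Fin N) ℂ, K.PosSemidef ∧
      Tendsto (fun s : ℂ => ((s - w * Complex.I) * Complex.I) • G s)
        (𝓝[≠] (w * Complex.I)) (𝓝 K)

/-! ### Hybrid integrator-gain systems -/

/-- The sector `ℱ`: triples `(e, u, ė)` with `e u ≥ u² / k`. -/
def sector (k : ℝ) : Set (ℝ × ℝ × ℝ) :=
  {p | p.1 * p.2.1 ≥ 1 / k * p.2.1 ^ 2}

/-- The gain mode region `ℱ₂`: triples `(e, u, ė)` with `u = k e` and `ω e² > k e ė`. -/
def gainRegion (k w : ℝ) : Set (ℝ × ℝ × ℝ) :=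
  {p | p.2.1 = k * p.1 ∧ w * p.1 ^ 2 > k * p.1 * p.2.2}

/-- The integrator mode region `ℱ₁ = ℱ \ ℱ₂`. -/
def integratorRegion (k w : ℝ) : Set (ℝ × ℝ × ℝ) :=
  sector k \ gainRegion k w

/-- On the time interval `[0, T]`, the signals `e` (input), `xh` (state) and `u` (output) satisfy
the equations of the HIGS with gain `k` and integrator frequency `w`. Signals are absolutely
continuous, the sector constraint holds at all times, and the mode equations hold at almost every
time, since derivatives need not exist at switching instants. -/
structure IsHIGSTrajectory (k w T : ℝ) (e xh u : ℝ → ℝ) : Prop where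
  input_ac : AbsolutelyContinuousOnInterval e 0 T
  state_ac : AbsolutelyContinuousOnInterval xh 0 T
  output_eq : ∀ t ∈ Icc 0 T, u t = xh t
  sector_mem : ∀ t ∈ Icc 0 T, (e t, u t, deriv e t) ∈ sector k
  integrator_mode : ∀ᵐ t : ℝ, t ∈ Ioo 0 T →
    (e t, u t, deriv e t) ∈ integratorRegion k w → HasDerivAt xh (w * e t) t
  gain_mode : ∀ᵐ t : ℝ, t ∈ Ioo 0 T →
    (e t, u t, deriv e t) ∈ gainRegion k w → xh t = k * e t

/-- A multi-HIGS: `N` HIGS in parallel, the `i`-th one with gain `k i`, integrator frequency `w i`,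
input `Eₕ i`, state `Xₕ i` and output `Uₕ i`. -/
def IsMultiHIGSTrajectory {N : ℕ} (k w : Fin N → ℝ) (T : ℝ) (Eh Xh Uh : ℝ → Fin N → ℝ) : Prop :=
  ∀ i, IsHIGSTrajectory (k i) (w i) T (fun t => Eh t i) (fun t => Xh t i) (fun t => Uh t i)

/-! ### The positive feedback interconnection -/

/-- `(x, Xₕ)` is a trajectory on `[0, T]` of the positive feedback interconnection (with zero
reference) of the plant `ẋ = Ax + Bu`, `y = Cx` and the multi-HIGS with parameters `k`, `w`:
the plant is driven by `u = Uₕ = Xₕ` and the multi-HIGS is driven by `Eₕ = y = Cx`. -/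
structure IsClosedLoopTrajectory {n N : ℕ} (A : Matrix (Fin n) (Fin n) ℝ)
    (B : Matrix (Fin n) (Fin N) ℝ) (C : Matrix (Fin N) (Fin n) ℝ) (k w : Fin N → ℝ) (T : ℝ)
    (x : ℝ → Fin n → ℝ) (Xh : ℝ → Fin N → ℝ) : Prop where
  plant : ∀ t ∈ Icc 0 T, HasDerivWithinAt x (A *ᵥ x t + B *ᵥ Xh t) (Icc 0 T) t
  controller : IsMultiHIGSTrajectory k w T (fun t => C *ᵥ x t) Xh Xh

/-- The equilibrium `(x, Xₕ) = (0, 0)` of the closed loop is asymptotically stable: it is Lyapunov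
stable, and every trajectory on `[0, ∞)` converges to it. -/
structure IsAsymptoticallyStable {n N : ℕ} (A : Matrix (Fin n) (Fin n) ℝ)
    (B : Matrix (Fin n) (Fin N) ℝ) (C : Matrix (Fin N) (Fin n) ℝ) (k w : Fin N → ℝ) : Prop where
  stable : ∀ ε > 0, ∃ δ > 0, ∀ (T : ℝ) (x : ℝ → Fin n → ℝ) (Xh : ℝ → Fin N → ℝ),
    IsClosedLoopTrajectory A B C k w T x Xh → ‖x 0‖ < δ → ‖Xh 0‖ < δ →
      ∀ t ∈ Icc 0 T, ‖x t‖ < ε ∧ ‖Xh t‖ < ε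
  attractive : ∀ (x : ℝ → Fin n → ℝ) (Xh : ℝ → Fin N → ℝ),
    (∀ T > 0, IsClosedLoopTrajectory A B C k w T x Xh) →
      Tendsto x atTop (𝓝 0) ∧ Tendsto Xh atTop (𝓝 0)

end MultiHIGS

end

noncomputable section

namespace MultiHIGS

/-! ### Real-variable lemmas -/

/-! All gains are taken equal to one small κ and all integrator frequencies equal to 1. The plant
has a storage function ½ xᵀPx, with P symmetric positive definite, whose rate is at most uᵀẏ
(`exists_storage_matrix`, `storage_pos`). For small κ the energy W = ½ xᵀPx − XᵀCx + |X|²/(2κ) is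
positive definite. With e = Cx, almost everywhere Ẇ ≤ −Σ eᵢ(eᵢ − Xᵢ/κ), and by the sector constraint
this sum dominates the squares of the components of η = Cx − X/κ. So W is nonincreasing, which gives
Lyapunov stability, and η → 0 by Barbalat's lemma.

Attractivity needs more than vanishing dissipation, since the dissipation bound is zero along every
limiting orbit z of ż = (A + κBC)z. The inequality ωe² > keė of the gain mode limits the growth of
Xᵢ² (`IsClosedLoopTrajectory.sq_growth`): in the limit, a component of Cz that vanishes once stays
zero. Each component is therefore eventually zero or of constant sign. As A + κBC is injective for
small κ, the integral of Cz is a linear function of the bounded orbit, so Cz → 0. Then z itself has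
a limiting orbit of ẋ = Ax with zero output, which is zero by observability. Hence W takes
arbitrarily small values, and being monotone it tends to 0 (`attractive_of_storage`).

The matrix P comes from duality. A positive definite second moment matrix of (x, u) that is
stationary for the plant splits into periodic regimes and a positive semidefinite remainder in u
alone. Its supply rate is nonnegative by the negative imaginary inequality at each frequency
(`IsMinimalRealization.frequency_nonneg`) and at infinity
(`IsMinimalRealization.feedthrough_nonneg`). M. Riesz extension turns this into a functional that is
nonnegative on all positive semidefinite matrices, from which P is read off.

Positivity of P is spectral. Minimality identifies poles of G with eigenvalues of A, so A has no
eigenvalue in the open right half plane or at 0, and its imaginary eigenvalues are semisimple. On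
decaying motions the storage falls to 0, hence is nonnegative. On undamped modes its sign is that of
the residue. Decaying motions and modes of different frequencies are mutually orthogonal for P.
Definiteness follows from observability and invertibility of A. -/

theorem ae_hasDerivAt_zero_of_eq_zero (f : ℝ → ℝ) :
    ∀ᵐ t : ℝ, f t = 0 → ∀ d, HasDerivAt f d t → d = 0 := by
  -- Only countably many points of the zero set are isolated from the right. At the others a nonzero
  -- derivative is impossible, as it would keep `f` off zero near `t`.
  have hc : ({t ∈ {t | f t = 0} | 𝓝[{t | f t = 0} ∩ Ioi t] t = ⊥} : Set ℝ).Countable :=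
    countable_setOfPred_isolated_right_within
  filter_upwards [hc.ae_notMem volume] with t ht h0 d hd
  by_contra hne
  apply ht
  refine ⟨h0, ?_⟩
  have h1 := hd.eventually_ne hne (c := 0)
  rw [← Filter.empty_mem_iff_bot]
  have h2 : ∀ᶠ z in 𝓝[{t | f t = 0} ∩ Ioi t] t, f z ≠ 0 :=
    h1.filter_mono (nhdsWithin_mono _ (fun z hz => ne_of_gt hz.2))
  filter_upwards [h2, self_mem_nhdsWithin] with z hz hz'
  exact hz hz'.1

theorem _root_.AbsolutelyContinuousOnInterval.sub_le_integral {f g : ℝ → ℝ} {a b : ℝ}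
    (hab : a ≤ b) (hf : AbsolutelyContinuousOnInterval f a b) (hg : IntervalIntegrable g volume a b)
    (h : ∀ᵐ t : ℝ, t ∈ Ioo a b → deriv f t ≤ g t) : f b - f a ≤ ∫ t in a..b, g t := by
  rw [← hf.integral_deriv_eq_sub]
  refine intervalIntegral.integral_mono_ae_restrict hab hf.intervalIntegrable_deriv hg ?_
  rw [Filter.EventuallyLE, ← restrict_Ioo_eq_restrict_Icc, ae_restrict_iff' measurableSet_Ioo]
  exact h

/-- **Barbalat's lemma** for nonnegative Lipschitz functions. -/
theorem tendsto_zero_of_integral_bounded {f : ℝ → ℝ} {K R : ℝ}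
    (hf0 : ∀ t, 0 ≤ t → 0 ≤ f t) (hfc : ContinuousOn f (Ici 0))
    (hK : ∀ s t, 0 ≤ s → s ≤ t → f s - K * (t - s) ≤ f t)
    (hR : ∀ T, 0 ≤ T → ∫ t in 0..T, f t ≤ R) : Tendsto f atTop (𝓝 0) := by
  have hint : ∀ a b, 0 ≤ a → 0 ≤ b → IntervalIntegrable f volume a b := fun a b ha hb =>
    (hfc.mono (fun z hz => (le_min ha hb).trans hz.1)).intervalIntegrable
  wlog hKpos : 0 < K generalizing K
  · refine this (K := 1) (fun s t hs hst => ?_) one_pos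
    have := hK s t hs hst
    nlinarith [mul_nonneg (sub_nonneg.2 hst) (sub_nonneg.2 (not_lt.1 hKpos))]
  have hmono : ∀ s t, 0 ≤ s → s ≤ t → ∫ z in s..t, f z = (∫ z in 0..t, f z) - ∫ z in 0..s, f z :=
    fun s t hs hst => by
      rw [← intervalIntegral.integral_add_adjacent_intervals (hint 0 s le_rfl hs)
        (hint s t hs (hs.trans hst))]; ring
  have hnn : ∀ s t, 0 ≤ s → s ≤ t → 0 ≤ ∫ z in s..t, f z := fun s t hs hst =>
    intervalIntegral.integral_nonneg hst (fun u hu => hf0 u (hs.trans hu.1))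
  set F : ℝ → ℝ := fun t => ∫ z in 0..(max t 0), f z with hF
  have hFm : Monotone F := fun s t hst => by
    have h1 := hnn (max s 0) (max t 0) (le_max_right _ _) (max_le_max_right 0 hst)
    rw [hmono _ _ (le_max_right _ _) (max_le_max_right 0 hst)] at h1
    simp only [hF]; linarith
  have hFb : BddAbove (range F) := ⟨R, by rintro _ ⟨t, rfl⟩; exact hR _ (le_max_right _ _)⟩
  have hlim := tendsto_atTop_ciSup hFm hFb
  set ℓ := ⨆ i, F i
  rw [Metric.tendsto_atTop] at hlim ⊢
  intro ε hε
  -- If `f t ≥ ε`, the one-sided Lipschitz bound keeps `f ≥ ε / 2` on an interval of length `δ`,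
  -- whose integral is at least `ε * δ / 2`. Two values of `F` within `ε * δ / 4` of the limit
  -- cannot differ by that much.
  set δ := ε / (2 * K) with hδ
  have hδ0 : 0 < δ := by positivity
  obtain ⟨T, hT⟩ := hlim (ε * δ / 4) (by positivity)
  refine ⟨max T 0, fun t ht => ?_⟩
  have ht0 : 0 ≤ t := (le_max_right _ _).trans ht
  have htT : T ≤ t := (le_max_left _ _).trans ht
  rw [Real.dist_eq, sub_zero, abs_of_nonneg (hf0 t ht0)]
  by_contra hcon
  have hcon := not_lt.1 hcon
  have h1 := abs_lt.1 (hT t htT)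
  have h2 := abs_lt.1 (hT (t + δ) (by linarith))
  have h3 : ∫ z in t..(t + δ), f z = F (t + δ) - F t := by
    rw [hmono t (t + δ) ht0 (by linarith)]
    simp [hF, max_eq_left ht0, max_eq_left (show 0 ≤ t + δ by linarith)]
  have h4 : ∫ _z in t..(t + δ), (ε / 2) ≤ ∫ z in t..(t + δ), f z := by
    refine intervalIntegral.integral_mono_on (by linarith) (by simp)
      (hint _ _ ht0 (by linarith)) (fun z hz => ?_)
    have h5 := hK t z ht0 hz.1
    have h6 : K * (z - t) ≤ K * δ := by
      apply mul_le_mul_of_nonneg_left _ hKpos.le; linarith [hz.2]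
    have h7 : K * δ = ε / 2 := by rw [hδ]; field_simp
    linarith
  rw [intervalIntegral.integral_const, smul_eq_mul, h3] at h4
  have h8 : (t + δ - t) * (ε / 2) = ε * δ / 2 := by ring
  linarith [h1.1, h1.2, h2.1, h2.2]

/-- The constant is the minimum over the compact unit sphere, carried to all vectors by homogeneity.
-/
theorem exists_pos_mul_sq_le {E : Type*} [NormedAddCommGroup E] [NormedSpace ℝ E]
    [FiniteDimensional ℝ E] {f : E → ℝ} (hf : Continuous f) (hsmul : ∀ (r : ℝ) v, f (r • v) = r ^ 2 * f v)
    (hpos : ∀ v, v ≠ 0 → 0 < f v) : ∃ c > 0, ∀ v, c * ‖v‖ ^ 2 ≤ f v := by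
  have : ProperSpace E := FiniteDimensional.proper ℝ E
  have key : ∃ c > 0, ∀ v ∈ Metric.sphere (0 : E) 1, c ≤ f v := by
    rcases (Metric.sphere (0 : E) 1).eq_empty_or_nonempty with h | h
    · exact ⟨1, one_pos, by simp [h]⟩
    · obtain ⟨v, hv, hm⟩ := (isCompact_sphere (0 : E) 1).exists_isMinOn h hf.continuousOn
      refine ⟨f v, hpos v ?_, fun u hu => hm hu⟩
      rintro rfl
      simp at hv
  obtain ⟨c, hc, h⟩ := key
  refine ⟨c, hc, fun v => ?_⟩
  by_cases hv : v = 0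
  · have := hsmul 0 v
    rw [hv] at this ⊢
    simp at this
    simp [this]
  · have hn : 0 < ‖v‖ := norm_pos_iff.2 hv
    have h1 := h (‖v‖⁻¹ • v) (by simp [norm_smul, hn.ne'])
    rw [hsmul] at h1
    have : f v = ‖v‖ ^ 2 * (‖v‖⁻¹ ^ 2 * f v) := by field_simp
    rw [this, mul_comm]
    exact mul_le_mul_of_nonneg_left h1 (by positivity)

/-- A bounded solution of a linear equation with vanishing perturbation has a limiting orbit. -/
theorem exists_limit_orbit {E : Type*} [NormedAddCommGroup E] [NormedSpace ℝ E]
    [FiniteDimensional ℝ E] (M : E →L[ℝ] E) {y η : ℝ → E} {R : ℝ}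
    (hy : ∀ t, 0 < t → HasDerivAt y (M (y t) + η t) t) (hb : ∀ t, 0 ≤ t → ‖y t‖ ≤ R)
    (hη : Tendsto η atTop (𝓝 0)) :
    ∃ (t : ℕ → ℝ) (y₀ : E), Tendsto t atTop atTop ∧
      ∀ τ, 0 ≤ τ → Tendsto (fun n => y (t n + τ)) atTop (𝓝 (NormedSpace.exp (τ • M) y₀)) := by
  have : ProperSpace E := FiniteDimensional.proper ℝ E
  have : CompleteSpace E := FiniteDimensional.complete ℝ E
  -- Bolzano–Weierstrass at integer times fixes the initial value of the limit; Grönwall then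
  -- propagates the convergence to every `τ ≥ 0`.
  obtain ⟨y₀, -, φ, hφ, hlim⟩ := tendsto_subseq_of_bounded (x := fun n : ℕ => y n)
    (Metric.isBounded_closedBall (x := (0 : E)) (r := R)) (fun n => by simpa using hb n (by positivity))
  refine ⟨fun n => (φ n : ℝ), y₀, tendsto_natCast_atTop_atTop.comp hφ.tendsto_atTop, fun τ hτ => ?_⟩
  have hT : Tendsto (fun n => (φ n : ℝ)) atTop atTop :=
    tendsto_natCast_atTop_atTop.comp hφ.tendsto_atTop
  set z : ℝ → E := fun t => NormedSpace.exp (t • M) y₀ with hz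
  have hzd : ∀ t, HasDerivAt z (M (z t)) t := fun t => by
    have h := hasDerivAt_exp_smul_const' M t
    have h2 := h.clm_apply (hasDerivAt_const t y₀)
    simpa using h2
  have hz0 : z 0 = y₀ := by simp [hz]
  rw [Metric.tendsto_atTop]
  intro ε hε
  -- Here `p` bounds both the initial error and the perturbation `η`; the summand `0` is the defect
  -- of the exact orbit.
  have hg : Tendsto (fun p : ℝ => gronwallBound p ‖M‖ (p + 0) τ) (𝓝 0) (𝓝 0) := by
    have : Continuous (fun p : ℝ => gronwallBound p ‖M‖ (p + 0) τ) := by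
      by_cases hM : ‖M‖ = 0
      · simp only [hM, gronwallBound_K0]; fun_prop
      · simp only [gronwallBound_of_K_ne_0 hM]; fun_prop
    have h := this.tendsto 0
    simpa [gronwallBound_ε0] using h
  obtain ⟨δ, hδ, hδ'⟩ := Metric.tendsto_nhds_nhds.1 hg ε hε
  obtain ⟨N₁, hN₁⟩ := Metric.tendsto_atTop.1 hlim (δ / 2) (by positivity)
  obtain ⟨T, hTT⟩ := Metric.tendsto_atTop.1 hη (δ / 2) (by positivity)
  obtain ⟨N₂, hN₂⟩ := (tendsto_atTop.1 hT (max T 1)).exists_forall_of_atTop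
  refine ⟨max N₁ N₂, fun n hn => ?_⟩
  have hn1 := hN₁ n ((le_max_left _ _).trans hn)
  have hn2 := hN₂ n ((le_max_right _ _).trans hn)
  have hnT : T ≤ φ n := (le_max_left _ _).trans hn2
  have hnp : (1 : ℝ) ≤ φ n := (le_max_right _ _).trans hn2
  have hyd : ∀ s, 0 ≤ s → HasDerivAt (fun s => y (φ n + s))
      (M (y (φ n + s)) + η (φ n + s)) s := fun s hs =>
    (hy (φ n + s) (by linarith)).comp_const_add _ _
  have key := dist_le_of_approx_trajectories_ODE (v := fun _ => M) (K := ‖M‖₊)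
    (f := fun s => y (φ n + s)) (f' := fun s => M (y (φ n + s)) + η (φ n + s))
    (g := z) (g' := fun s => M (z s)) (a := 0) (b := τ) (εf := δ / 2) (εg := 0) (δ := δ / 2)
    (fun _ => M.lipschitz) (fun s hs => (hyd s hs.1).continuousAt.continuousWithinAt)
    (fun s hs => (hyd s hs.1).hasDerivWithinAt)
    (fun s hs => by
      have := hTT (φ n + s) (by linarith [hs.1])
      simp only [dist_eq_norm, add_sub_cancel_left]
      simpa using this.le)
    (fun s _ => (hzd s).continuousAt.continuousWithinAt)
    (fun s _ => (hzd s).hasDerivWithinAt) (fun s _ => by simp)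
    (by simpa [hz0] using hn1.le) τ ⟨hτ, le_rfl⟩
  refine lt_of_le_of_lt key ?_
  have := hδ' (x := δ / 2) (by rw [Real.dist_eq, sub_zero, abs_of_pos (by positivity)]; linarith)
  rw [Real.dist_eq, sub_zero] at this
  simpa using lt_of_abs_lt this

/-! ### Trajectories of the closed loop -/

theorem absolutelyContinuous_const (c a b : ℝ) :
    AbsolutelyContinuousOnInterval (fun _ : ℝ => c) a b :=
  ((LipschitzWith.const c).lipschitzOnWith (s := uIcc a b)).absolutelyContinuousOnInterval

theorem absolutelyContinuous_sum {ι : Type*} (s : Finset ι) {f : ι → ℝ → ℝ} {a b : ℝ}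
    (h : ∀ i ∈ s, AbsolutelyContinuousOnInterval (f i) a b) :
    AbsolutelyContinuousOnInterval (fun t => ∑ i ∈ s, f i t) a b := by
  classical
  induction s using Finset.induction_on with
  | empty => simpa using absolutelyContinuous_const 0 a b
  | insert i s hi ih =>
    simp only [Finset.sum_insert hi]
    exact (h i (Finset.mem_insert_self i s)).fun_add
      (ih fun j hj => h j (Finset.mem_insert_of_mem hj))

theorem absolutelyContinuous_dotProduct {m : ℕ} {u v : ℝ → Fin m → ℝ} {a b : ℝ}
    (hu : ∀ i, AbsolutelyContinuousOnInterval (fun t => u t i) a b)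
    (hv : ∀ i, AbsolutelyContinuousOnInterval (fun t => v t i) a b) :
    AbsolutelyContinuousOnInterval (fun t => u t ⬝ᵥ v t) a b :=
  absolutelyContinuous_sum _ fun i _ => (hu i).fun_mul (hv i)

theorem absolutelyContinuous_mulVec {m n : ℕ} (M : Matrix (Fin m) (Fin n) ℝ) {v : ℝ → Fin n → ℝ}
    {a b : ℝ} (hv : ∀ i, AbsolutelyContinuousOnInterval (fun t => v t i) a b) (i : Fin m) :
    AbsolutelyContinuousOnInterval (fun t => (M *ᵥ v t) i) a b :=
  absolutelyContinuous_dotProduct (u := fun _ => M i) (fun _ => absolutelyContinuous_const _ _ _) hv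

theorem hasDerivAt_dotProduct {m : ℕ} {u v : ℝ → Fin m → ℝ} {u' v' : Fin m → ℝ} {t : ℝ}
    (hu : HasDerivAt u u' t) (hv : HasDerivAt v v' t) :
    HasDerivAt (fun t => u t ⬝ᵥ v t) (u' ⬝ᵥ v t + u t ⬝ᵥ v') t := by
  simp only [dotProduct, ← Finset.sum_add_distrib]
  exact HasDerivAt.fun_sum fun i _ => (hasDerivAt_pi.1 hu i).mul (hasDerivAt_pi.1 hv i)

theorem hasDerivAt_mulVec {m n : ℕ} (M : Matrix (Fin m) (Fin n) ℝ) {v : ℝ → Fin n → ℝ}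
    {v' : Fin n → ℝ} {t : ℝ} (hv : HasDerivAt v v' t) :
    HasDerivAt (fun t => M *ᵥ v t) (M *ᵥ v') t :=
  (LinearMap.toContinuousLinearMap M.mulVecLin).hasFDerivAt.comp_hasDerivAt t hv

/-- The gain mode only prescribes the value of the state at the instant. Its derivative is recovered
at almost every such instant because `xh - k * e` has zero derivative at almost all of its zeros. -/
theorem IsHIGSTrajectory.ae_hasDerivAt {k w T : ℝ} {e xh u : ℝ → ℝ}
    (h : IsHIGSTrajectory k w T e xh u) (hT : 0 ≤ T) :
    ∀ᵐ t : ℝ, t ∈ Ioo 0 T → ∀ e', HasDerivAt e e' t → ∃ d, HasDerivAt xh d t ∧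
      (d = w * e t ∨ (xh t = k * e t ∧ d = k * e' ∧ k * e t * e' < w * e t ^ 2)) := by
  filter_upwards [h.integrator_mode, h.gain_mode, h.state_ac.ae_differentiableAt,
    ae_hasDerivAt_zero_of_eq_zero (fun t => xh t - k * e t)] with t h1 h2 h3 h4 ht e' he'
  by_cases hg : (e t, u t, deriv e t) ∈ gainRegion k w
  · have hd := (h3 (by rw [uIcc_of_le hT]; exact Ioo_subset_Icc_self ht)).hasDerivAt
    have heq := h2 ht hg
    have h5 := h4 (by rw [heq]; ring) _ (hd.sub (he'.const_mul k))
    have h6 : k * e t * deriv e t < w * e t ^ 2 := hg.2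
    rw [he'.deriv] at h6
    exact ⟨_, hd, Or.inr ⟨heq, by linarith, h6⟩⟩
  · exact ⟨_, h1 ht ⟨h.sector_mem t (Ioo_subset_Icc_self ht), hg⟩, Or.inl rfl⟩

theorem IsHIGSTrajectory.sector_le {k w T : ℝ} {e xh u : ℝ → ℝ}
    (h : IsHIGSTrajectory k w T e xh u) {t : ℝ} (ht : t ∈ Icc 0 T) :
    xh t ^ 2 / k ≤ e t * xh t := by
  have := h.sector_mem t ht
  simp only [sector, mem_ofPred_eq, h.output_eq t ht] at this
  calc xh t ^ 2 / k = 1 / k * xh t ^ 2 := by ring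
    _ ≤ _ := this

section

variable {n N : ℕ} {A : Matrix (Fin n) (Fin n) ℝ} {B : Matrix (Fin n) (Fin N) ℝ}
  {C : Matrix (Fin N) (Fin n) ℝ}

theorem IsClosedLoopTrajectory.continuousOn_plant {k w : Fin N → ℝ} {T : ℝ} {x : ℝ → Fin n → ℝ}
    {X : ℝ → Fin N → ℝ} (h : IsClosedLoopTrajectory A B C k w T x X) :
    ContinuousOn x (Icc 0 T) := fun t ht => (h.plant t ht).continuousWithinAt

theorem IsClosedLoopTrajectory.continuousOn_state {k w : Fin N → ℝ} {T : ℝ} {x : ℝ → Fin n → ℝ}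
    {X : ℝ → Fin N → ℝ} (h : IsClosedLoopTrajectory A B C k w T x X) (hT : 0 ≤ T) :
    ContinuousOn X (Icc 0 T) :=
  continuousOn_pi.2 fun i => by
    have := (h.controller i).state_ac.continuousOn
    rwa [uIcc_of_le hT] at this

theorem IsClosedLoopTrajectory.absolutelyContinuous_plant {k w : Fin N → ℝ} {T : ℝ}
    {x : ℝ → Fin n → ℝ} {X : ℝ → Fin N → ℝ} (h : IsClosedLoopTrajectory A B C k w T x X)
    (hT : 0 ≤ T) (i : Fin n) : AbsolutelyContinuousOnInterval (fun t => x t i) 0 T := by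
  have hc : ContinuousOn (fun t => A *ᵥ x t + B *ᵥ X t) (Icc 0 T) :=
    ((Continuous.matrix_mulVec continuous_const continuous_id).comp_continuousOn
      h.continuousOn_plant).add
    ((Continuous.matrix_mulVec continuous_const continuous_id).comp_continuousOn
      (h.continuousOn_state hT))
  obtain ⟨K, hK⟩ := isCompact_Icc.exists_bound_of_continuousOn hc
  have hL : LipschitzOnWith K.toNNReal x (Icc 0 T) :=
    (convex_Icc 0 T).lipschitzOnWith_of_nnnorm_hasDerivWithin_le h.plant fun t ht => by
      rw [← NNReal.coe_le_coe, coe_nnnorm]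
      exact (hK t ht).trans (Real.le_coe_toNNReal K)
  have hLi : LipschitzOnWith K.toNNReal (fun t => x t i) (uIcc 0 T) := by
    rw [uIcc_of_le hT]
    intro s hs t ht
    exact (edist_le_pi_edist _ _ i).trans (hL hs ht)
  exact hLi.absolutelyContinuousOnInterval

/-- The plant equation holds with two-sided derivatives in the interior. -/
theorem IsClosedLoopTrajectory.hasDerivAt_plant {k w : Fin N → ℝ} {T : ℝ}
    {x : ℝ → Fin n → ℝ} {X : ℝ → Fin N → ℝ} (h : IsClosedLoopTrajectory A B C k w T x X)
    {t : ℝ} (ht : t ∈ Ioo 0 T) : HasDerivAt x (A *ᵥ x t + B *ᵥ X t) t :=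
  (h.plant t (Ioo_subset_Icc_self ht)).hasDerivAt (Icc_mem_nhds ht.1 ht.2)

theorem IsClosedLoopTrajectory.ae_hasDerivAt_state {k w : Fin N → ℝ} {T : ℝ}
    {x : ℝ → Fin n → ℝ} {X : ℝ → Fin N → ℝ} (h : IsClosedLoopTrajectory A B C k w T x X)
    (hT : 0 ≤ T) :
    ∀ᵐ t : ℝ, t ∈ Ioo 0 T → ∃ d, HasDerivAt X d t ∧ ∀ i, d i = w i * (C *ᵥ x t) i ∨
      (X t i = k i * (C *ᵥ x t) i ∧ d i = k i * (C *ᵥ (A *ᵥ x t + B *ᵥ X t)) i ∧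
        k i * (C *ᵥ x t) i * (C *ᵥ (A *ᵥ x t + B *ᵥ X t)) i < w i * (C *ᵥ x t) i ^ 2) := by
  have hall := ae_all_iff.2 fun i => (h.controller i).ae_hasDerivAt hT
  filter_upwards [hall] with t h1 ht
  have he := fun i => hasDerivAt_pi.1 (hasDerivAt_mulVec C (h.hasDerivAt_plant ht)) i
  choose d hd hd' using fun i => h1 i ht _ (he i)
  exact ⟨d, hasDerivAt_pi.2 hd, hd'⟩

/-- The energy of the closed loop when all gains of the multi-HIGS are equal to `κ`. -/
def energy (P : Matrix (Fin n) (Fin n) ℝ) (C : Matrix (Fin N) (Fin n) ℝ) (κ : ℝ)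
    (x : Fin n → ℝ) (X : Fin N → ℝ) : ℝ :=
  1 / 2 * (x ⬝ᵥ (P *ᵥ x)) - X ⬝ᵥ (C *ᵥ x) + 1 / (2 * κ) * (X ⬝ᵥ X)

/-- The rate at which the integrator modes dissipate energy. -/
def dissipation (C : Matrix (Fin N) (Fin n) ℝ) (κ : ℝ) (x : Fin n → ℝ) (X : Fin N → ℝ) : ℝ :=
  ∑ i, (C *ᵥ x) i * ((C *ᵥ x) i - X i / κ)

theorem continuous_energy (P : Matrix (Fin n) (Fin n) ℝ) (C : Matrix (Fin N) (Fin n) ℝ) (κ : ℝ) :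
    Continuous fun p : (Fin n → ℝ) × (Fin N → ℝ) => energy P C κ p.1 p.2 := by
  unfold energy
  simp only [dotProduct, Matrix.mulVec]
  fun_prop

theorem continuous_dissipation (C : Matrix (Fin N) (Fin n) ℝ) (κ : ℝ) :
    Continuous fun p : (Fin n → ℝ) × (Fin N → ℝ) => dissipation C κ p.1 p.2 := by
  unfold dissipation
  simp only [dotProduct, Matrix.mulVec]
  fun_prop

theorem continuousOn_dissipation (C : Matrix (Fin N) (Fin n) ℝ) (κ : ℝ) {x : ℝ → Fin n → ℝ}
    {X : ℝ → Fin N → ℝ} {s : Set ℝ} (hx : ContinuousOn x s) (hX : ContinuousOn X s) :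
    ContinuousOn (fun r => dissipation C κ (x r) (X r)) s := by
  have h := (continuous_dissipation C κ).comp_continuousOn (hx.prodMk hX)
  exact h

theorem hasDerivAt_energy (P : Matrix (Fin n) (Fin n) ℝ) (C : Matrix (Fin N) (Fin n) ℝ) (κ : ℝ)
    {x : ℝ → Fin n → ℝ} {X : ℝ → Fin N → ℝ} {v : Fin n → ℝ} {d : Fin N → ℝ} {r : ℝ}
    (hx : HasDerivAt x v r) (hX : HasDerivAt X d r) :
    HasDerivAt (fun r => energy P C κ (x r) (X r))
      (1 / 2 * (v ⬝ᵥ (P *ᵥ x r) + x r ⬝ᵥ (P *ᵥ v)) - (d ⬝ᵥ (C *ᵥ x r) + X r ⬝ᵥ (C *ᵥ v)) +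
        1 / (2 * κ) * (d ⬝ᵥ X r + X r ⬝ᵥ d)) r :=
  (((hasDerivAt_dotProduct hx (hasDerivAt_mulVec P hx)).const_mul (1 / 2 : ℝ)).fun_sub
    (hasDerivAt_dotProduct hX (hasDerivAt_mulVec C hx))).fun_add
    ((hasDerivAt_dotProduct hX hX).const_mul (1 / (2 * κ)))

theorem absolutelyContinuous_energy (P : Matrix (Fin n) (Fin n) ℝ) (C : Matrix (Fin N) (Fin n) ℝ)
    (κ : ℝ) {x : ℝ → Fin n → ℝ} {X : ℝ → Fin N → ℝ} {a b : ℝ}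
    (hx : ∀ i, AbsolutelyContinuousOnInterval (fun t => x t i) a b)
    (hX : ∀ i, AbsolutelyContinuousOnInterval (fun t => X t i) a b) :
    AbsolutelyContinuousOnInterval (fun r => energy P C κ (x r) (X r)) a b :=
  (((absolutelyContinuous_dotProduct hx (absolutelyContinuous_mulVec P hx)).const_mul
    _).fun_sub (absolutelyContinuous_dotProduct hX (absolutelyContinuous_mulVec C hx))).fun_add
    ((absolutelyContinuous_dotProduct hX hX).const_mul _)

/-- The storage inequality cancels the term `X ⬝ᵥ (C *ᵥ v)`. What remains is the sum of −dᵢ(eᵢ −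
Xᵢ/κ): in the integrator mode dᵢ = eᵢ, and in the gain mode the second factor is zero. -/
theorem energy_rate_le {P : Matrix (Fin n) (Fin n) ℝ} {κ : ℝ} (hPs : Pᵀ = P) (hκ : 0 < κ)
    {x v : Fin n → ℝ} {X d : Fin N → ℝ} (hdiss : (P *ᵥ x) ⬝ᵥ v ≤ X ⬝ᵥ (C *ᵥ v))
    (hmode : ∀ i, d i = (C *ᵥ x) i ∨ X i = κ * (C *ᵥ x) i) :
    1 / 2 * (v ⬝ᵥ (P *ᵥ x) + x ⬝ᵥ (P *ᵥ v)) - (d ⬝ᵥ (C *ᵥ x) + X ⬝ᵥ (C *ᵥ v)) +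
        1 / (2 * κ) * (d ⬝ᵥ X + X ⬝ᵥ d) ≤ -dissipation C κ x X := by
  have h1 : x ⬝ᵥ P *ᵥ v = v ⬝ᵥ P *ᵥ x := by
    rw [Matrix.dotProduct_mulVec, ← Matrix.mulVec_transpose, hPs, dotProduct_comm]
  rw [dotProduct_comm] at hdiss
  have h3 : -(d ⬝ᵥ C *ᵥ x) + 1 / (2 * κ) * (d ⬝ᵥ X + X ⬝ᵥ d) ≤ -dissipation C κ x X := by
    rw [dotProduct_comm X d]
    simp only [dissipation, dotProduct]
    rw [← Finset.sum_neg_distrib, ← Finset.sum_neg_distrib, ← Finset.sum_add_distrib,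
      Finset.mul_sum, ← Finset.sum_add_distrib]
    refine Finset.sum_le_sum fun i _ => ?_
    have he : 1 / (2 * κ) * (d i * X i + d i * X i) = d i * (X i / κ) := by
      field_simp; ring
    rw [he]
    have hm := hmode i
    generalize (C *ᵥ x) i = e at hm ⊢
    rcases hm with h | h
    · rw [h]; apply le_of_eq; ring
    · rw [h, mul_div_cancel_left₀ _ hκ.ne']; apply le_of_eq; ring
  rw [h1]
  linarith

/-- The rate bound holds only almost everywhere; absolute continuity of the energy makes it
integrable. -/
theorem IsClosedLoopTrajectory.energy_sub_le {P : Matrix (Fin n) (Fin n) ℝ} {κ T : ℝ}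
    {x : ℝ → Fin n → ℝ} {X : ℝ → Fin N → ℝ} (hPs : Pᵀ = P) (hκ : 0 < κ)
    (hdiss : ∀ x u, (P *ᵥ x) ⬝ᵥ (A *ᵥ x + B *ᵥ u) ≤ u ⬝ᵥ (C *ᵥ (A *ᵥ x + B *ᵥ u)))
    (h : IsClosedLoopTrajectory A B C (fun _ => κ) (fun _ => 1) T x X)
    {s t : ℝ} (hs : 0 ≤ s) (hst : s ≤ t) (htT : t ≤ T) :
    energy P C κ (x t) (X t) - energy P C κ (x s) (X s) ≤
      -∫ r in s..t, dissipation C κ (x r) (X r) := by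
  have hT : 0 ≤ T := hs.trans (hst.trans htT)
  have hX : ∀ i, AbsolutelyContinuousOnInterval (fun t => X t i) 0 T :=
    fun i => (h.controller i).state_ac
  have hac := absolutelyContinuous_energy P C κ (h.absolutelyContinuous_plant hT) hX
  have hsub : uIcc s t ⊆ Icc 0 T := by
    rw [uIcc_of_le hst]; exact Icc_subset_Icc hs htT
  have hcont : ContinuousOn (fun r => dissipation C κ (x r) (X r)) (Icc 0 T) := by
    have h1 := h.continuousOn_plant
    have h2 := h.continuousOn_state hT
    exact continuousOn_dissipation C κ h1 h2
  rw [← intervalIntegral.integral_neg]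
  have hac' : AbsolutelyContinuousOnInterval (fun r => energy P C κ (x r) (X r)) s t :=
    hac.mono (by rwa [uIcc_of_le hT])
  have hint : IntervalIntegrable (fun r => -dissipation C κ (x r) (X r)) volume s t :=
    (hcont.mono hsub).fun_neg.intervalIntegrable
  have hae : ∀ᵐ r : ℝ, r ∈ Ioo s t →
      deriv (fun r => energy P C κ (x r) (X r)) r ≤ -dissipation C κ (x r) (X r) := by
    filter_upwards [h.ae_hasDerivAt_state hT] with r hr hrst
    have hrT : r ∈ Ioo 0 T := ⟨hs.trans_lt hrst.1, hrst.2.trans_le htT⟩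
    obtain ⟨d, hd, hmode⟩ := hr hrT
    rw [(hasDerivAt_energy P C κ (h.hasDerivAt_plant hrT) hd).deriv]
    refine energy_rate_le hPs hκ (hdiss _ _) fun i => ?_
    rcases hmode i with h | h
    · exact Or.inl (by rw [h, one_mul])
    · exact Or.inr h.1
  exact hac'.sub_le_integral hst hint hae

end

/-! ### Coercivity of the energy and Lyapunov stability -/

section

variable {n N : ℕ} {A : Matrix (Fin n) (Fin n) ℝ} {B : Matrix (Fin n) (Fin N) ℝ}
  {C : Matrix (Fin N) (Fin n) ℝ}

theorem exists_gain (C : Matrix (Fin N) (Fin n) ℝ) {P : Matrix (Fin n) (Fin n) ℝ}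
    (hP : ∀ x, x ≠ 0 → 0 < x ⬝ᵥ (P *ᵥ x)) :
    ∃ κ > 0, ∀ x, κ * ((C *ᵥ x) ⬝ᵥ (C *ᵥ x)) ≤ 1 / 4 * (x ⬝ᵥ (P *ᵥ x)) := by
  obtain ⟨c, hc, hcP⟩ := exists_pos_mul_sq_le (f := fun x : Fin n → ℝ => x ⬝ᵥ (P *ᵥ x))
    (by simp only [dotProduct, Matrix.mulVec]; fun_prop)
    (fun r v => by simp only [Matrix.mulVec_smul, dotProduct_smul, smul_dotProduct, smul_eq_mul]; ring)
    hP
  set D := ‖LinearMap.toContinuousLinearMap C.mulVecLin‖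
  have hD : ∀ x, (C *ᵥ x) ⬝ᵥ (C *ᵥ x) ≤ N * (D * ‖x‖) ^ 2 := fun x => by
    have h1 : ‖C *ᵥ x‖ ≤ D * ‖x‖ := (LinearMap.toContinuousLinearMap C.mulVecLin).le_opNorm x
    calc (C *ᵥ x) ⬝ᵥ (C *ᵥ x) ≤ ∑ _i : Fin N, (D * ‖x‖) ^ 2 := by
          refine Finset.sum_le_sum fun i _ => ?_
          rw [← sq, ← sq_abs]
          exact pow_le_pow_left₀ (abs_nonneg _) ((norm_le_pi_norm (C *ᵥ x) i).trans h1) 2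
      _ = _ := by simp
  -- The factor `N` pays for passing from the sup norm to a sum of squares; the `+ 1` guards against
  -- `D = 0`.
  refine ⟨c / (4 * (N * D ^ 2 + 1)), by positivity, fun x => ?_⟩
  have h1 : c / (4 * (N * D ^ 2 + 1)) * (N * (D * ‖x‖) ^ 2) ≤ 1 / 4 * (c * ‖x‖ ^ 2) := by
    have : c / (4 * (N * D ^ 2 + 1)) * (N * (D * ‖x‖) ^ 2) =
        1 / 4 * (c * ‖x‖ ^ 2) * ((N * D ^ 2) / (N * D ^ 2 + 1)) := by
      field_simp
    rw [this]
    apply mul_le_of_le_one_right (by positivity)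
    rw [div_le_one (by positivity)]
    linarith
  calc _ ≤ c / (4 * (N * D ^ 2 + 1)) * (N * (D * ‖x‖) ^ 2) :=
        mul_le_mul_of_nonneg_left (hD x) (by positivity)
    _ ≤ 1 / 4 * (c * ‖x‖ ^ 2) := h1
    _ ≤ _ := by linarith [hcP x]

/-- Young's inequality bounds the cross term by κ|Cx|² + |X|²/(4κ). The small gain condition absorbs
the first part in half of ½ xᵀPx, the second is half of |X|²/(2κ), and the remaining halves are
positive definite. -/
theorem exists_energy_lower_bound {P : Matrix (Fin n) (Fin n) ℝ} {κ : ℝ} (hκ : 0 < κ)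
    (hP : ∀ x, x ≠ 0 → 0 < x ⬝ᵥ (P *ᵥ x))
    (hg : ∀ x, κ * ((C *ᵥ x) ⬝ᵥ (C *ᵥ x)) ≤ 1 / 4 * (x ⬝ᵥ (P *ᵥ x))) :
    ∃ c > 0, ∀ x X, c * ‖((x, X) : (Fin n → ℝ) × (Fin N → ℝ))‖ ^ 2 ≤ energy P C κ x X := by
  have hlow : ∀ x X, 1 / 4 * (x ⬝ᵥ (P *ᵥ x)) + 1 / (4 * κ) * (X ⬝ᵥ X) ≤ energy P C κ x X := by
    intro x X
    have h1 : X ⬝ᵥ (C *ᵥ x) ≤ κ * ((C *ᵥ x) ⬝ᵥ (C *ᵥ x)) + 1 / (4 * κ) * (X ⬝ᵥ X) := by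
      simp only [dotProduct, Finset.mul_sum, ← Finset.sum_add_distrib]
      refine Finset.sum_le_sum fun i _ => ?_
      generalize (∑ j, C i j * x j) = a
      generalize (C *ᵥ x) i = b
      have : κ * (b * b) + 1 / (4 * κ) * (X i * X i) - X i * b =
          κ * (b - X i / (2 * κ)) ^ 2 := by field_simp; ring
      have h2 : 0 ≤ κ * (b - X i / (2 * κ)) ^ 2 := by positivity
      linarith
    have h2 : 1 / (2 * κ) * (X ⬝ᵥ X) = 1 / (4 * κ) * (X ⬝ᵥ X) + 1 / (4 * κ) * (X ⬝ᵥ X) := by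
      field_simp; ring
    unfold energy
    linarith [hg x]
  obtain ⟨c, hc, h⟩ := exists_pos_mul_sq_le (continuous_energy P C κ)
    (fun r v => by
      simp only [energy, Prod.smul_fst, Prod.smul_snd, Matrix.mulVec_smul, dotProduct_smul,
        smul_dotProduct, smul_eq_mul]; ring)
    (fun v hv => by
      refine lt_of_lt_of_le ?_ (hlow v.1 v.2)
      have hXX : 0 ≤ v.2 ⬝ᵥ v.2 := Finset.sum_nonneg fun i _ => mul_self_nonneg _
      by_cases h1 : v.1 = 0
      · have h2 : v.2 ≠ 0 := fun h2 => hv (Prod.ext h1 h2)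
        have h3 : v.2 ⬝ᵥ v.2 ≠ 0 := fun h => h2 (dotProduct_self_eq_zero.1 h)
        have : 0 < v.2 ⬝ᵥ v.2 := lt_of_le_of_ne hXX h3.symm
        rw [h1, zero_dotProduct]
        positivity
      · have := hP _ h1
        positivity)
  exact ⟨c, hc, fun x X => h (x, X)⟩

/-- The difference of the two sides is the sector defect (eu − u²/κ)/κ. This makes the dissipation
control the distance to the gain law u = κe. -/
theorem sq_sub_le_of_sector {κ e u : ℝ} (hκ : 0 < κ) (h : u ^ 2 / κ ≤ e * u) :
    (e - u / κ) ^ 2 ≤ e * (e - u / κ) := by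
  have : e * (e - u / κ) - (e - u / κ) ^ 2 = (e * u - u ^ 2 / κ) / κ := by field_simp; ring
  have h2 : 0 ≤ (e * u - u ^ 2 / κ) / κ := div_nonneg (by linarith) hκ.le
  linarith

theorem IsClosedLoopTrajectory.sq_le_dissipation {κ T : ℝ} {w : Fin N → ℝ} {x : ℝ → Fin n → ℝ}
    {X : ℝ → Fin N → ℝ} (hκ : 0 < κ) (h : IsClosedLoopTrajectory A B C (fun _ => κ) w T x X)
    {t : ℝ} (ht : t ∈ Icc 0 T) (i : Fin N) :
    ((C *ᵥ x t) i - X t i / κ) ^ 2 ≤ dissipation C κ (x t) (X t) := by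
  have h1 := fun j => sq_sub_le_of_sector hκ ((h.controller j).sector_le ht)
  exact (h1 i).trans (Finset.single_le_sum
    (f := fun j => (C *ᵥ x t) j * ((C *ᵥ x t) j - X t j / κ))
    (fun j _ => (sq_nonneg _).trans (h1 j)) (Finset.mem_univ i))

theorem IsClosedLoopTrajectory.dissipation_nonneg {κ T : ℝ} {w : Fin N → ℝ} {x : ℝ → Fin n → ℝ}
    {X : ℝ → Fin N → ℝ} (hκ : 0 < κ) (h : IsClosedLoopTrajectory A B C (fun _ => κ) w T x X)
    {t : ℝ} (ht : t ∈ Icc 0 T) : 0 ≤ dissipation C κ (x t) (X t) :=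
  Finset.sum_nonneg fun j _ =>
    (sq_nonneg _).trans (sq_sub_le_of_sector hκ ((h.controller j).sector_le ht))

theorem IsClosedLoopTrajectory.energy_antitone {P : Matrix (Fin n) (Fin n) ℝ} {κ T : ℝ}
    {x : ℝ → Fin n → ℝ} {X : ℝ → Fin N → ℝ} (hPs : Pᵀ = P) (hκ : 0 < κ)
    (hdiss : ∀ x u, (P *ᵥ x) ⬝ᵥ (A *ᵥ x + B *ᵥ u) ≤ u ⬝ᵥ (C *ᵥ (A *ᵥ x + B *ᵥ u)))
    (h : IsClosedLoopTrajectory A B C (fun _ => κ) (fun _ => 1) T x X)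
    {s t : ℝ} (hs : 0 ≤ s) (hst : s ≤ t) (htT : t ≤ T) :
    energy P C κ (x t) (X t) ≤ energy P C κ (x s) (X s) := by
  have h1 := h.energy_sub_le hPs hκ hdiss hs hst htT
  have h2 : 0 ≤ ∫ r in s..t, dissipation C κ (x r) (X r) :=
    intervalIntegral.integral_nonneg hst fun r hr =>
      h.dissipation_nonneg hκ ⟨hs.trans hr.1, hr.2.trans htT⟩
  linarith

theorem stable_of_storage {P : Matrix (Fin n) (Fin n) ℝ} {κ : ℝ} (hPs : Pᵀ = P) (hκ : 0 < κ)
    (hP : ∀ x, x ≠ 0 → 0 < x ⬝ᵥ (P *ᵥ x))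
    (hdiss : ∀ x u, (P *ᵥ x) ⬝ᵥ (A *ᵥ x + B *ᵥ u) ≤ u ⬝ᵥ (C *ᵥ (A *ᵥ x + B *ᵥ u)))
    (hg : ∀ x, κ * ((C *ᵥ x) ⬝ᵥ (C *ᵥ x)) ≤ 1 / 4 * (x ⬝ᵥ (P *ᵥ x))) :
    ∀ ε > 0, ∃ δ > 0, ∀ (T : ℝ) (x : ℝ → Fin n → ℝ) (X : ℝ → Fin N → ℝ),
    IsClosedLoopTrajectory A B C (fun _ => κ) (fun _ => 1) T x X → ‖x 0‖ < δ → ‖X 0‖ < δ →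
      ∀ t ∈ Icc 0 T, ‖x t‖ < ε ∧ ‖X t‖ < ε := by
  intro ε hε
  obtain ⟨c, hc, hlow⟩ := exists_energy_lower_bound hκ hP hg
  have h0 : Tendsto (fun p : (Fin n → ℝ) × (Fin N → ℝ) => energy P C κ p.1 p.2) (𝓝 0) (𝓝 0) := by
    have := (continuous_energy P C κ).tendsto 0
    simpa [energy] using this
  obtain ⟨δ, hδ, h⟩ := Metric.tendsto_nhds_nhds.1 h0 (c * ε ^ 2) (by positivity)
  refine ⟨δ, hδ, fun T x X htr hx hX t ht => ?_⟩
  have h1 : energy P C κ (x 0) (X 0) < c * ε ^ 2 := by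
    have := h (x := (x 0, X 0)) (by rw [dist_zero_right]; exact max_lt hx hX)
    rw [Real.dist_eq, sub_zero] at this
    exact lt_of_abs_lt this
  have h2 := htr.energy_antitone hPs hκ hdiss le_rfl ht.1 ht.2
  have h3 := hlow (x t) (X t)
  have h4 : ‖((x t, X t) : (Fin n → ℝ) × (Fin N → ℝ))‖ < ε := by
    have : c * ‖((x t, X t) : (Fin n → ℝ) × (Fin N → ℝ))‖ ^ 2 < c * ε ^ 2 := by linarith
    exact lt_of_pow_lt_pow_left₀ 2 hε.le (lt_of_mul_lt_mul_left this hc.le)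
  exact max_lt_iff.1 h4

theorem _root_.AbsolutelyContinuousOnInterval.abs_sub_le {f : ℝ → ℝ} {a b L : ℝ} (hab : a ≤ b)
    (hf : AbsolutelyContinuousOnInterval f a b)
    (h : ∀ᵐ t : ℝ, t ∈ Ioo a b → |deriv f t| ≤ L) : |f b - f a| ≤ L * (b - a) := by
  have h1 := hf.sub_le_integral hab (g := fun _ => L) (by simp)
    (by filter_upwards [h] with t ht hm using (abs_le.1 (ht hm)).2)
  have h2 := hf.fun_neg.sub_le_integral hab (g := fun _ => L) (by simp)
    (by filter_upwards [h] with t ht hm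
        rw [deriv.fun_neg]; linarith [(abs_le.1 (ht hm)).1])
  rw [intervalIntegral.integral_const, smul_eq_mul] at h1 h2
  rw [abs_le]
  constructor <;> linarith

/-- Growth estimate for the squared state of one HIGS whose input is `u / κ + η`, `η² ≤ ε`. -/
theorem IsClosedLoopTrajectory.sq_growth {κ T ε : ℝ} {x : ℝ → Fin n → ℝ} {X : ℝ → Fin N → ℝ}
    (hκ : 0 < κ) (h : IsClosedLoopTrajectory A B C (fun _ => κ) (fun _ => 1) T x X)
    {s t : ℝ} (hs : 0 ≤ s) (hst : s ≤ t) (htT : t ≤ T) (i : Fin N)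
    (hη : ∀ r ∈ Icc s t, ((C *ᵥ x r) i - X r i / κ) ^ 2 ≤ ε) :
    Real.exp (-(4 / κ) * (t - s)) * X t i ^ 2 - X s i ^ 2 ≤ 4 * κ * ε * (t - s) := by
  have hT : 0 ≤ T := hs.trans (hst.trans htT)
  have hX : AbsolutelyContinuousOnInterval (fun r => X r i) s t :=
    AbsolutelyContinuousOnInterval.mono (a := 0) (b := T) (h.controller i).state_ac
      (by rw [uIcc_of_le hst, uIcc_of_le hT]; exact Icc_subset_Icc hs htT)
  -- The weight comes from (u²)′ ≤ 2κe² and e² ≤ 2(u/κ)² + 2ε, which together give (u²)′ ≤ (4/κ)u² +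
  -- 4κε.
  have hexp : AbsolutelyContinuousOnInterval (fun r => Real.exp (-(4 / κ) * (r - s))) s t :=
    ContDiffOn.absolutelyContinuousOnInterval (by fun_prop)
  have hac : AbsolutelyContinuousOnInterval
      (fun r => Real.exp (-(4 / κ) * (r - s)) * (X r i * X r i)) s t :=
    hexp.fun_mul (hX.fun_mul hX)
  have key := hac.sub_le_integral hst (g := fun _ => 4 * κ * ε) (by simp) ?_
  · rw [intervalIntegral.integral_const, smul_eq_mul] at key
    simp only [sub_self, mul_zero, Real.exp_zero, one_mul, ← sq] at key
    linarith
  filter_upwards [h.ae_hasDerivAt_state hT] with r hr hrst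
  have hrT : r ∈ Ioo 0 T := ⟨hs.trans_lt hrst.1, hrst.2.trans_le htT⟩
  obtain ⟨d, hd, hmode⟩ := hr hrT
  have hdi := hasDerivAt_pi.1 hd i
  have hE : HasDerivAt (fun r => Real.exp (-(4 / κ) * (r - s)))
      (Real.exp (-(4 / κ) * (r - s)) * (-(4 / κ))) r := by
    have := (((hasDerivAt_id r).sub_const s).const_mul (-(4 / κ))).exp
    simpa using this
  have hD := (hE.fun_mul (hdi.fun_mul hdi)).deriv
  rw [hD]
  have hsec := sq_sub_le_of_sector hκ ((h.controller i).sector_le (Ioo_subset_Icc_self hrT))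
  have hη' := hη r (Ioo_subset_Icc_self hrst)
  have hm := hmode i
  set e := (C *ᵥ x r) i
  set u := X r i
  -- In the integrator mode this is ue ≤ κe², a consequence of the sector constraint. In the gain
  -- mode it is κ times the defining inequality κeė < e² of the gain region.
  have h1 : u * d i ≤ κ * e ^ 2 := by
    have hue : u * e ≤ κ * e ^ 2 := by
      have h0 : 0 ≤ κ * (e * (e - u / κ)) := mul_nonneg hκ.le ((sq_nonneg _).trans hsec)
      have : κ * (e * (e - u / κ)) = κ * e ^ 2 - u * e := by field_simp
      linarith
    rcases hm with hm | ⟨h2, h3, h4⟩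
    · rw [hm, one_mul]; exact hue
    · rw [h2, h3]
      have : κ * e * (κ * (C *ᵥ (A *ᵥ x r + B *ᵥ X r)) i) =
        κ * (κ * e * (C *ᵥ (A *ᵥ x r + B *ᵥ X r)) i) := by ring
      rw [this]
      apply mul_le_mul_of_nonneg_left _ hκ.le
      linarith
  have h2 : e ^ 2 ≤ 2 * (u / κ) ^ 2 + 2 * ε := by
    nlinarith [sq_nonneg (e - 2 * (u / κ))]
  have h3 : 2 * (κ * e ^ 2) ≤ 4 / κ * u ^ 2 + 4 * κ * ε := by
    have : 2 * (κ * (2 * (u / κ) ^ 2 + 2 * ε)) = 4 / κ * u ^ 2 + 4 * κ * ε := by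
      field_simp; ring
    rw [← this]
    have := mul_le_mul_of_nonneg_left h2 hκ.le
    linarith
  have hε : 0 ≤ ε := (sq_nonneg _).trans hη'
  have hE1 : Real.exp (-(4 / κ) * (r - s)) ≤ 1 := by
    rw [Real.exp_le_one_iff]
    have : 0 ≤ 4 / κ * (r - s) := mul_nonneg (by positivity) (by linarith [hrst.1])
    linarith
  have hE0 := Real.exp_pos (-(4 / κ) * (r - s))
  set E := Real.exp (-(4 / κ) * (r - s))
  have h4 : E * (-(4 / κ)) * (u * u) + E * (d i * u + u * d i) =
      E * (2 * (u * d i) - 4 / κ * u ^ 2) := by ring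
  rw [h4]
  calc E * (2 * (u * d i) - 4 / κ * u ^ 2) ≤ E * (4 * κ * ε) :=
        mul_le_mul_of_nonneg_left (by linarith) hE0.le
    _ ≤ 1 * (4 * κ * ε) := mul_le_mul_of_nonneg_right hE1 (by positivity)
    _ = _ := one_mul _

end

/-! ### Attractivity through limiting orbits -/

section

variable {n N : ℕ} {A : Matrix (Fin n) (Fin n) ℝ} {B : Matrix (Fin n) (Fin N) ℝ}
  {C : Matrix (Fin N) (Fin n) ℝ}

/-- A matrix as a continuous linear map. -/
abbrev toCLM {m n : ℕ} (M : Matrix (Fin m) (Fin n) ℝ) : (Fin n → ℝ) →L[ℝ] (Fin m → ℝ) :=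
  LinearMap.toContinuousLinearMap M.mulVecLin

theorem toCLM_apply {m n : ℕ} (M : Matrix (Fin m) (Fin n) ℝ) (v : Fin n → ℝ) :
    toCLM M v = M *ᵥ v := rfl

theorem norm_mulVec_le {m n : ℕ} (M : Matrix (Fin m) (Fin n) ℝ) (v : Fin n → ℝ) :
    ‖M *ᵥ v‖ ≤ ‖toCLM M‖ * ‖v‖ := (toCLM M).le_opNorm v

theorem hasDerivAt_exp_orbit {E : Type*} [NormedAddCommGroup E] [NormedSpace ℝ E] [CompleteSpace E]
    (M : E →L[ℝ] E) (y₀ : E) (t : ℝ) :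
    HasDerivAt (fun t : ℝ => NormedSpace.exp (t • M) y₀) (M (NormedSpace.exp (t • M) y₀)) t := by
  have h2 := (hasDerivAt_exp_smul_const' M t).clm_apply (hasDerivAt_const t y₀)
  simpa using h2

/-- An observable system whose output vanishes for all positive times has zero state. -/
theorem orbit_eq_zero_of_output_eq_zero
    (hobs : ∀ x : Fin n → ℝ, (∀ j : ℕ, C *ᵥ ((A ^ j) *ᵥ x) = 0) → x = 0) (y₀ : Fin n → ℝ)
    (h : ∀ τ : ℝ, 0 < τ → C *ᵥ (NormedSpace.exp (τ • toCLM A) y₀) = 0) {τ : ℝ} (hτ : 0 < τ) :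
    NormedSpace.exp (τ • toCLM A) y₀ = 0 := by
  have key : ∀ (j : ℕ) (τ : ℝ), 0 < τ →
      C *ᵥ ((A ^ j) *ᵥ (NormedSpace.exp (τ • toCLM A) y₀)) = 0 := by
    intro j
    induction j with
    | zero => simpa using h
    | succ j ih =>
      intro τ hτ
      -- Differentiating an output that vanishes for all positive times puts one more factor `A` in
      -- front of the state.
      have h1 := hasDerivAt_mulVec C (hasDerivAt_mulVec (A ^ j) (hasDerivAt_exp_orbit (toCLM A) y₀ τ))
      have h2 : (fun t : ℝ => C *ᵥ ((A ^ j) *ᵥ (NormedSpace.exp (t • toCLM A) y₀))) =ᶠ[𝓝 τ]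
          fun _ => 0 := by
        filter_upwards [lt_mem_nhds hτ] with t ht using ih t ht
      have h3 := h1.unique ((hasDerivAt_const τ (0 : Fin N → ℝ)).congr_of_eventuallyEq h2)
      rw [pow_succ, ← Matrix.mulVec_mulVec]
      exact h3
  exact hobs _ fun j => key j τ hτ

theorem attractive_of_storage {P : Matrix (Fin n) (Fin n) ℝ} {κ : ℝ} (hPs : Pᵀ = P) (hκ : 0 < κ)
    (hP : ∀ x, x ≠ 0 → 0 < x ⬝ᵥ (P *ᵥ x))
    (hdiss : ∀ x u, (P *ᵥ x) ⬝ᵥ (A *ᵥ x + B *ᵥ u) ≤ u ⬝ᵥ (C *ᵥ (A *ᵥ x + B *ᵥ u)))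
    (hg : ∀ x, κ * ((C *ᵥ x) ⬝ᵥ (C *ᵥ x)) ≤ 1 / 4 * (x ⬝ᵥ (P *ᵥ x)))
    (hobs : ∀ x : Fin n → ℝ, (∀ j : ℕ, C *ᵥ ((A ^ j) *ᵥ x) = 0) → x = 0)
    (hinj : ∀ x : Fin n → ℝ, A *ᵥ x + B *ᵥ (κ • (C *ᵥ x)) = 0 → x = 0)
    {x : ℝ → Fin n → ℝ} {X : ℝ → Fin N → ℝ}
    (h : ∀ T > 0, IsClosedLoopTrajectory A B C (fun _ => κ) (fun _ => 1) T x X) :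
    Tendsto x atTop (𝓝 0) ∧ Tendsto X atTop (𝓝 0) := by
  obtain ⟨c, hc, hlow⟩ := exists_energy_lower_bound hκ hP hg
  have hmono : ∀ s t, 0 ≤ s → s ≤ t →
      energy P C κ (x t) (X t) ≤ energy P C κ (x s) (X s) := fun s t hs hst =>
    (h (t + 1) (by linarith)).energy_antitone hPs hκ hdiss hs hst (by linarith)
  -- boundedness
  obtain ⟨R, hR⟩ : ∃ R, ∀ t, 0 ≤ t → ‖x t‖ ≤ R ∧ ‖X t‖ ≤ R := by
    refine ⟨Real.sqrt (energy P C κ (x 0) (X 0) / c), fun t ht => ?_⟩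
    have h1 := (hlow (x t) (X t)).trans (hmono 0 t le_rfl ht)
    have h2 : ‖((x t, X t) : (Fin n → ℝ) × (Fin N → ℝ))‖ ≤
        Real.sqrt (energy P C κ (x 0) (X 0) / c) := by
      apply Real.le_sqrt_of_sq_le
      rw [le_div_iff₀ hc]; linarith
    exact max_le_iff.1 h2
  have hR0 : 0 ≤ R := (norm_nonneg _).trans (hR 0 le_rfl).1
  have hxd : ∀ t, 0 < t → HasDerivAt x (A *ᵥ x t + B *ᵥ X t) t := fun t ht =>
    (h (t + 1) (by linarith)).hasDerivAt_plant ⟨ht, by linarith⟩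
  have hvel : ∀ t, 0 ≤ t → ‖A *ᵥ x t + B *ᵥ X t‖ ≤ (‖toCLM A‖ + ‖toCLM B‖) * R := fun t ht =>
    calc _ ≤ ‖A *ᵥ x t‖ + ‖B *ᵥ X t‖ := norm_add_le _ _
      _ ≤ ‖toCLM A‖ * R + ‖toCLM B‖ * R := add_le_add
          ((norm_mulVec_le _ _).trans (mul_le_mul_of_nonneg_left (hR t ht).1 (norm_nonneg _)))
          ((norm_mulVec_le _ _).trans (mul_le_mul_of_nonneg_left (hR t ht).2 (norm_nonneg _)))
      _ = _ := by ring
  have hCx : ∀ t, 0 ≤ t → ‖C *ᵥ x t‖ ≤ ‖toCLM C‖ * R := fun t ht =>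
    (norm_mulVec_le _ _).trans (mul_le_mul_of_nonneg_left (hR t ht).1 (norm_nonneg _))
  -- the deviation from the gain mode tends to zero
  set η : ℝ → Fin N → ℝ := fun t => C *ᵥ x t - κ⁻¹ • X t with hηdef
  have hηi : ∀ t i, η t i = (C *ᵥ x t) i - X t i / κ := fun t i => by
    simp [hηdef, div_eq_inv_mul]
  have hη0 : Tendsto η atTop (𝓝 0) := by
    rw [tendsto_pi_nhds]
    intro i
    set V := (‖toCLM A‖ + ‖toCLM B‖) * R with hV
    set L₁ := ‖toCLM C‖ * V with hL₁
    -- The two entries bound the speed of one HIGS state in the integrator and in the gain mode.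
    set L₂ := max (‖toCLM C‖ * R) (κ * L₁) with hL₂
    have hCv : ∀ t, 0 ≤ t → ‖C *ᵥ (A *ᵥ x t + B *ᵥ X t)‖ ≤ L₁ := fun t ht =>
      (norm_mulVec_le _ _).trans (mul_le_mul_of_nonneg_left (hvel t ht) (norm_nonneg _))
    have hLip : ∀ s t, 0 ≤ s → s ≤ t → |η t i - η s i| ≤ (L₁ + L₂ / κ) * (t - s) := by
      intro s t hs hst
      have htr := h (t + 1) (by linarith)
      have hsub : uIcc s t ⊆ uIcc 0 (t + 1) := by
        rw [uIcc_of_le hst, uIcc_of_le (by linarith)]; exact Icc_subset_Icc hs (by linarith)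
      have he : AbsolutelyContinuousOnInterval (fun r => (C *ᵥ x r) i) s t :=
        AbsolutelyContinuousOnInterval.mono (htr.controller i).input_ac hsub
      have hX : AbsolutelyContinuousOnInterval (fun r => X r i) s t :=
        AbsolutelyContinuousOnInterval.mono (htr.controller i).state_ac hsub
      have h1 := he.abs_sub_le hst (L := L₁) (ae_of_all _ fun r hr => by
        have hr0 : 0 < r := hs.trans_lt hr.1
        have := hasDerivAt_pi.1 (hasDerivAt_mulVec C (hxd r hr0)) i
        rw [this.deriv]
        exact (norm_le_pi_norm (C *ᵥ (A *ᵥ x r + B *ᵥ X r)) i).trans (hCv r hr0.le))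
      have h2 := hX.abs_sub_le hst (L := L₂) (by
        filter_upwards [htr.ae_hasDerivAt_state (by linarith)] with r hr hrst
        have hr0 : 0 < r := hs.trans_lt hrst.1
        obtain ⟨d, hd, hm⟩ := hr ⟨hr0, hrst.2.trans (by linarith)⟩
        rw [(hasDerivAt_pi.1 hd i).deriv]
        rcases hm i with hm | ⟨-, hm, -⟩
        · rw [hm, one_mul]
          exact ((norm_le_pi_norm (C *ᵥ x r) i).trans (hCx r hr0.le)).trans (le_max_left _ _)
        · rw [hm, abs_mul, abs_of_pos hκ]
          exact (mul_le_mul_of_nonneg_left ((norm_le_pi_norm (C *ᵥ (A *ᵥ x r + B *ᵥ X r)) i).trans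
            (hCv r hr0.le)) hκ.le).trans (le_max_right _ _))
      rw [hηi, hηi]
      have h3 : (C *ᵥ x t) i - X t i / κ - ((C *ᵥ x s) i - X s i / κ) =
          ((C *ᵥ x t) i - (C *ᵥ x s) i) - (X t i - X s i) / κ := by ring
      rw [h3]
      calc _ ≤ |(C *ᵥ x t) i - (C *ᵥ x s) i| + |(X t i - X s i) / κ| := abs_sub _ _
        _ ≤ L₁ * (t - s) + L₂ * (t - s) / κ := by
            rw [abs_div, abs_of_pos hκ]
            exact add_le_add h1 (div_le_div_of_nonneg_right h2 hκ.le)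
        _ = _ := by ring
    set D := ‖toCLM C‖ * R + R / κ with hD
    have hbd : ∀ t, 0 ≤ t → |η t i| ≤ D := fun t ht => by
      rw [hηi]
      calc _ ≤ |(C *ᵥ x t) i| + |X t i / κ| := abs_sub _ _
        _ ≤ D := by
          rw [abs_div, abs_of_pos hκ]
          exact add_le_add ((norm_le_pi_norm (C *ᵥ x t) i).trans (hCx t ht))
            (div_le_div_of_nonneg_right ((norm_le_pi_norm (X t) i).trans (hR t ht).2) hκ.le)
    set L := L₁ + L₂ / κ with hL
    have hηc : ContinuousOn (fun t => η t i) (Ici 0) := by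
      have hL0 : 0 ≤ L := by
        have := (abs_nonneg _).trans (hLip 0 1 le_rfl zero_le_one)
        linarith
      have : LipschitzOnWith L.toNNReal (fun t => η t i) (Ici 0) := by
        refine LipschitzOnWith.of_dist_le_mul fun s hs t ht => ?_
        rw [Real.dist_eq, Real.dist_eq, Real.coe_toNNReal L hL0]
        rcases le_total s t with hst | hst
        · rw [abs_sub_comm, abs_sub_comm s t, abs_of_nonneg (sub_nonneg.2 hst)]
          exact hLip s t hs hst
        · rw [abs_of_nonneg (sub_nonneg.2 hst)]
          exact hLip t s ht hst
      exact this.continuousOn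
    -- Barbalat applies: η² is Lipschitz because η is bounded and Lipschitz, and its integral is at
    -- most the initial energy because the energy stays nonnegative.
    have hsq : Tendsto (fun t => η t i ^ 2) atTop (𝓝 0) := by
      refine tendsto_zero_of_integral_bounded (K := 2 * D * L)
        (R := energy P C κ (x 0) (X 0)) (fun t _ => sq_nonneg _) (hηc.pow 2) ?_ ?_
      · intro s t hs hst
        have h1 := hLip s t hs hst
        have h2 : |η s i + η t i| ≤ 2 * D :=
          (abs_add_le _ _).trans (by linarith [hbd s hs, hbd t (hs.trans hst)])
        have h3 : |η s i ^ 2 - η t i ^ 2| ≤ 2 * D * L * (t - s) := by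
          have : η s i ^ 2 - η t i ^ 2 = -((η s i + η t i) * (η t i - η s i)) := by ring
          rw [this, abs_neg, abs_mul, mul_assoc (2 * D)]
          exact mul_le_mul h2 h1 (abs_nonneg _) ((abs_nonneg _).trans h2)
        linarith [(abs_le.1 h3).2]
      · intro T hT
        have htr := h (T + 1) (by linarith)
        have h1 := htr.energy_sub_le hPs hκ hdiss le_rfl hT (by linarith)
        have hsub : Icc 0 T ⊆ Icc 0 (T + 1) := Icc_subset_Icc le_rfl (by linarith)
        have h2 : ∫ r in 0..T, η r i ^ 2 ≤ ∫ r in 0..T, dissipation C κ (x r) (X r) := by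
          refine intervalIntegral.integral_mono_on hT ?_ ?_ fun r hr => ?_
          · refine ((hηc.pow 2).mono fun r hr => ?_).intervalIntegrable
            rw [uIcc_of_le hT] at hr; exact hr.1
          · refine ContinuousOn.intervalIntegrable ?_
            rw [uIcc_of_le hT]
            exact continuousOn_dissipation C κ (htr.continuousOn_plant.mono hsub)
              ((htr.continuousOn_state (by linarith)).mono hsub)
          · rw [hηi]
            exact htr.sq_le_dissipation hκ (hsub hr) i
        have h3 : 0 ≤ energy P C κ (x T) (X T) :=
          le_trans (by positivity) (hlow (x T) (X T))
        linarith
    have := (Real.continuous_sqrt.tendsto 0).comp hsq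
    simp only [Real.sqrt_zero, Function.comp_def, Real.sqrt_sq_eq_abs] at this
    simpa using (tendsto_zero_iff_abs_tendsto_zero (fun t => η t i)).2 this
  -- limiting orbit
  set M : Matrix (Fin n) (Fin n) ℝ := A + κ • (B * C) with hM
  have hMx : ∀ v, M *ᵥ v = A *ᵥ v + B *ᵥ (κ • (C *ᵥ v)) := fun v => by
    rw [hM, Matrix.add_mulVec, Matrix.smul_mulVec, Matrix.mulVec_smul, Matrix.mulVec_mulVec]
  have hXη : ∀ t, X t = κ • (C *ᵥ x t) - κ • η t := fun t => by
    simp only [hηdef, smul_sub, smul_smul, mul_inv_cancel₀ hκ.ne', one_smul, sub_sub_cancel]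
  obtain ⟨t, y₀, ht, hlim⟩ := exists_limit_orbit (toCLM M) (y := x)
    (η := fun t => -(κ • (B *ᵥ η t))) (R := R)
    (fun t ht => by
      have := hxd t ht
      rw [hXη t, Matrix.mulVec_sub, Matrix.mulVec_smul _ κ (η t)] at this
      rw [toCLM_apply, hMx]
      exact this.congr_deriv (by abel))
    (fun t ht => (hR t ht).1)
    (by
      have h1 := (((toCLM B).continuous.tendsto 0).comp hη0).const_smul κ |>.neg
      simpa [Function.comp_def, toCLM_apply] using h1)
  set z : ℝ → Fin n → ℝ := fun τ => NormedSpace.exp (τ • toCLM M) y₀ with hz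
  have hzd : ∀ τ, HasDerivAt z (M *ᵥ z τ) τ := fun τ => hasDerivAt_exp_orbit (toCLM M) y₀ τ
  have htτ : ∀ τ, Tendsto (fun n => t n + τ) atTop atTop := fun τ =>
    tendsto_atTop_add_const_right _ _ ht
  have hClim : ∀ τ, 0 ≤ τ → Tendsto (fun n => C *ᵥ x (t n + τ)) atTop (𝓝 (C *ᵥ z τ)) :=
    fun τ hτ => ((toCLM C).continuous.tendsto _).comp (hlim τ hτ)
  have hXlim : ∀ τ, 0 ≤ τ → Tendsto (fun n => X (t n + τ)) atTop (𝓝 (κ • (C *ᵥ z τ))) :=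
    fun τ hτ => by
      simp_rw [hXη]
      have := ((hClim τ hτ).const_smul κ).sub ((hη0.comp (htτ τ)).const_smul κ)
      simpa [Function.comp_def] using this
  have hzR : ∀ τ, 0 ≤ τ → ‖z τ‖ ≤ R := fun τ hτ => by
    refine le_of_tendsto (hlim τ hτ).norm ?_
    filter_upwards [(htτ τ).eventually_ge_atTop 0] with n hn using (hR _ hn).1
  -- The growth estimate is applied along the shifted trajectories, where eventually `η² ≤ ε`.
  -- Passing to the limit orbit and then letting `ε → 0` leaves e^{−(4/κ)(b−a)} times the later
  -- squared output bounded by the earlier one, which is zero.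
  have hzero : ∀ i a b, 0 ≤ a → a ≤ b → (C *ᵥ z a) i = 0 → (C *ᵥ z b) i = 0 := by
    intro i a b ha hab h0
    have hXi : ∀ τ, 0 ≤ τ → Tendsto (fun n => X (t n + τ) i ^ 2) atTop
        (𝓝 ((κ * (C *ᵥ z τ) i) ^ 2)) := fun τ hτ =>
      ((tendsto_pi_nhds.1 (hXlim τ hτ)) i).pow 2
    have key : ∀ ε > 0, Real.exp (-(4 / κ) * (b - a)) * (κ * (C *ᵥ z b) i) ^ 2
        - (κ * (C *ᵥ z a) i) ^ 2 ≤ 4 * κ * ε * (b - a) := by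
      intro ε hε
      refine le_of_tendsto (((hXi b (ha.trans hab)).const_mul _).sub (hXi a ha)) ?_
      have h1 : ∀ᶠ r in atTop, η r i ^ 2 ≤ ε := by
        have := ((tendsto_pi_nhds.1 hη0 i).pow 2)
        simp only [Pi.zero_apply, ne_eq, OfNat.ofNat_ne_zero, not_false_eq_true, zero_pow] at this
        exact (this.eventually (gt_mem_nhds hε)).mono fun _ h => h.le
      obtain ⟨r₀, hr₀⟩ := eventually_atTop.1 h1
      filter_upwards [(htτ a).eventually_ge_atTop (max r₀ 0)] with n hn
      have hn0 : 0 ≤ t n + a := (le_max_right _ _).trans hn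
      have htr := h (t n + b + 1) (by linarith)
      have := htr.sq_growth hκ (s := t n + a) (t := t n + b) (ε := ε) hn0 (by linarith)
        (by linarith) i (fun r hr => by
          rw [← hηi]; exact hr₀ r (((le_max_left _ _).trans hn).trans hr.1))
      have hs : t n + b - (t n + a) = b - a := by ring
      rwa [hs] at this
    have hle : Real.exp (-(4 / κ) * (b - a)) * (κ * (C *ᵥ z b) i) ^ 2 ≤ 0 := by
      refine le_of_forall_pos_le_add fun ε hε => ?_
      have hden : 0 < 4 * κ * (b - a) + 1 := by
        have : 0 ≤ 4 * κ * (b - a) := mul_nonneg (by positivity) (by linarith)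
        linarith
      have h1 := key (ε / (4 * κ * (b - a) + 1)) (by positivity)
      rw [h0, mul_zero, zero_pow two_ne_zero, sub_zero] at h1
      refine h1.trans ?_
      have : 4 * κ * (ε / (4 * κ * (b - a) + 1)) * (b - a) =
        ε * ((4 * κ * (b - a)) / (4 * κ * (b - a) + 1)) := by ring
      rw [this, zero_add]
      apply mul_le_of_le_one_right hε.le
      rw [div_le_one hden]; linarith
    have h2 : (κ * (C *ᵥ z b) i) ^ 2 ≤ 0 :=
      nonpos_of_mul_nonpos_right hle (Real.exp_pos _)
    have h3 := pow_eq_zero_iff (two_ne_zero) |>.1 (le_antisymm h2 (sq_nonneg _))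
    exact (mul_eq_zero.1 h3).resolve_left hκ.ne'
  -- the output of the limiting orbit tends to zero
  have hCz : Tendsto (fun τ => C *ᵥ z τ) atTop (𝓝 0) := by
    rw [tendsto_pi_nhds]
    intro i
    have hzi : ∀ τ, HasDerivAt (fun τ => (C *ᵥ z τ) i) ((C *ᵥ (M *ᵥ z τ)) i) τ := fun τ =>
      hasDerivAt_pi.1 (hasDerivAt_mulVec C (hzd τ)) i
    have hcont : Continuous fun τ => (C *ᵥ z τ) i :=
      continuous_iff_continuousAt.2 fun τ => (hzi τ).continuousAt
    by_cases hex : ∃ a, 0 ≤ a ∧ (C *ᵥ z a) i = 0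
    · obtain ⟨a, ha, h0⟩ := hex
      refine tendsto_const_nhds.congr' ?_
      filter_upwards [eventually_ge_atTop a] with b hb
      exact (hzero i a b ha hb h0).symm
    push Not at hex
    -- A component that never vanishes keeps its sign, by the intermediate value theorem.
    obtain ⟨σ, hσ, hsign⟩ : ∃ σ : ℝ, |σ| = 1 ∧ ∀ τ, 0 ≤ τ → 0 ≤ σ * (C *ᵥ z τ) i := by
      rcases lt_or_gt_of_ne (hex 0 le_rfl) with h0 | h0
      · refine ⟨-1, by simp, fun τ hτ => ?_⟩
        by_contra hcon
        obtain ⟨a, ha, ha0⟩ := intermediate_value_Icc hτ hcont.continuousOn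
          (show (0 : ℝ) ∈ Icc _ _ from ⟨h0.le, by linarith⟩)
        exact hex a ha.1 ha0
      · refine ⟨1, by simp, fun τ hτ => ?_⟩
        by_contra hcon
        obtain ⟨a, ha, ha0⟩ := intermediate_value_Icc' hτ hcont.continuousOn
          (show (0 : ℝ) ∈ Icc _ _ from ⟨by linarith, h0.le⟩)
        exact hex a ha.1 ha0
    -- A left inverse of `M` exhibits the output as the derivative of a linear function of `z`.
    -- Since `z` is bounded, so is the integral of the output, which its constant sign makes usable
    -- in Barbalat's lemma.
    have hMinj : LinearMap.ker M.mulVecLin = ⊥ := by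
      rw [LinearMap.ker_eq_bot']
      intro v hv
      rw [Matrix.mulVecLin_apply, hMx] at hv
      exact hinj v hv
    obtain ⟨L, hL⟩ := M.mulVecLin.exists_leftInverse_of_injective hMinj
    set G := (LinearMap.proj i).comp ((C.mulVecLin).comp L) with hG
    set Gc := LinearMap.toContinuousLinearMap G with hGc
    have hGM : ∀ v, Gc (M *ᵥ v) = (C *ᵥ v) i := fun v => by
      have : L (M *ᵥ v) = v := by
        have := LinearMap.congr_fun hL v
        simpa using this
      simp [hGc, hG, this]
    have hint : ∀ T, ∫ τ in 0..T, σ * (C *ᵥ z τ) i = σ * Gc (z T) - σ * Gc (z 0) := fun T => by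
      have hσc : Continuous fun τ => σ * (C *ᵥ z τ) i := continuous_const.mul hcont
      refine intervalIntegral.integral_eq_sub_of_hasDerivAt (f := fun τ => σ * Gc (z τ))
        (fun τ _ => ?_) (hσc.intervalIntegrable 0 T)
      have := (Gc.hasFDerivAt.comp_hasDerivAt τ (hzd τ)).const_mul σ
      rwa [hGM] at this
    have hlimσ : Tendsto (fun τ => σ * (C *ᵥ z τ) i) atTop (𝓝 0) := by
      refine tendsto_zero_of_integral_bounded (K := ‖toCLM C‖ * (‖toCLM M‖ * R))
        (R := 2 * (‖Gc‖ * R)) hsign (continuous_const.mul hcont).continuousOn ?_ ?_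
      · intro s t hs hst
        have hlip : ‖(C *ᵥ z t) i - (C *ᵥ z s) i‖ ≤ ‖toCLM C‖ * (‖toCLM M‖ * R) * ‖t - s‖ := by
          refine (convex_Icc s t).norm_image_sub_le_of_norm_hasDerivWithin_le
            (fun τ _ => (hzi τ).hasDerivWithinAt) (fun τ hτ => ?_)
            (left_mem_Icc.2 hst) (right_mem_Icc.2 hst)
          refine (norm_le_pi_norm (C *ᵥ (M *ᵥ z τ)) i).trans ((norm_mulVec_le _ _).trans ?_)
          refine mul_le_mul_of_nonneg_left ((norm_mulVec_le _ _).trans ?_) (norm_nonneg _)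
          exact mul_le_mul_of_nonneg_left (hzR τ (hs.trans hτ.1)) (norm_nonneg _)
        rw [Real.norm_eq_abs, Real.norm_eq_abs, abs_of_nonneg (sub_nonneg.2 hst)] at hlip
        have h2 : |σ * (C *ᵥ z t) i - σ * (C *ᵥ z s) i| ≤
            ‖toCLM C‖ * (‖toCLM M‖ * R) * (t - s) := by
          rw [← mul_sub, abs_mul, hσ, one_mul]; exact hlip
        linarith [(abs_le.1 h2).1]
      · intro T hT
        rw [hint]
        have hb : ∀ τ, 0 ≤ τ → |σ * Gc (z τ)| ≤ ‖Gc‖ * R := fun τ hτ => by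
          rw [abs_mul, hσ, one_mul]
          exact (Gc.le_opNorm _).trans (mul_le_mul_of_nonneg_left (hzR τ hτ) (norm_nonneg _))
        have h1 := (abs_le.1 (hb T hT)).2
        have h2 := (abs_le.1 (hb 0 le_rfl)).1
        linarith
    have habs := hlimσ.abs
    simp only [abs_mul, hσ, one_mul, abs_zero] at habs
    simpa using (tendsto_zero_iff_abs_tendsto_zero (fun τ => (C *ᵥ z τ) i)).2 habs
  -- hence the limiting orbit comes close to the origin
  obtain ⟨s, z₀, hs, hslim⟩ := exists_limit_orbit (toCLM A) (y := z)
    (η := fun τ => B *ᵥ (κ • (C *ᵥ z τ))) (R := R)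
    (fun τ _ => by rw [toCLM_apply, ← hMx]; exact hzd τ) hzR
    (by
      have h1 := ((toCLM B).continuous.tendsto _).comp (hCz.const_smul κ)
      simp only [smul_zero, map_zero] at h1
      exact h1)
  -- The time 1 is arbitrary; vanishing is available at positive times only.
  have hz1 : NormedSpace.exp ((1 : ℝ) • toCLM A) z₀ = 0 := by
    refine orbit_eq_zero_of_output_eq_zero hobs z₀ (fun τ hτ => ?_) one_pos
    have h1 : Tendsto (fun n => C *ᵥ z (s n + τ)) atTop
        (𝓝 (C *ᵥ (NormedSpace.exp (τ • toCLM A) z₀))) :=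
      ((toCLM C).continuous.tendsto _).comp (hslim τ hτ.le)
    exact tendsto_nhds_unique h1 (hCz.comp (tendsto_atTop_add_const_right _ τ hs))
  have hz0 : Tendsto (fun n => z (s n + 1)) atTop (𝓝 0) := by
    have := hslim 1 zero_le_one
    rwa [hz1] at this
  have hWz : Tendsto (fun n => energy P C κ (z (s n + 1)) (κ • (C *ᵥ z (s n + 1)))) atTop
      (𝓝 0) := by
    have h1 : Tendsto (fun n => (z (s n + 1), κ • (C *ᵥ z (s n + 1)))) atTop
        (𝓝 ((0 : Fin n → ℝ), κ • (C *ᵥ (0 : Fin n → ℝ)))) :=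
      hz0.prodMk_nhds ((((toCLM C).continuous.tendsto _).comp hz0).const_smul κ)
    have h2 := ((continuous_energy P C κ).tendsto _).comp h1
    have h3 : energy P C κ (0 : Fin n → ℝ) (κ • (C *ᵥ (0 : Fin n → ℝ))) = 0 := by simp [energy]
    simp only [h3] at h2
    exact h2
  -- Two approximations are chained: `z` comes close to the origin, and the trajectory comes close
  -- to that point of `z`, with `X` close to `κ • (C *ᵥ z)`.
  have hsmall : ∀ ε > 0, ∃ r, 0 ≤ r ∧ energy P C κ (x r) (X r) < ε := by
    intro ε hε
    obtain ⟨m, hm1, hm2⟩ := ((hWz.eventually (gt_mem_nhds hε)).and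
      ((tendsto_atTop_add_const_right _ (1 : ℝ) hs).eventually_ge_atTop 0)).exists
    have h1 := (hlim _ hm2).prodMk_nhds (hXlim _ hm2)
    have h2 := ((continuous_energy P C κ).tendsto _).comp h1
    obtain ⟨k, hk1, hk2⟩ := ((h2.eventually (gt_mem_nhds hm1)).and
      ((htτ (s m + 1)).eventually_ge_atTop 0)).exists
    exact ⟨_, hk2, hk1⟩
  -- Monotonicity of the energy upgrades one small value to smallness at all later times.
  have hfinal : Tendsto (fun t => (x t, X t)) atTop (𝓝 (0 : (Fin n → ℝ) × (Fin N → ℝ))) := by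
    rw [Metric.tendsto_atTop]
    intro ε hε
    obtain ⟨r, hr, hr'⟩ := hsmall (c * ε ^ 2) (by positivity)
    refine ⟨r, fun t htr => ?_⟩
    rw [dist_zero_right]
    have h1 := (hlow (x t) (X t)).trans (hmono r t hr htr)
    have h2 : c * ‖((x t, X t) : (Fin n → ℝ) × (Fin N → ℝ))‖ ^ 2 < c * ε ^ 2 :=
      lt_of_le_of_lt h1 hr'
    exact lt_of_pow_lt_pow_left₀ 2 hε.le (lt_of_mul_lt_mul_left h2 hc.le)
  exact ⟨(continuous_fst.tendsto _).comp hfinal, (continuous_snd.tendsto _).comp hfinal⟩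

end

/-! ### Complexification of real matrices -/

section Complexify

variable {l m n : ℕ}

/-- The complexification of a real matrix. -/
abbrev toC (M : Matrix (Fin m) (Fin n) ℝ) : Matrix (Fin m) (Fin n) ℂ := M.map Complex.ofReal

theorem toC_mul (M : Matrix (Fin l) (Fin m) ℝ) (M' : Matrix (Fin m) (Fin n) ℝ) :
    toC (M * M') = toC M * toC M' := Matrix.map_mul (f := Complex.ofRealHom)

theorem toC_add (M M' : Matrix (Fin m) (Fin n) ℝ) : toC (M + M') = toC M + toC M' := by
  ext; simp

theorem toC_one : toC (1 : Matrix (Fin n) (Fin n) ℝ) = 1 :=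
  Matrix.map_one _ Complex.ofReal_zero Complex.ofReal_one

theorem toC_pow (M : Matrix (Fin n) (Fin n) ℝ) (j : ℕ) : toC (M ^ j) = toC M ^ j := by
  induction j with
  | zero => simp only [pow_zero, toC_one]
  | succ j ih => rw [pow_succ, pow_succ, toC_mul, ih]

theorem toC_conjTranspose (M : Matrix (Fin m) (Fin n) ℝ) : (toC M)ᴴ = toC Mᵀ := by
  ext; simp

theorem toC_mulVec_re (M : Matrix (Fin m) (Fin n) ℝ) (v : Fin n → ℂ) (i : Fin m) :
    ((toC M *ᵥ v) i).re = (M *ᵥ fun k => (v k).re) i := by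
  simp [Matrix.mulVec, dotProduct]

theorem toC_mulVec_im (M : Matrix (Fin m) (Fin n) ℝ) (v : Fin n → ℂ) (i : Fin m) :
    ((toC M *ᵥ v) i).im = (M *ᵥ fun k => (v k).im) i := by
  simp [Matrix.mulVec, dotProduct]

theorem toC_mulVec_star (M : Matrix (Fin m) (Fin n) ℝ) (v : Fin n → ℂ) :
    toC M *ᵥ star v = star (toC M *ᵥ v) := by
  ext i
  simp [Matrix.mulVec, dotProduct]

theorem toC_mulVec_ofReal (M : Matrix (Fin m) (Fin n) ℝ) (v : Fin n → ℝ) :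
    toC M *ᵥ (fun k => (v k : ℂ)) = fun k => (((M *ᵥ v) k : ℝ) : ℂ) := by
  ext i
  simp [Matrix.mulVec, dotProduct]

end Complexify

/-! ### Minimal realizations are controllable and observable -/

section Kalman

variable {n N : ℕ} {A : Matrix (Fin n) (Fin n) ℝ} {B : Matrix (Fin n) (Fin N) ℝ}
  {C : Matrix (Fin N) (Fin n) ℝ}

theorem toC_resolvent_mul {m : ℕ} {A' : Matrix (Fin m) (Fin m) ℝ} {T : Matrix (Fin n) (Fin m) ℝ}
    (hT : A * T = T * A') {s : ℂ} (hs : IsRegularPoint A s) (hs' : IsRegularPoint A' s) :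
    (s • (1 : Matrix (Fin n) (Fin n) ℂ) - toC A)⁻¹ * toC T =
      toC T * (s • (1 : Matrix (Fin m) (Fin m) ℂ) - toC A')⁻¹ := by
  have h1 : (s • (1 : Matrix (Fin n) (Fin n) ℂ) - toC A) * toC T =
      toC T * (s • (1 : Matrix (Fin m) (Fin m) ℂ) - toC A') := by
    rw [Matrix.sub_mul, Matrix.mul_sub, ← toC_mul, ← toC_mul, hT]
    simp
  have hu : IsUnit (s • (1 : Matrix (Fin n) (Fin n) ℂ) - toC A).det := isUnit_iff_ne_zero.2 hs
  have hu' : IsUnit (s • (1 : Matrix (Fin m) (Fin m) ℂ) - toC A').det := isUnit_iff_ne_zero.2 hs'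
  calc _ = (s • (1 : Matrix (Fin n) (Fin n) ℂ) - toC A)⁻¹ * (toC T *
      ((s • (1 : Matrix (Fin m) (Fin m) ℂ) - toC A') *
        (s • (1 : Matrix (Fin m) (Fin m) ℂ) - toC A')⁻¹)) := by
        rw [Matrix.mul_nonsing_inv _ hu', Matrix.mul_one]
    _ = ((s • (1 : Matrix (Fin n) (Fin n) ℂ) - toC A)⁻¹ *
      (s • (1 : Matrix (Fin n) (Fin n) ℂ) - toC A)) * toC T *
        (s • (1 : Matrix (Fin m) (Fin m) ℂ) - toC A')⁻¹ := by
        rw [← Matrix.mul_assoc (toC T), ← h1]; simp only [Matrix.mul_assoc]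
    _ = _ := by rw [Matrix.nonsing_inv_mul _ hu, Matrix.one_mul]

/-- A nonzero `p` orthogonal to all columns of `A ^ j * B` makes {x : p ⬝ A^j x = 0 for all j} an
`A`-invariant subspace containing the columns of `B`. It is proper, as it misses `p`. Restricting
the system to it would realize the same transfer matrix in smaller dimension. -/
theorem IsMinimalRealization.controllable (h : IsMinimalRealization A B C) (p : Fin n → ℝ)
    (hp : ∀ j : ℕ, p ᵥ* (A ^ j * B) = 0) : p = 0 := by
  by_contra hne
  let W : Submodule ℝ (Fin n → ℝ) :=
    { carrier := {x | ∀ j : ℕ, p ⬝ᵥ ((A ^ j) *ᵥ x) = 0}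
      add_mem' := fun {x y} hx hy j => by rw [Matrix.mulVec_add, dotProduct_add, hx, hy, add_zero]
      zero_mem' := fun j => by simp
      smul_mem' := fun c x hx j => by rw [Matrix.mulVec_smul, dotProduct_smul, hx, smul_zero] }
  have hWA : ∀ x ∈ W, A *ᵥ x ∈ W := fun x hx j => by
    rw [Matrix.mulVec_mulVec, ← pow_succ]; exact hx (j + 1)
  have hWB : ∀ k, B.col k ∈ W := fun k j => by
    rw [← Matrix.mulVec_single_one, Matrix.mulVec_mulVec, Matrix.dotProduct_mulVec, hp j,
      zero_dotProduct]
  have hWlt : Module.finrank ℝ W < n := by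
    have : W ≠ ⊤ := fun htop => by
      have h1 : p ∈ W := by rw [htop]; trivial
      have h2 := h1 0
      rw [pow_zero, Matrix.one_mulVec, dotProduct_self_eq_zero] at h2
      exact hne h2
    have := Submodule.finrank_lt this
    simpa using this
  set m := Module.finrank ℝ W
  let b : Module.Basis (Fin m) ℝ W := Module.finBasis ℝ W
  -- The columns of `T` are a basis of `W`; the restricted system is then characterized by `A * T =
  -- T * A'` and `B = T * B'`.
  let T : Matrix (Fin n) (Fin m) ℝ := Matrix.of fun i k => (b k : Fin n → ℝ) i
  have hT : ∀ y ∈ W, ∃ c : Fin m → ℝ, T *ᵥ c = y := fun y hy => by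
    refine ⟨b.repr ⟨y, hy⟩, ?_⟩
    have h1 := congrArg (fun z : W => (z : Fin n → ℝ)) (b.sum_repr ⟨y, hy⟩)
    simp only [Submodule.coe_sum, Submodule.coe_smul] at h1
    refine Eq.trans ?_ h1
    ext i
    simp [T, Matrix.mulVec, dotProduct, mul_comm]
  choose a ha using fun l : Fin m => hT _ (hWA _ (b l).2)
  choose β hβ using fun k : Fin N => hT _ (hWB k)
  let A' : Matrix (Fin m) (Fin m) ℝ := Matrix.of fun k l => a l k
  let B' : Matrix (Fin m) (Fin N) ℝ := Matrix.of fun k l => β l k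
  have hAT : A * T = T * A' := by
    ext i l
    exact (congrFun (ha l) i).symm
  have hBT : B = T * B' := by
    ext i l
    exact (congrFun (hβ l) i).symm
  refine absurd (h m A' B' (C * T) fun s hs hs' => ?_) (not_le.2 hWlt)
  have := toC_resolvent_mul hAT hs hs'
  unfold transferMatrix
  change toC C * _ * toC B = toC (C * T) * _ * toC B'
  rw [toC_mul, Matrix.mul_assoc (toC C) (toC T), ← this, hBT, toC_mul]
  simp only [Matrix.mul_assoc]

/-- Transposition maps realizations of G to realizations of Gᵀ without changing the dimension, so
observability becomes controllability of the dual system. -/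
theorem IsMinimalRealization.transpose (h : IsMinimalRealization A B C) :
    IsMinimalRealization Aᵀ Cᵀ Bᵀ := by
  have hreg : ∀ {k : ℕ} (M : Matrix (Fin k) (Fin k) ℝ) (s : ℂ),
      IsRegularPoint M s → IsRegularPoint Mᵀ s := fun M s hs => by
    unfold IsRegularPoint at hs ⊢
    rw [← Matrix.det_transpose]
    simpa [Matrix.transpose_map] using hs
  have htr : ∀ {k : ℕ} (M : Matrix (Fin k) (Fin k) ℝ) (F : Matrix (Fin k) (Fin N) ℝ)
      (H : Matrix (Fin N) (Fin k) ℝ) (s : ℂ),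
      transferMatrix Mᵀ Hᵀ Fᵀ s = (transferMatrix M F H s)ᵀ := fun M F H s => by
    unfold transferMatrix
    simp [Matrix.transpose_mul, Matrix.transpose_nonsing_inv, Matrix.transpose_map, Matrix.mul_assoc]
  intro m A' B' C' hsame
  refine h m A'ᵀ C'ᵀ B'ᵀ fun s hs hs' => ?_
  have h1 := hsame s (hreg A s hs) (by simpa using hreg A'ᵀ s hs')
  rw [htr A B C] at h1
  rw [htr A' B' C', ← h1, Matrix.transpose_transpose]

theorem IsMinimalRealization.observable (h : IsMinimalRealization A B C) (x : Fin n → ℝ)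
    (hx : ∀ j : ℕ, C *ᵥ ((A ^ j) *ᵥ x) = 0) : x = 0 := by
  refine h.transpose.controllable x fun j => ?_
  rw [← Matrix.transpose_pow, ← Matrix.transpose_mul, Matrix.vecMul_transpose,
    ← Matrix.mulVec_mulVec, hx j]

theorem IsMinimalRealization.controllable_complex (h : IsMinimalRealization A B C) (p : Fin n → ℂ)
    (hp : ∀ j : ℕ, p ᵥ* (toC A ^ j * toC B) = 0) : p = 0 := by
  have h1 : ∀ j : ℕ, toC (A ^ j * B)ᵀ *ᵥ p = 0 := fun j => by
    have := hp j
    rw [← toC_pow, ← toC_mul] at this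
    rw [← this, ← Matrix.mulVec_transpose]
    rfl
  have hre := h.controllable (fun k => (p k).re) fun j => by
    rw [← Matrix.mulVec_transpose]
    ext i
    rw [← toC_mulVec_re, h1]; rfl
  have him := h.controllable (fun k => (p k).im) fun j => by
    rw [← Matrix.mulVec_transpose]
    ext i
    rw [← toC_mulVec_im, h1]; rfl
  ext k
  exact Complex.ext (congrFun hre k) (congrFun him k)

theorem IsMinimalRealization.observable_complex (h : IsMinimalRealization A B C) (x : Fin n → ℂ)
    (hx : ∀ j : ℕ, toC C *ᵥ ((toC A ^ j) *ᵥ x) = 0) : x = 0 := by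
  refine h.transpose.controllable_complex x fun j => ?_
  have h1 : toC Aᵀ ^ j * toC Cᵀ = (toC C * toC A ^ j)ᵀ := by
    rw [Matrix.transpose_mul, Matrix.transpose_pow]; rfl
  rw [h1, Matrix.vecMul_transpose, ← Matrix.mulVec_mulVec, hx j]

end Kalman

/-! ### Spanning form of controllability -/

/-- A proper span lies in the kernel of a nonzero functional, and such a functional is a row vector
annihilating all `a ^ j * b`. -/
theorem span_columns_eq_top {n N : ℕ} {K : Type*} [Field K] {a : Matrix (Fin n) (Fin n) K}
    {b : Matrix (Fin n) (Fin N) K} (h : ∀ p : Fin n → K, (∀ j : ℕ, p ᵥ* (a ^ j * b) = 0) → p = 0) :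
    Submodule.span K (range fun q : ℕ × Fin N => (a ^ q.1 * b).col q.2) = ⊤ := by
  by_contra hne
  obtain ⟨f, hf, hle⟩ := Submodule.exists_le_ker_of_lt_top _ (lt_top_iff_ne_top.2 hne)
  apply hf
  have hfp : ∀ v, f v = (fun i => f (Pi.single i 1)) ⬝ᵥ v := fun v => by
    conv_lhs => rw [pi_eq_sum_univ' v]
    rw [map_sum]
    refine Finset.sum_congr rfl fun i _ => ?_
    rw [map_smul, smul_eq_mul, mul_comm]
  have hp := h (fun i => f (Pi.single i 1)) fun j => by
    ext k
    have h1 : (a ^ j * b).col k ∈ LinearMap.ker f := hle (Submodule.subset_span ⟨(j, k), rfl⟩)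
    rw [LinearMap.mem_ker, hfp] at h1
    exact h1
  ext i
  simpa using congrFun hp i

/-! ### Resolvents of complex matrices -/

section Resolvent

variable {n N : ℕ}

/-- The resolvent `(s I - a)⁻¹` of a complex matrix. -/
def resolventMatrix (a : Matrix (Fin n) (Fin n) ℂ) (s : ℂ) : Matrix (Fin n) (Fin n) ℂ :=
  (s • (1 : Matrix (Fin n) (Fin n) ℂ) - a)⁻¹

variable {a : Matrix (Fin n) (Fin n) ℂ} {s : ℂ}

theorem mul_resolventMatrix (h : (s • (1 : Matrix (Fin n) (Fin n) ℂ) - a).det ≠ 0) :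
    a * resolventMatrix a s = s • resolventMatrix a s - 1 := by
  have h1 := Matrix.mul_nonsing_inv _ (isUnit_iff_ne_zero.2 h)
  rw [Matrix.sub_mul, Matrix.smul_mul, Matrix.one_mul] at h1
  change s • resolventMatrix a s - a * resolventMatrix a s = 1 at h1
  rw [← h1]; abel

theorem resolventMatrix_mul (h : (s • (1 : Matrix (Fin n) (Fin n) ℂ) - a).det ≠ 0) :
    resolventMatrix a s * a = s • resolventMatrix a s - 1 := by
  have h1 := Matrix.nonsing_inv_mul _ (isUnit_iff_ne_zero.2 h)
  rw [Matrix.mul_sub, Matrix.mul_smul, Matrix.mul_one] at h1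
  change s • resolventMatrix a s - resolventMatrix a s * a = 1 at h1
  rw [← h1]; abel

theorem finite_setOf_det_eq_zero (a : Matrix (Fin n) (Fin n) ℂ) :
    {s : ℂ | (s • (1 : Matrix (Fin n) (Fin n) ℂ) - a).det = 0}.Finite := by
  refine (Polynomial.finite_setOfPred_isRoot a.charpoly_monic.ne_zero).subset fun s hs => ?_
  change a.charpoly.eval s = 0
  rw [Matrix.eval_charpoly, ← hs.out]
  congr 2
  ext i j; simp [Matrix.one_apply, Matrix.diagonal_apply]

theorem eventually_det_ne_zero (a : Matrix (Fin n) (Fin n) ℂ) (s₀ : ℂ) :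
    ∀ᶠ s in 𝓝[≠] s₀, (s • (1 : Matrix (Fin n) (Fin n) ℂ) - a).det ≠ 0 :=
  by
  filter_upwards [(((finite_setOf_det_eq_zero a).subset sdiff_subset).isClosed (s := _ \ {s₀})).isOpen_compl.mem_nhds
    (show s₀ ∈ _ from fun h => h.2 rfl) |> mem_nhdsWithin_of_mem_nhds, self_mem_nhdsWithin]
    with s hs hne h0
  exact hs ⟨h0, hne⟩

theorem analyticAt_det {m : ℕ} {M : ℂ → Matrix (Fin m) (Fin m) ℂ} {s₀ : ℂ}
    (h : ∀ i j, AnalyticAt ℂ (fun s => M s i j) s₀) : AnalyticAt ℂ (fun s => (M s).det) s₀ := by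
  simp only [Matrix.det_apply]
  refine Finset.analyticAt_fun_sum _ fun σ _ => ?_
  simp only [Units.smul_def, zsmul_eq_mul]
  exact analyticAt_const.mul (Finset.analyticAt_fun_prod _ fun i _ => h _ _)

theorem analyticAt_adjugate {m : ℕ} {M : ℂ → Matrix (Fin m) (Fin m) ℂ} {s₀ : ℂ}
    (h : ∀ i j, AnalyticAt ℂ (fun s => M s i j) s₀) (i j : Fin m) :
    AnalyticAt ℂ (fun s => (M s).adjugate i j) s₀ := by
  simp only [Matrix.adjugate_apply]
  refine analyticAt_det fun k l => ?_
  simp only [Matrix.updateRow_apply]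
  split_ifs
  · exact analyticAt_const
  · exact h k l

theorem analyticAt_pencil (a : Matrix (Fin n) (Fin n) ℂ) (s₀ : ℂ) (i j : Fin n) :
    AnalyticAt ℂ (fun s : ℂ => (s • (1 : Matrix (Fin n) (Fin n) ℂ) - a) i j) s₀ := by
  simp only [Matrix.sub_apply, Matrix.smul_apply, smul_eq_mul]
  fun_prop

theorem meromorphicAt_resolventMatrix (a : Matrix (Fin n) (Fin n) ℂ) (s₀ : ℂ) (i j : Fin n) :
    MeromorphicAt (fun s => resolventMatrix a s i j) s₀ := by
  simp only [resolventMatrix, Matrix.inv_def, Matrix.smul_apply, smul_eq_mul, Ring.inverse_eq_inv']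
  exact (analyticAt_det (analyticAt_pencil a s₀)).meromorphicAt.inv.mul
    (analyticAt_adjugate (analyticAt_pencil a s₀) i j).meromorphicAt

theorem analyticAt_resolventMatrix {s₀ : ℂ}
    (h : (s₀ • (1 : Matrix (Fin n) (Fin n) ℂ) - a).det ≠ 0) (i j : Fin n) :
    AnalyticAt ℂ (fun s => resolventMatrix a s i j) s₀ := by
  simp only [resolventMatrix, Matrix.inv_def, Matrix.smul_apply, smul_eq_mul, Ring.inverse_eq_inv']
  exact ((analyticAt_det (analyticAt_pencil a s₀)).inv h).mul
    (analyticAt_adjugate (analyticAt_pencil a s₀) i j)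

/-- Convergence of a scalar multiple of the transfer matrix of a controllable and observable
system implies convergence of the same multiple of the resolvent. -/
theorem exists_tendsto_resolventMatrix {b : Matrix (Fin n) (Fin N) ℂ}
    {c : Matrix (Fin N) (Fin n) ℂ} (hctr : ∀ p : Fin n → ℂ, (∀ j : ℕ, p ᵥ* (a ^ j * b) = 0) → p = 0)
    (hobs : ∀ x : Fin n → ℂ, (∀ j : ℕ, c *ᵥ ((a ^ j) *ᵥ x) = 0) → x = 0)
    {φ : ℂ → ℂ} {s₀ φ₀ : ℂ} (hφ : Tendsto φ (𝓝[≠] s₀) (𝓝 φ₀))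
    (h : ∀ i j, ∃ ℓ, Tendsto (fun s => φ s * (c * resolventMatrix a s * b) i j) (𝓝[≠] s₀) (𝓝 ℓ)) :
    ∃ F, Tendsto (fun s => φ s • resolventMatrix a s) (𝓝[≠] s₀) (𝓝 F) := by
  -- Since aR = Ra = sR − 1 and `φ` itself converges, the pairs (v, w) for which φ·vR(s)w converges
  -- are stable under `a` on either side, as well as under linear combinations. Starting from rows
  -- of `c` and columns of `b`, observability and controllability reach all pairs.
  let Conv : (Fin n → ℂ) → (Fin n → ℂ) → Prop := fun v w =>
    ∃ ℓ, Tendsto (fun s => φ s * (v ⬝ᵥ (resolventMatrix a s *ᵥ w))) (𝓝[≠] s₀) (𝓝 ℓ)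
  have hid : Tendsto (fun s : ℂ => s) (𝓝[≠] s₀) (𝓝 s₀) := tendsto_id.mono_left nhdsWithin_le_nhds
  have hr : ∀ v w, Conv v w → Conv v (a *ᵥ w) := by
    rintro v w ⟨ℓ, hℓ⟩
    refine ⟨s₀ * ℓ - φ₀ * (v ⬝ᵥ w), ((hid.mul hℓ).sub (hφ.mul_const _)).congr' ?_⟩
    filter_upwards [eventually_det_ne_zero a s₀] with s hs
    rw [Matrix.mulVec_mulVec, resolventMatrix_mul hs, Matrix.sub_mulVec, Matrix.one_mulVec,
      Matrix.smul_mulVec, dotProduct_sub, dotProduct_smul, smul_eq_mul]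
    ring
  have hl : ∀ v w, Conv v w → Conv (v ᵥ* a) w := by
    rintro v w ⟨ℓ, hℓ⟩
    refine ⟨s₀ * ℓ - φ₀ * (v ⬝ᵥ w), ((hid.mul hℓ).sub (hφ.mul_const _)).congr' ?_⟩
    filter_upwards [eventually_det_ne_zero a s₀] with s hs
    rw [← Matrix.dotProduct_mulVec, Matrix.mulVec_mulVec, mul_resolventMatrix hs,
      Matrix.sub_mulVec, Matrix.one_mulVec,
      Matrix.smul_mulVec, dotProduct_sub, dotProduct_smul, smul_eq_mul]
    ring
  have h0 : ∀ i j, Conv (c i) (b.col j) := fun i j => by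
    obtain ⟨ℓ, hℓ⟩ := h i j
    refine ⟨ℓ, hℓ.congr fun s => ?_⟩
    rw [Matrix.mul_assoc]
    rfl
  have h1 : ∀ i (q : ℕ × Fin N), Conv (c i) ((a ^ q.1 * b).col q.2) := by
    rintro i ⟨k, j⟩
    induction k with
    | zero => simpa using h0 i j
    | succ k ih =>
      have := hr _ _ ih
      have e : a *ᵥ (a ^ k * b).col j = (a ^ (k + 1) * b).col j := by
        rw [pow_succ', Matrix.mul_assoc]; rfl
      rwa [e] at this
  have h2 : ∀ (p : ℕ × Fin N) (q : ℕ × Fin N),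
      Conv (((aᵀ) ^ p.1 * cᵀ).col p.2) ((a ^ q.1 * b).col q.2) := by
    rintro ⟨k, i⟩ q
    induction k with
    | zero =>
      have e : ((aᵀ) ^ 0 * cᵀ).col i = c i := by rw [pow_zero, Matrix.one_mul]; rfl
      rw [e]; exact h1 i q
    | succ k ih =>
      have := hl _ _ ih
      have e : ((aᵀ) ^ k * cᵀ).col i ᵥ* a = ((aᵀ) ^ (k + 1) * cᵀ).col i := by
        rw [pow_succ', Matrix.mul_assoc, ← Matrix.mulVec_transpose]; rfl
      rwa [e] at this
  have h3 : ∀ (p : ℕ × Fin N) w, Conv (((aᵀ) ^ p.1 * cᵀ).col p.2) w := by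
    intro p w
    have hw : w ∈ Submodule.span ℂ (range fun q : ℕ × Fin N => (a ^ q.1 * b).col q.2) := by
      rw [span_columns_eq_top hctr]; trivial
    induction hw using Submodule.span_induction with
    | mem x hx => obtain ⟨q, rfl⟩ := hx; exact h2 p q
    | zero => exact ⟨0, by simp⟩
    | add x y _ _ hx hy =>
      obtain ⟨ℓ, hℓ⟩ := hx
      obtain ⟨m, hm⟩ := hy
      exact ⟨ℓ + m, (hℓ.add hm).congr fun s => by
        rw [Matrix.mulVec_add, dotProduct_add]; ring⟩
    | smul r x _ hx =>
      obtain ⟨ℓ, hℓ⟩ := hx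
      exact ⟨r * ℓ, (hℓ.const_mul r).congr fun s => by
        rw [Matrix.mulVec_smul, dotProduct_smul, smul_eq_mul]; ring⟩
  have h4 : ∀ v w, Conv v w := by
    intro v w
    have hv : v ∈ Submodule.span ℂ (range fun q : ℕ × Fin N => ((aᵀ) ^ q.1 * cᵀ).col q.2) := by
      rw [span_columns_eq_top fun p hp => hobs p fun j => ?_]; · trivial
      rw [← hp j, ← Matrix.transpose_pow, ← Matrix.transpose_mul, Matrix.vecMul_transpose,
        Matrix.mulVec_mulVec]
    induction hv using Submodule.span_induction with
    | mem x hx => obtain ⟨q, rfl⟩ := hx; exact h3 q w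
    | zero => exact ⟨0, by simp⟩
    | add x y _ _ hx hy =>
      obtain ⟨ℓ, hℓ⟩ := hx
      obtain ⟨m, hm⟩ := hy
      exact ⟨ℓ + m, (hℓ.add hm).congr fun s => by rw [add_dotProduct]; ring⟩
    | smul r x _ hx =>
      obtain ⟨ℓ, hℓ⟩ := hx
      exact ⟨r * ℓ, (hℓ.const_mul r).congr fun s => by
        rw [smul_dotProduct, smul_eq_mul]; ring⟩
  choose ℓ hℓ using fun i j : Fin n => h4 (Pi.single i 1) (Pi.single j 1)
  refine ⟨Matrix.of ℓ, tendsto_pi_nhds.2 fun i => tendsto_pi_nhds.2 fun j => ?_⟩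
  refine (hℓ i j).congr fun s => ?_
  simp

/-- Passing to the limit in (s − a)R(s) = 1 gives a right inverse at `s₀`. -/
theorem det_ne_zero_of_tendsto {s₀ : ℂ} {R₀ : Matrix (Fin n) (Fin n) ℂ}
    (h : Tendsto (fun s => resolventMatrix a s) (𝓝[≠] s₀) (𝓝 R₀)) :
    (s₀ • (1 : Matrix (Fin n) (Fin n) ℂ) - a).det ≠ 0 := by
  have hid : Tendsto (fun s : ℂ => s • (1 : Matrix (Fin n) (Fin n) ℂ) - a) (𝓝[≠] s₀)
      (𝓝 (s₀ • (1 : Matrix (Fin n) (Fin n) ℂ) - a)) :=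
    ((tendsto_id.mono_left nhdsWithin_le_nhds).smul_const _).sub_const _
  have h1 := hid.mul h
  have h2 : Tendsto (fun s => (s • (1 : Matrix (Fin n) (Fin n) ℂ) - a) * resolventMatrix a s)
      (𝓝[≠] s₀) (𝓝 1) := by
    refine tendsto_const_nhds.congr' ?_
    filter_upwards [eventually_det_ne_zero a s₀] with s hs
    exact (Matrix.mul_nonsing_inv _ (isUnit_iff_ne_zero.2 hs)).symm
  have h3 := tendsto_nhds_unique h1 h2
  intro h0
  have := congrArg Matrix.det h3
  rw [Matrix.det_mul, h0, zero_mul, Matrix.det_one] at this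
  exact zero_ne_one this

/-- The resolvent along the imaginary axis tends to zero. -/
theorem tendsto_resolventMatrix_mulVec (a : Matrix (Fin n) (Fin n) ℂ) (v : Fin n → ℂ) :
    (∀ᶠ w : ℝ in atTop, (((w : ℂ) * Complex.I) • (1 : Matrix (Fin n) (Fin n) ℂ) - a).det ≠ 0) ∧
    Tendsto (fun w : ℝ => resolventMatrix a (w * Complex.I) *ᵥ v) atTop (𝓝 0) := by
  have hinj : Tendsto (fun w : ℝ => (w : ℂ) * Complex.I) atTop (Bornology.cobounded ℂ) := by
    rw [tendsto_norm_atTop_iff_cobounded.symm]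
    simpa using tendsto_abs_atTop_atTop
  have hreg : ∀ᶠ w : ℝ in atTop,
      (((w : ℂ) * Complex.I) • (1 : Matrix (Fin n) (Fin n) ℂ) - a).det ≠ 0 := by
    have h1 := (finite_setOf_det_eq_zero a).isBounded
    exact hinj.eventually (Bornology.isBounded_def.1 h1)
  refine ⟨hreg, ?_⟩
  set L := LinearMap.toContinuousLinearMap a.mulVecLin
  -- Taking norms in jωx = ax + v gives ω‖x‖ ≤ ‖a‖‖x‖ + ‖v‖.
  have hb : ∀ᶠ w : ℝ in atTop,
      ‖resolventMatrix a (w * Complex.I) *ᵥ v‖ ≤ ‖v‖ / (w - ‖L‖) := by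
    filter_upwards [hreg, eventually_gt_atTop ‖L‖] with w hw hwL
    set x := resolventMatrix a (w * Complex.I) *ᵥ v with hx
    have h1 : ((w : ℂ) * Complex.I) • x = a *ᵥ x + v := by
      rw [hx, Matrix.mulVec_mulVec, mul_resolventMatrix hw, Matrix.sub_mulVec, Matrix.one_mulVec,
        Matrix.smul_mulVec]; abel
    have h2 : ‖a *ᵥ x‖ ≤ ‖L‖ * ‖x‖ := L.le_opNorm x
    have h3 := congrArg norm h1
    rw [norm_smul, norm_mul, Complex.norm_I, mul_one, Complex.norm_real, Real.norm_eq_abs,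
      abs_of_pos ((norm_nonneg _).trans_lt hwL)] at h3
    have h4 := norm_add_le (a *ᵥ x) v
    rw [le_div_iff₀ (by linarith)]
    linarith
  refine squeeze_zero_norm' hb ?_
  exact tendsto_const_nhds.div_atTop (tendsto_atTop_add_const_right _ _ tendsto_id)

end Resolvent

/-! ### Spectral consequences of the negative imaginary property -/

section Residue

variable {n N : ℕ} {a F : Matrix (Fin n) (Fin n) ℂ} {s₀ : ℂ}

/-- Off the spectrum the product before the limit equals (s − s₀)·1, which tends to 0. -/
theorem residue_mul_pencil
    (h : Tendsto (fun s => (s - s₀) • resolventMatrix a s) (𝓝[≠] s₀) (𝓝 F)) :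
    F * (s₀ • (1 : Matrix (Fin n) (Fin n) ℂ) - a) = 0 := by
  have hid : Tendsto (fun s : ℂ => s) (𝓝[≠] s₀) (𝓝 s₀) := tendsto_id.mono_left nhdsWithin_le_nhds
  have h1 := h.mul ((hid.smul_const (1 : Matrix (Fin n) (Fin n) ℂ)).sub_const a)
  refine tendsto_nhds_unique h1 ?_
  have h2 : Tendsto (fun s => (s - s₀) • (1 : Matrix (Fin n) (Fin n) ℂ)) (𝓝[≠] s₀) (𝓝 0) := by
    have := (hid.sub_const s₀).smul_const (1 : Matrix (Fin n) (Fin n) ℂ)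
    simpa using this
  refine h2.congr' ?_
  filter_upwards [eventually_det_ne_zero a s₀] with s hs
  rw [Matrix.smul_mul]
  exact congrArg _ (Matrix.nonsing_inv_mul _ (isUnit_iff_ne_zero.2 hs)).symm

theorem residue_mulVec_eigenvector
    (h : Tendsto (fun s => (s - s₀) • resolventMatrix a s) (𝓝[≠] s₀) (𝓝 F)) {v : Fin n → ℂ}
    (hv : a *ᵥ v = s₀ • v) : F *ᵥ v = v := by
  have h1 : Tendsto (fun s => ((s - s₀) • resolventMatrix a s) *ᵥ v) (𝓝[≠] s₀) (𝓝 (F *ᵥ v)) :=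
    ((Continuous.matrix_mulVec continuous_id continuous_const).tendsto F).comp h
  refine tendsto_nhds_unique h1 (tendsto_const_nhds.congr' ?_)
  filter_upwards [eventually_det_ne_zero a s₀] with s hs
  have h2 : (s - s₀) • v = (s • (1 : Matrix (Fin n) (Fin n) ℂ) - a) *ᵥ v := by
    rw [Matrix.sub_mulVec, Matrix.smul_mulVec, Matrix.one_mulVec, hv, sub_smul]
  rw [Matrix.smul_mulVec, ← Matrix.mulVec_smul, h2, Matrix.mulVec_mulVec]
  unfold resolventMatrix
  rw [Matrix.nonsing_inv_mul _ (isUnit_iff_ne_zero.2 hs), Matrix.one_mulVec]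

theorem residue_mul_eq_smul
    (h : Tendsto (fun s => (s - s₀) • resolventMatrix a s) (𝓝[≠] s₀) (𝓝 F)) :
    F * a = s₀ • F := by
  have := residue_mul_pencil h
  rw [Matrix.mul_sub, Matrix.mul_smul, Matrix.mul_one, sub_eq_zero] at this
  exact this.symm

/-- On the residue `a` acts as the scalar `s₀`, so F a^j b = s₀^j F b; as the columns of `a ^ j * b`
span, `F * b` has the full range of `F`. -/
theorem exists_residue_mulVec_eq {b : Matrix (Fin n) (Fin N) ℂ}
    (h : Tendsto (fun s => (s - s₀) • resolventMatrix a s) (𝓝[≠] s₀) (𝓝 F))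
    (hctr : ∀ p : Fin n → ℂ, (∀ j : ℕ, p ᵥ* (a ^ j * b) = 0) → p = 0) (x : Fin n → ℂ) :
    ∃ w, F *ᵥ x = F *ᵥ (b *ᵥ w) := by
  have hx : x ∈ Submodule.span ℂ (range fun q : ℕ × Fin N => (a ^ q.1 * b).col q.2) := by
    rw [span_columns_eq_top hctr]; trivial
  induction hx using Submodule.span_induction with
  | mem x hx =>
    obtain ⟨⟨j, r⟩, rfl⟩ := hx
    refine ⟨s₀ ^ j • Pi.single r 1, ?_⟩
    have hj : F * a ^ j = s₀ ^ j • F := by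
      induction j with
      | zero => simp
      | succ j ih => rw [pow_succ, ← mul_assoc, ih, Matrix.smul_mul, residue_mul_eq_smul h,
          smul_smul, pow_succ]
    change F *ᵥ ((a ^ j * b).col r) = _
    rw [← Matrix.mulVec_single_one, ← Matrix.mulVec_mulVec, Matrix.mulVec_mulVec, hj,
      Matrix.mulVec_smul, Matrix.mulVec_smul, Matrix.smul_mulVec]
  | zero => exact ⟨0, by simp⟩
  | add x y _ _ hx hy =>
    obtain ⟨w, hw⟩ := hx
    obtain ⟨w', hw'⟩ := hy
    exact ⟨w + w', by rw [Matrix.mulVec_add, hw, hw', Matrix.mulVec_add, Matrix.mulVec_add]⟩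
  | smul r x _ hx =>
    obtain ⟨w, hw⟩ := hx
    exact ⟨r • w, by rw [Matrix.mulVec_smul, hw, Matrix.mulVec_smul, Matrix.mulVec_smul]⟩

end Residue

section NegativeImaginary

variable {n N : ℕ} {A : Matrix (Fin n) (Fin n) ℝ} {B : Matrix (Fin n) (Fin N) ℝ}
  {C : Matrix (Fin N) (Fin n) ℝ}

theorem transferMatrix_eq (A : Matrix (Fin n) (Fin n) ℝ) (B : Matrix (Fin n) (Fin N) ℝ)
    (C : Matrix (Fin N) (Fin n) ℝ) (s : ℂ) :
    transferMatrix A B C s = toC C * resolventMatrix (toC A) s * toC B := rfl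

theorem transferMatrix_apply (A : Matrix (Fin n) (Fin n) ℝ) (B : Matrix (Fin n) (Fin N) ℝ)
    (C : Matrix (Fin N) (Fin n) ℝ) (s : ℂ) (i j : Fin N) :
    transferMatrix A B C s i j =
      ∑ l, (∑ k, toC C i k * resolventMatrix (toC A) s k l) * toC B l j := rfl

theorem meromorphicAt_transferMatrix (A : Matrix (Fin n) (Fin n) ℝ) (B : Matrix (Fin n) (Fin N) ℝ)
    (C : Matrix (Fin N) (Fin n) ℝ) (s₀ : ℂ) (i j : Fin N) :
    MeromorphicAt (fun s => transferMatrix A B C s i j) s₀ := by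
  simp only [transferMatrix_apply]
  refine MeromorphicAt.fun_sum fun l _ => MeromorphicAt.fun_mul
    (MeromorphicAt.fun_sum fun k _ => ?_) (.const _ _)
  exact MeromorphicAt.fun_mul (.const _ _) (meromorphicAt_resolventMatrix _ _ _ _)

theorem not_isPole_of_isRegularPoint {s₀ : ℂ} (h : IsRegularPoint A s₀) :
    ¬ IsPole (transferMatrix A B C) s₀ := by
  rintro ⟨i, j, hij⟩
  refine not_le.2 hij (AnalyticAt.meromorphicOrderAt_nonneg ?_)
  simp only [transferMatrix_apply]
  refine Finset.analyticAt_fun_sum _ fun l _ => AnalyticAt.fun_mul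
    (Finset.analyticAt_fun_sum _ fun k _ => ?_) analyticAt_const
  exact AnalyticAt.fun_mul analyticAt_const (analyticAt_resolventMatrix h _ _)

/-- Without a pole every entry of G has a limit; by controllability and observability the resolvent
then has one too, which excludes an eigenvalue. -/
theorem IsMinimalRealization.isRegularPoint (hmin : IsMinimalRealization A B C) {s₀ : ℂ}
    (h : ¬ IsPole (transferMatrix A B C) s₀) : IsRegularPoint A s₀ := by
  obtain ⟨F, hF⟩ := exists_tendsto_resolventMatrix hmin.controllable_complex
    hmin.observable_complex (φ := fun _ => 1) (s₀ := s₀) tendsto_const_nhds fun i j => by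
      have h1 : 0 ≤ meromorphicOrderAt (fun s => transferMatrix A B C s i j) s₀ := by
        by_contra hcon
        exact h ⟨i, j, not_le.1 hcon⟩
      obtain ⟨ℓ, hℓ⟩ := tendsto_nhds_of_meromorphicOrderAt_nonneg
        (meromorphicAt_transferMatrix A B C s₀ i j) h1
      exact ⟨ℓ, hℓ.congr fun s => by rw [one_mul]; rfl⟩
  simp only [one_smul] at hF
  exact det_ne_zero_of_tendsto hF

/-- An eigenvalue must be a pole of G, and the assumed limit of (s − jω)jG(s) forces convergence of
(s − jω) times the resolvent itself. Hence its residue `F` exists, and jCFB is the given positive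
semidefinite limit. -/
theorem IsMinimalRealization.exists_residue (hmin : IsMinimalRealization A B C)
    (hNI : IsNegativeImaginary (transferMatrix A B C)) {w : ℝ} (hw : 0 < w)
    (h : ¬ IsRegularPoint A (w * Complex.I)) :
    ∃ F, Tendsto (fun s => (s - w * Complex.I) • resolventMatrix (toC A) s)
        (𝓝[≠] (w * Complex.I)) (𝓝 F) ∧
      (Complex.I • (toC C * F * toC B)).PosSemidef := by
  have hp : IsPole (transferMatrix A B C) (w * Complex.I) := by
    by_contra hcon
    exact h (hmin.isRegularPoint hcon)
  obtain ⟨K, hK, hlim⟩ := hNI.residue w hw hp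
  have hid : Tendsto (fun s : ℂ => s - w * Complex.I) (𝓝[≠] (w * Complex.I)) (𝓝 0) := by
    have : Tendsto (fun s : ℂ => s) (𝓝[≠] (w * Complex.I)) (𝓝 (w * Complex.I)) :=
      tendsto_id.mono_left nhdsWithin_le_nhds
    simpa using this.sub_const (w * Complex.I)
  obtain ⟨F, hF⟩ := exists_tendsto_resolventMatrix hmin.controllable_complex
    hmin.observable_complex (φ := fun s => s - w * Complex.I) (s₀ := w * Complex.I) hid
    fun i j => by
      have h1 := (tendsto_pi_nhds.1 ((tendsto_pi_nhds.1 hlim) i) j).const_mul (-Complex.I)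
      refine ⟨_, h1.congr fun s => ?_⟩
      rw [Matrix.smul_apply, smul_eq_mul, transferMatrix_eq]
      linear_combination (-(s - w * Complex.I) *
        (toC C * resolventMatrix (toC A) s * toC B) i j) * Complex.I_mul_I
  refine ⟨F, hF, ?_⟩
  have h2 : Tendsto (fun s : ℂ => ((s - w * Complex.I) * Complex.I) • transferMatrix A B C s)
      (𝓝[≠] (w * Complex.I)) (𝓝 (Complex.I • (toC C * F * toC B))) := by
    have hc : Continuous fun M : Matrix (Fin n) (Fin n) ℂ => Complex.I • (toC C * M * toC B) := by
      fun_prop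
    refine ((hc.tendsto F).comp hF).congr fun s => ?_
    rw [transferMatrix_eq, Function.comp_apply, Matrix.mul_smul, Matrix.smul_mul, smul_smul, mul_comm]
  rw [tendsto_nhds_unique h2 hlim]
  exact hK

/-- The Hermitian form of j(G − G*) at `u` is −2 Im(u*Gu). -/
theorem IsNegativeImaginary.im_nonpos (hNI : IsNegativeImaginary (transferMatrix A B C)) {w : ℝ}
    (hw : 0 < w) (h : IsRegularPoint A (w * Complex.I)) (u : Fin N → ℂ) :
    (star u ⬝ᵥ (toC C *ᵥ (resolventMatrix (toC A) (w * Complex.I) *ᵥ (toC B *ᵥ u)))).im ≤ 0 := by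
  have h1 := (hNI.nonneg w hw (not_isPole_of_isRegularPoint h)).dotProduct_mulVec_nonneg u
  rw [transferMatrix_eq] at h1
  set G := toC C * resolventMatrix (toC A) (w * Complex.I) * toC B with hG
  have h2 : toC C *ᵥ (resolventMatrix (toC A) (w * Complex.I) *ᵥ (toC B *ᵥ u)) = G *ᵥ u := by
    rw [hG]; simp only [Matrix.mulVec_mulVec, Matrix.mul_assoc]
  rw [h2]
  have h3 : star u ⬝ᵥ (Gᴴ *ᵥ u) = star (star u ⬝ᵥ (G *ᵥ u)) := by
    rw [Matrix.dotProduct_mulVec, ← Matrix.star_mulVec, Matrix.star_dotProduct]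
  rw [Matrix.smul_mulVec, Matrix.sub_mulVec, dotProduct_smul, dotProduct_sub, h3] at h1
  have h4 := (Complex.le_def.1 h1).1
  simp at h4
  linarith

/-- The frequency domain inequality, valid also at the eigenvalues of `A`. -/
theorem IsMinimalRealization.frequency_nonneg (hmin : IsMinimalRealization A B C)
    (hNI : IsNegativeImaginary (transferMatrix A B C)) {w : ℝ} {x : Fin n → ℂ} {u : Fin N → ℂ}
    (h : ((w : ℂ) * Complex.I) • x = toC A *ᵥ x + toC B *ᵥ u) :
    0 ≤ (star u ⬝ᵥ (toC C *ᵥ (((w : ℂ) * Complex.I) • x))).re := by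
  have main : ∀ (w : ℝ), 0 < w → ∀ (x : Fin n → ℂ) (u : Fin N → ℂ),
      ((w : ℂ) * Complex.I) • x = toC A *ᵥ x + toC B *ᵥ u →
      (star u ⬝ᵥ (toC C *ᵥ x)).im ≤ 0 := by
    clear h x u w
    intro w hw x u h
    have hbu : ∀ s : ℂ, toC B *ᵥ u = (s • (1 : Matrix (Fin n) (Fin n) ℂ) - toC A) *ᵥ x
        - (s - w * Complex.I) • x := fun s => by
      rw [Matrix.sub_mulVec, Matrix.smul_mulVec, Matrix.one_mulVec, sub_smul, h]; abel
    have hres : ∀ s : ℂ, IsRegularPoint A s → resolventMatrix (toC A) s *ᵥ (toC B *ᵥ u) =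
        x - ((s - w * Complex.I) • resolventMatrix (toC A) s) *ᵥ x := fun s hs => by
      rw [hbu s, Matrix.mulVec_sub, Matrix.mulVec_mulVec]
      unfold resolventMatrix
      rw [Matrix.nonsing_inv_mul _ (isUnit_iff_ne_zero.2 hs), Matrix.one_mulVec,
        Matrix.mulVec_smul, Matrix.smul_mulVec]
    by_cases hr : IsRegularPoint A (w * Complex.I)
    · have h1 := hNI.im_nonpos hw hr u
      rw [hres _ hr] at h1
      simpa using h1
    -- At an eigenvalue the inequality is a limit of nearby frequencies. The residue annihilates
    -- `Bu`, so R(s)Bu → x − Fx. The extra term u*CFx vanishes: Fx = FBv for some v, and the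
    -- Hermitian matrix jCFB annihilates u.
    · obtain ⟨F, hF, hK⟩ := hmin.exists_residue hNI hw hr
      have hFbu : F *ᵥ (toC B *ᵥ u) = 0 := by
        rw [hbu (w * Complex.I), sub_self, zero_smul, sub_zero, Matrix.mulVec_mulVec,
          residue_mul_pencil hF, Matrix.zero_mulVec]
      obtain ⟨v, hv⟩ := exists_residue_mulVec_eq hF hmin.controllable_complex x
      have hzero : star u ⬝ᵥ (toC C *ᵥ (F *ᵥ x)) = 0 := by
        have h1 : (Complex.I • (toC C * F * toC B)) *ᵥ u = 0 := by
          rw [Matrix.smul_mulVec, ← Matrix.mulVec_mulVec, ← Matrix.mulVec_mulVec, hFbu,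
            Matrix.mulVec_zero, smul_zero]
        have h2 : star u ⬝ᵥ ((Complex.I • (toC C * F * toC B)) *ᵥ v) = 0 := by
          rw [← hK.isHermitian.eq, Matrix.dotProduct_mulVec, ← Matrix.star_mulVec, h1]
          simp
        rw [Matrix.smul_mulVec, ← Matrix.mulVec_mulVec, ← Matrix.mulVec_mulVec, ← hv,
          dotProduct_smul, smul_eq_mul, mul_eq_zero] at h2
        exact h2.resolve_left Complex.I_ne_zero
      have hc : Continuous fun M : Matrix (Fin n) (Fin n) ℂ =>
          (star u ⬝ᵥ (toC C *ᵥ (x - M *ᵥ x))).im :=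
        Complex.continuous_im.comp (continuous_const.dotProduct
          (continuous_const.matrix_mulVec (continuous_const.sub
            (continuous_id.matrix_mulVec continuous_const))))
      have hpath : Tendsto (fun r : ℝ => (r : ℂ) * Complex.I) (𝓝[≠] w) (𝓝[≠] (w * Complex.I)) := by
        refine tendsto_nhdsWithin_of_tendsto_nhds_of_eventually_within _ ?_ ?_
        · have : Continuous fun r : ℝ => (r : ℂ) * Complex.I := by fun_prop
          exact (this.tendsto w).mono_left nhdsWithin_le_nhds
        · filter_upwards [self_mem_nhdsWithin] with r hr h0
          exact hr (by simpa using h0)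
      have h1 := (hc.tendsto F).comp (hF.comp hpath)
      have h2 : (star u ⬝ᵥ (toC C *ᵥ (x - F *ᵥ x))).im ≤ 0 := by
        refine le_of_tendsto h1 ?_
        filter_upwards [hpath.eventually (eventually_det_ne_zero (toC A) (w * Complex.I)),
          mem_nhdsWithin_of_mem_nhds (lt_mem_nhds hw)] with r hr hr0
        have := hNI.im_nonpos hr0 hr u
        rw [hres _ hr] at this
        exact this
      rw [Matrix.mulVec_sub, dotProduct_sub, hzero, sub_zero] at h2
      exact h2
  have hre : ∀ z : ℂ, ((w : ℂ) * Complex.I * z).re = -(w * z.im) := fun z => by simp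
  rw [Matrix.mulVec_smul, dotProduct_smul, smul_eq_mul, hre]
  -- Negative frequencies reduce to positive ones by conjugation, because the system is real.
  rcases lt_trichotomy w 0 with hw | hw | hw
  · have h1 := main (-w) (by linarith) (star x) (star u) (by
      rw [toC_mulVec_star, toC_mulVec_star, ← star_add, ← h, star_smul]
      congr 1
      simp)
    rw [toC_mulVec_star, Matrix.star_dotProduct_star, dotProduct_comm, Complex.star_def,
      Complex.conj_im] at h1
    nlinarith
  · simp [hw]
  · have := main w hw x u h
    nlinarith

/-- The transfer matrix of `ẏ` is positive real at infinity. -/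
theorem IsMinimalRealization.feedthrough_nonneg (hmin : IsMinimalRealization A B C)
    (hNI : IsNegativeImaginary (transferMatrix A B C)) (u : Fin N → ℝ) :
    0 ≤ u ⬝ᵥ (C *ᵥ (B *ᵥ u)) := by
  set u' : Fin N → ℂ := fun k => (u k : ℂ) with hu'
  obtain ⟨hreg, hlim⟩ := tendsto_resolventMatrix_mulVec (toC A) (toC B *ᵥ u')
  -- As the frequency tends to infinity the periodic state R(jω)Bu tends to 0, so ẏ = C(Ax + Bu)
  -- tends to CBu and the frequency inequality survives in the limit.
  have h1 : Tendsto (fun w : ℝ => (star u' ⬝ᵥ (toC C *ᵥ (toC A *ᵥ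
      (resolventMatrix (toC A) (w * Complex.I) *ᵥ (toC B *ᵥ u')) + toC B *ᵥ u'))).re) atTop
      (𝓝 (star u' ⬝ᵥ (toC C *ᵥ (toC A *ᵥ 0 + toC B *ᵥ u'))).re) := by
    have hc : Continuous fun x : Fin n → ℂ =>
        (star u' ⬝ᵥ (toC C *ᵥ (toC A *ᵥ x + toC B *ᵥ u'))).re :=
      Complex.continuous_re.comp (continuous_const.dotProduct
        (continuous_const.matrix_mulVec ((continuous_const.matrix_mulVec continuous_id).add
            continuous_const)))
    exact (hc.tendsto 0).comp hlim
  have h2 : 0 ≤ (star u' ⬝ᵥ (toC C *ᵥ (toC A *ᵥ 0 + toC B *ᵥ u'))).re := by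
    refine ge_of_tendsto h1 ?_
    filter_upwards [hreg] with w hw
    have h3 : ((w : ℂ) * Complex.I) • (resolventMatrix (toC A) (w * Complex.I) *ᵥ (toC B *ᵥ u')) =
        toC A *ᵥ (resolventMatrix (toC A) (w * Complex.I) *ᵥ (toC B *ᵥ u')) + toC B *ᵥ u' := by
      rw [Matrix.mulVec_mulVec (toC B *ᵥ u') (toC A), mul_resolventMatrix hw, Matrix.sub_mulVec,
        Matrix.one_mulVec, Matrix.smul_mulVec]; abel
    rw [← h3]
    exact hmin.frequency_nonneg hNI h3
  have h4 : star u' ⬝ᵥ (toC C *ᵥ (toC A *ᵥ 0 + toC B *ᵥ u')) =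
      ((u ⬝ᵥ (C *ᵥ (B *ᵥ u)) : ℝ) : ℂ) := by
    rw [Matrix.mulVec_zero, zero_add, toC_mulVec_ofReal, toC_mulVec_ofReal]
    simp [dotProduct, hu']
  rw [h4, Complex.ofReal_re] at h2
  exact h2

end NegativeImaginary

/-! ### A Kalman–Yakubovich–Popov lemma -/

theorem exists_conjTranspose_mul_self {m : ℕ} {M : Matrix (Fin m) (Fin m) ℝ} (h : M.PosSemidef) :
    ∃ X : Matrix (Fin m) (Fin m) ℝ, M = Xᵀ * X := by
  open scoped MatrixOrder in
  obtain ⟨X, hX⟩ := CStarAlgebra.nonneg_iff_eq_star_mul_self.mp h.nonneg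
  exact ⟨X, by rw [hX, Matrix.star_eq_conjTranspose, Matrix.conjTranspose_eq_transpose_of_trivial]⟩

section KYP

variable {n N : ℕ} {A : Matrix (Fin n) (Fin n) ℝ} {B : Matrix (Fin n) (Fin N) ℝ}
  {C : Matrix (Fin N) (Fin n) ℝ}

/-- With R = XᵀX the trace is that of XMXᵀ, a sum of values of the quadratic form of `M` at the rows
of `X`. -/
theorem trace_mul_posSemidef_nonneg {M R : Matrix (Fin N) (Fin N) ℝ}
    (hM : ∀ u, 0 ≤ u ⬝ᵥ (M *ᵥ u)) (hR : R.PosSemidef) : 0 ≤ (M * R).trace := by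
  obtain ⟨X, rfl⟩ := exists_conjTranspose_mul_self hR
  rw [← Matrix.mul_assoc, Matrix.trace_mul_comm, ← Matrix.mul_assoc, Matrix.trace]
  refine Finset.sum_nonneg fun i _ => ?_
  have h1 := hM (X i)
  rw [Matrix.dotProduct_mulVec] at h1
  exact h1

/-- With Y = XXᵀ, the skewness hypothesis makes S = X⁻¹(A + BK)X skew. So −jS is Hermitian, and an
orthonormal eigenbasis of it turns the second moments into a sum of modes of A + BK with imaginary
eigenvalues. With u = Kx each mode is a periodic regime, and the trace is the sum of their supply
rates. -/
theorem trace_nonneg_of_skew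
    (hfreq : ∀ (w : ℝ) (x : Fin n → ℂ) (u : Fin N → ℂ),
      ((w : ℂ) * Complex.I) • x = toC A *ᵥ x + toC B *ᵥ u →
      0 ≤ (star u ⬝ᵥ (toC C *ᵥ (((w : ℂ) * Complex.I) • x))).re)
    {Y : Matrix (Fin n) (Fin n) ℝ} (hY : Y.PosDef) (K : Matrix (Fin N) (Fin n) ℝ)
    (hskew : (A + B * K) * Y + ((A + B * K) * Y)ᵀ = 0) :
    0 ≤ (C * ((A + B * K) * Y) * Kᵀ).trace := by
  obtain ⟨X, hYX⟩ : ∃ X : Matrix (Fin n) (Fin n) ℝ, Y = X * Xᵀ := by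
    obtain ⟨X₀, hX₀⟩ := exists_conjTranspose_mul_self hY.posSemidef
    exact ⟨X₀ᵀ, by rw [hX₀, Matrix.transpose_transpose]⟩
  have hXu : IsUnit X.det := by
    have h1 : IsUnit Y.det := (Matrix.isUnit_iff_isUnit_det _).1 hY.isUnit
    rw [hYX, Matrix.det_mul] at h1
    exact isUnit_of_mul_isUnit_left h1
  set Ak := A + B * K with hAk
  set S := X⁻¹ * Ak * X with hS
  have hAX : Ak * X = X * S := by
    rw [hS, Matrix.mul_assoc, ← Matrix.mul_assoc X, Matrix.mul_nonsing_inv _ hXu, Matrix.one_mul]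
  have hH : Ak * Y = X * S * Xᵀ := by rw [hYX, ← Matrix.mul_assoc, hAX]
  have hSskew : Sᵀ = -S := by
    have hXu' : IsUnit (Xᵀ).det := by rwa [Matrix.det_transpose]
    have h0 : X * (S + Sᵀ) * Xᵀ = 0 := by
      rw [← hskew, hH]
      simp only [Matrix.transpose_mul, Matrix.transpose_transpose, Matrix.mul_add, Matrix.add_mul,
        Matrix.mul_assoc]
    have h1 := congrArg (fun M => X⁻¹ * M * (Xᵀ)⁻¹) h0
    simp only [Matrix.mul_assoc, Matrix.mul_nonsing_inv _ hXu', Matrix.mul_one,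
      Matrix.zero_mul, Matrix.mul_zero] at h1
    rw [← Matrix.mul_assoc, Matrix.nonsing_inv_mul _ hXu, Matrix.one_mul] at h1
    exact eq_neg_of_add_eq_zero_right h1
  have hHerm : ((-Complex.I) • toC S).IsHermitian := by
    unfold Matrix.IsHermitian
    rw [Matrix.conjTranspose_smul, toC_conjTranspose, hSskew]
    ext i j
    simp
  set U : Matrix (Fin n) (Fin n) ℂ := hHerm.eigenvectorUnitary.1 with hU
  set D : Fin n → ℝ := hHerm.eigenvalues with hD
  have hUU : U * star U = 1 := Unitary.coe_mul_star_self hHerm.eigenvectorUnitary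
  have hUU' : star U * U = 1 := Unitary.coe_star_mul_self hHerm.eigenvectorUnitary
  set Λ : Matrix (Fin n) (Fin n) ℂ := Matrix.diagonal fun k => (D k : ℂ) * Complex.I with hΛ
  have hspec : toC S = U * Λ * star U := by
    have h1 := hHerm.spectral_theorem
    rw [Unitary.conjStarAlgAut_apply] at h1
    have h2 : toC S = Complex.I • ((-Complex.I) • toC S) := by
      rw [smul_smul]; simp
    have h3 : Λ = Complex.I • Matrix.diagonal (RCLike.ofReal ∘ hHerm.eigenvalues) := by
      ext i j
      by_cases hij : i = j
      · subst hij; simp [hΛ, hD, mul_comm]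
      · simp [hΛ, hij]
    rw [h2, h1, h3, Matrix.mul_smul, Matrix.smul_mul]
  set X' := toC X * U with hX'
  have hcol : (toC A + toC B * toC K) * X' = X' * Λ := by
    have h1 : toC Ak = toC A + toC B * toC K := by rw [hAk, toC_add, toC_mul]
    rw [← h1, hX', ← Matrix.mul_assoc, ← toC_mul, hAX, toC_mul, hspec]
    simp only [Matrix.mul_assoc, hUU', Matrix.mul_one]
  have hHC : toC (Ak * Y) = X' * Λ * X'ᴴ := by
    rw [hH, toC_mul, toC_mul, hspec, hX', Matrix.conjTranspose_mul, toC_conjTranspose,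
      ← Matrix.star_eq_conjTranspose]
    simp only [Matrix.mul_assoc]
  have htr : (((C * (Ak * Y) * Kᵀ).trace : ℝ) : ℂ) =
      ∑ k, star (toC K *ᵥ X'.col k) ⬝ᵥ (toC C *ᵥ (((D k : ℂ) * Complex.I) • X'.col k)) := by
    have h1 : (((C * (Ak * Y) * Kᵀ).trace : ℝ) : ℂ) = (toC (C * (Ak * Y) * Kᵀ)).trace := by
      simp [Matrix.trace]
    have h2 : toC (C * (Ak * Y) * Kᵀ) = (toC C * (X' * Λ)) * (toC K * X')ᴴ := by
      rw [toC_mul, toC_mul, hHC, Matrix.conjTranspose_mul (toC K) X', toC_conjTranspose]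
      simp only [Matrix.mul_assoc]
    rw [h1, h2, Matrix.trace_mul_comm, Matrix.trace]
    refine Finset.sum_congr rfl fun k _ => ?_
    have h3 : ((D k : ℂ) * Complex.I) • X'.col k = (X' * Λ).col k := by
      ext i
      simp [hΛ, mul_comm]
    rw [h3]
    rfl
  have hre : (C * (Ak * Y) * Kᵀ).trace =
      ∑ k, (star (toC K *ᵥ X'.col k) ⬝ᵥ (toC C *ᵥ (((D k : ℂ) * Complex.I) • X'.col k))).re := by
    rw [← Complex.re_sum, ← htr, Complex.ofReal_re]
  rw [hre]
  refine Finset.sum_nonneg fun k _ => hfreq _ _ _ ?_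
  have h1 : ((toC A + toC B * toC K) * X').col k = (X' * Λ).col k := by rw [hcol]
  have h3 : ((D k : ℂ) * Complex.I) • X'.col k = (X' * Λ).col k := by
    ext i
    simp [hΛ, mul_comm]
  rw [h3, ← h1, Matrix.mulVec_mulVec, ← Matrix.add_mulVec]
  rfl

/-- Linear regression of u on x: K = VᵀY⁻¹ explains u by state feedback, and the Schur complement R
≥ 0 is the unexplained part. The feedback part is the skew case, and the rest contributes tr(CBR) ≥
0. -/
theorem trace_nonneg_of_posDef
    (hfreq : ∀ (w : ℝ) (x : Fin n → ℂ) (u : Fin N → ℂ),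
      ((w : ℂ) * Complex.I) • x = toC A *ᵥ x + toC B *ᵥ u →
      0 ≤ (star u ⬝ᵥ (toC C *ᵥ (((w : ℂ) * Complex.I) • x))).re)
    (hfeed : ∀ u, 0 ≤ u ⬝ᵥ (C *ᵥ (B *ᵥ u)))
    {S : Matrix (Fin n ⊕ Fin N) (Fin n ⊕ Fin N) ℝ} (hS : S.PosDef)
    (hskew : (A * S.toBlocks₁₁ + B * S.toBlocks₂₁) +
      (A * S.toBlocks₁₁ + B * S.toBlocks₂₁)ᵀ = 0) :
    0 ≤ (C * (A * S.toBlocks₁₂ + B * S.toBlocks₂₂)).trace := by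
  set Y := S.toBlocks₁₁ with hYdef
  set V := S.toBlocks₁₂ with hV
  have hY : Y.PosDef := hS.submatrix Sum.inl_injective
  have h21 : S.toBlocks₂₁ = Vᴴ := by
    ext i j
    exact (hS.isHermitian.apply (Sum.inr i) (Sum.inl j)).symm
  have hYu : IsUnit Y.det := (Matrix.isUnit_iff_isUnit_det _).1 hY.isUnit
  have hYt : Yᵀ = Y := by
    rw [← Matrix.conjTranspose_eq_transpose_of_trivial]; exact hY.isHermitian
  have hR : (S.toBlocks₂₂ - Vᴴ * Y⁻¹ * V).PosSemidef := by
    have : Invertible Y := Matrix.invertibleOfIsUnitDet Y hYu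
    rw [← Matrix.PosDef.fromBlocks₁₁ V _ hY, ← h21, Matrix.fromBlocks_toBlocks]
    exact hS.posSemidef
  set R := S.toBlocks₂₂ - Vᴴ * Y⁻¹ * V with hRdef
  set K := Vᴴ * Y⁻¹ with hK
  have hKY : K * Y = Vᴴ := by
    rw [hK, Matrix.mul_assoc, Matrix.nonsing_inv_mul _ hYu, Matrix.mul_one]
  have hYK : Y * Kᵀ = V := by
    have := congrArg Matrix.transpose hKY
    rw [Matrix.transpose_mul, hYt, Matrix.conjTranspose_eq_transpose_of_trivial,
      Matrix.transpose_transpose] at this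
    exact this
  have h1 : (A + B * K) * Y = A * Y + B * S.toBlocks₂₁ := by
    rw [Matrix.add_mul, Matrix.mul_assoc, hKY, h21]
  have h2 : A * V + B * S.toBlocks₂₂ = (A + B * K) * Y * Kᵀ + B * R := by
    have h3 : S.toBlocks₂₂ = K * V + R := by rw [hRdef]; abel
    rw [h3, Matrix.mul_assoc (A + B * K) Y, hYK, Matrix.add_mul, Matrix.mul_add,
      Matrix.mul_assoc B K V, add_assoc]
  have h4 := trace_nonneg_of_skew hfreq hY K (by rw [h1]; exact hskew)
  have h5 : 0 ≤ (C * B * R).trace := trace_mul_posSemidef_nonneg (fun u => by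
    rw [← Matrix.mulVec_mulVec]; exact hfeed u) hR
  rw [h2, Matrix.mul_add, Matrix.trace_add, ← Matrix.mul_assoc C B, ← Matrix.mul_assoc C _ Kᵀ]
  exact add_nonneg h4 h5

end KYP

/-! ### Periodic regimes and the storage matrix by Riesz extension -/

section Riesz

theorem abs_dotProduct_le {ι : Type*} [Fintype ι] (v w : ι → ℝ) :
    |v ⬝ᵥ w| ≤ Fintype.card ι * (‖v‖ * ‖w‖) := by
  calc |v ⬝ᵥ w| ≤ ∑ i, |v i * w i| := Finset.abs_sum_le_sum_abs _ _
    _ ≤ ∑ _i : ι, ‖v‖ * ‖w‖ := Finset.sum_le_sum fun i _ => by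
        rw [abs_mul]
        exact mul_le_mul (norm_le_pi_norm v i) (norm_le_pi_norm w i) (abs_nonneg _) (norm_nonneg _)
    _ = _ := by simp

/-- A positive definite matrix is an order unit of the space of symmetric matrices. -/
theorem exists_smul_add_posSemidef {ι : Type*} [Fintype ι] {S M : Matrix ι ι ℝ}
    (hS : S.PosDef) (hM : Mᵀ = M) : ∃ r : ℝ, (r • S + M).PosSemidef := by
  obtain ⟨c, hc, hcS⟩ := exists_pos_mul_sq_le (f := fun x : ι → ℝ => x ⬝ᵥ (S *ᵥ x))
    (by simp only [dotProduct, Matrix.mulVec]; fun_prop)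
    (fun r v => by simp only [Matrix.mulVec_smul, dotProduct_smul, smul_dotProduct, smul_eq_mul]; ring)
    (fun v hv => by simpa using hS.dotProduct_mulVec_pos hv)
  set D := ‖LinearMap.toContinuousLinearMap M.mulVecLin‖
  have hD : ∀ v, |v ⬝ᵥ (M *ᵥ v)| ≤ Fintype.card ι * D * ‖v‖ ^ 2 := fun v => by
    have h1 : ‖M *ᵥ v‖ ≤ D * ‖v‖ := (LinearMap.toContinuousLinearMap M.mulVecLin).le_opNorm v
    calc _ ≤ Fintype.card ι * (‖v‖ * ‖M *ᵥ v‖) := abs_dotProduct_le _ _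
      _ ≤ Fintype.card ι * (‖v‖ * (D * ‖v‖)) := by gcongr
      _ = _ := by ring
  refine ⟨Fintype.card ι * D / c, .of_dotProduct_mulVec_nonneg ?_ fun v => ?_⟩
  · have hSh := hS.isHermitian
    unfold Matrix.IsHermitian at hSh ⊢
    rw [Matrix.conjTranspose_eq_transpose_of_trivial] at hSh ⊢
    rw [Matrix.transpose_add, Matrix.transpose_smul, hSh, hM]
  · rw [star_trivial, Matrix.add_mulVec, dotProduct_add, Matrix.smul_mulVec, dotProduct_smul,
      smul_eq_mul]
    have h1 := (abs_le.1 (hD v)).1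
    have h2 : Fintype.card ι * D / c * (c * ‖v‖ ^ 2) ≤
        Fintype.card ι * D / c * (v ⬝ᵥ (S *ᵥ v)) :=
      mul_le_mul_of_nonneg_left (hcS v) (by positivity)
    have h3 : Fintype.card ι * D / c * (c * ‖v‖ ^ 2) = Fintype.card ι * D * ‖v‖ ^ 2 := by
      field_simp
    linarith

variable {n N : ℕ}

/-- The Lyapunov map `Z ↦ H + Hᵀ`, `H = A S₁₁ + B S₂₁`, of the symmetrization `S = Z + Zᵀ`. -/
def lyapunovMap (A : Matrix (Fin n) (Fin n) ℝ) (B : Matrix (Fin n) (Fin N) ℝ) :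
    Matrix (Fin n ⊕ Fin N) (Fin n ⊕ Fin N) ℝ →ₗ[ℝ] Matrix (Fin n) (Fin n) ℝ where
  toFun Z := (A * (Z + Zᵀ).toBlocks₁₁ + B * (Z + Zᵀ).toBlocks₂₁) +
    (A * (Z + Zᵀ).toBlocks₁₁ + B * (Z + Zᵀ).toBlocks₂₁)ᵀ
  map_add' Z Z' := by
    have h1 : ((Z + Z') + (Z + Z')ᵀ).toBlocks₁₁ = (Z + Zᵀ).toBlocks₁₁ + (Z' + Z'ᵀ).toBlocks₁₁ := by
      ext; simp [Matrix.toBlocks₁₁]; ring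
    have h2 : ((Z + Z') + (Z + Z')ᵀ).toBlocks₂₁ = (Z + Zᵀ).toBlocks₂₁ + (Z' + Z'ᵀ).toBlocks₂₁ := by
      ext; simp [Matrix.toBlocks₂₁]; ring
    rw [h1, h2, Matrix.mul_add, Matrix.mul_add]
    simp only [Matrix.transpose_add]
    abel
  map_smul' r Z := by
    have h1 : (r • Z + (r • Z)ᵀ).toBlocks₁₁ = r • (Z + Zᵀ).toBlocks₁₁ := by
      ext; simp [Matrix.toBlocks₁₁]; ring
    have h2 : (r • Z + (r • Z)ᵀ).toBlocks₂₁ = r • (Z + Zᵀ).toBlocks₂₁ := by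
      ext; simp [Matrix.toBlocks₂₁]; ring
    rw [h1, h2]
    simp only [Matrix.mul_smul, ← smul_add, RingHom.id_apply]
    rw [Matrix.transpose_smul, ← smul_add]

/-- The supply rate `uᵀ C (A x + B u)` as a linear function of the second moments of `(x, u)`. -/
def supplyMap (A : Matrix (Fin n) (Fin n) ℝ) (B : Matrix (Fin n) (Fin N) ℝ)
    (C : Matrix (Fin N) (Fin n) ℝ) :
    Matrix (Fin n ⊕ Fin N) (Fin n ⊕ Fin N) ℝ →ₗ[ℝ] ℝ where
  toFun Z := (C * (A * (Z + Zᵀ).toBlocks₁₂ + B * (Z + Zᵀ).toBlocks₂₂)).trace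
  map_add' Z Z' := by
    have h1 : ((Z + Z') + (Z + Z')ᵀ).toBlocks₁₂ = (Z + Zᵀ).toBlocks₁₂ + (Z' + Z'ᵀ).toBlocks₁₂ := by
      ext; simp [Matrix.toBlocks₁₂]; ring
    have h2 : ((Z + Z') + (Z + Z')ᵀ).toBlocks₂₂ = (Z + Zᵀ).toBlocks₂₂ + (Z' + Z'ᵀ).toBlocks₂₂ := by
      ext; simp [Matrix.toBlocks₂₂]; ring
    rw [h1, h2, ← Matrix.trace_add]
    congr 1
    simp only [Matrix.mul_add]
    abel
  map_smul' r Z := by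
    have h1 : (r • Z + (r • Z)ᵀ).toBlocks₁₂ = r • (Z + Zᵀ).toBlocks₁₂ := by
      ext; simp [Matrix.toBlocks₁₂]; ring
    have h2 : (r • Z + (r • Z)ᵀ).toBlocks₂₂ = r • (Z + Zᵀ).toBlocks₂₂ := by
      ext; simp [Matrix.toBlocks₂₂]; ring
    rw [h1, h2]
    simp only [Matrix.mul_smul, ← smul_add, Matrix.trace_smul, RingHom.id_apply]

theorem lyapunovMap_vecMulVec (A : Matrix (Fin n) (Fin n) ℝ) (B : Matrix (Fin n) (Fin N) ℝ)
    (x : Fin n → ℝ) (u : Fin N → ℝ) :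
    lyapunovMap A B (Matrix.vecMulVec (Sum.elim x u) (Sum.elim x u)) =
      (2 : ℝ) • (Matrix.vecMulVec (A *ᵥ x + B *ᵥ u) x + Matrix.vecMulVec x (A *ᵥ x + B *ᵥ u)) := by
  ext i j
  simp only [lyapunovMap, LinearMap.coe_mk, AddHom.coe_mk, Matrix.add_apply, Matrix.transpose_apply,
    Matrix.mul_apply, Matrix.toBlocks₁₁, Matrix.toBlocks₂₁, Matrix.of_apply, Matrix.vecMulVec_apply,
    Sum.elim_inl, Sum.elim_inr, Matrix.smul_apply, smul_eq_mul, Pi.add_apply, Matrix.mulVec,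
    dotProduct, add_mul, mul_add, Finset.sum_mul, Finset.mul_sum]
  rw [add_add_add_comm, ← Finset.sum_add_distrib, ← Finset.sum_add_distrib]
  rw [add_add_add_comm, ← Finset.sum_add_distrib, ← Finset.sum_add_distrib]
  congr 1 <;> exact Finset.sum_congr rfl fun k _ => by ring

theorem supplyMap_vecMulVec (A : Matrix (Fin n) (Fin n) ℝ) (B : Matrix (Fin n) (Fin N) ℝ)
    (C : Matrix (Fin N) (Fin n) ℝ) (x : Fin n → ℝ) (u : Fin N → ℝ) :
    supplyMap A B C (Matrix.vecMulVec (Sum.elim x u) (Sum.elim x u)) =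
      2 * (u ⬝ᵥ (C *ᵥ (A *ᵥ x + B *ᵥ u))) := by
  have h1 : (Matrix.vecMulVec (Sum.elim x u) (Sum.elim x u) +
      (Matrix.vecMulVec (Sum.elim x u) (Sum.elim x u))ᵀ).toBlocks₁₂ =
      (2 : ℝ) • Matrix.vecMulVec x u := by
    ext; simp [Matrix.toBlocks₁₂, Matrix.vecMulVec_apply]; ring
  have h2 : (Matrix.vecMulVec (Sum.elim x u) (Sum.elim x u) +
      (Matrix.vecMulVec (Sum.elim x u) (Sum.elim x u))ᵀ).toBlocks₂₂ =
      (2 : ℝ) • Matrix.vecMulVec u u := by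
    ext; simp [Matrix.toBlocks₂₂, Matrix.vecMulVec_apply]; ring
  change (C * (A * (Matrix.vecMulVec (Sum.elim x u) (Sum.elim x u) +
      (Matrix.vecMulVec (Sum.elim x u) (Sum.elim x u))ᵀ).toBlocks₁₂ +
    B * (Matrix.vecMulVec (Sum.elim x u) (Sum.elim x u) +
      (Matrix.vecMulVec (Sum.elim x u) (Sum.elim x u))ᵀ).toBlocks₂₂)).trace = _
  rw [h1, h2, Matrix.mul_smul, Matrix.mul_smul, ← smul_add, Matrix.mul_smul, Matrix.trace_smul,
    Matrix.mul_vecMulVec, Matrix.mul_vecMulVec, ← Matrix.add_vecMulVec, Matrix.mul_vecMulVec,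
    Matrix.trace_vecMulVec, smul_eq_mul, dotProduct_comm]

/-- The real and imaginary parts of a periodic regime contribute nothing to the Lyapunov map. -/
theorem lyapunovMap_periodic {A : Matrix (Fin n) (Fin n) ℝ} {B : Matrix (Fin n) (Fin N) ℝ} {w : ℝ}
    {x : Fin n → ℂ} {u : Fin N → ℂ}
    (h : ((w : ℂ) * Complex.I) • x = toC A *ᵥ x + toC B *ᵥ u) :
    lyapunovMap A B
      (Matrix.vecMulVec (Sum.elim (fun i => (x i).re) fun i => (u i).re)
          (Sum.elim (fun i => (x i).re) fun i => (u i).re) +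
        Matrix.vecMulVec (Sum.elim (fun i => (x i).im) fun i => (u i).im)
          (Sum.elim (fun i => (x i).im) fun i => (u i).im)) = 0 := by
  have hre : (A *ᵥ fun i => (x i).re) + (B *ᵥ fun i => (u i).re) = fun i => -(w * (x i).im) := by
    ext i
    rw [Pi.add_apply, ← toC_mulVec_re, ← toC_mulVec_re, ← Complex.add_re, ← Pi.add_apply, ← h]
    simp
  have him : (A *ᵥ fun i => (x i).im) + (B *ᵥ fun i => (u i).im) = fun i => w * (x i).re := by
    ext i
    rw [Pi.add_apply, ← toC_mulVec_im, ← toC_mulVec_im, ← Complex.add_im, ← Pi.add_apply, ← h]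
    simp
  rw [map_add, lyapunovMap_vecMulVec, lyapunovMap_vecMulVec, hre, him]
  ext i j
  simp [Matrix.vecMulVec_apply]
  ring

/-- The periodic regimes of a controllable system span the space of states and inputs. -/
theorem span_periodic_eq_top {A : Matrix (Fin n) (Fin n) ℝ} {B : Matrix (Fin n) (Fin N) ℝ}
    (hctr : ∀ p : Fin n → ℂ, (∀ j : ℕ, p ᵥ* (toC A ^ j * toC B) = 0) → p = 0) :
    Submodule.span ℝ {v : Fin n ⊕ Fin N → ℝ | ∃ v', lyapunovMap A B
      (Matrix.vecMulVec v v + Matrix.vecMulVec v' v') = 0} = ⊤ := by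
  by_contra hne
  obtain ⟨f, hf, hle⟩ := Submodule.exists_le_ker_of_lt_top _ (lt_top_iff_ne_top.2 hne)
  apply hf
  set p : Fin n ⊕ Fin N → ℝ := fun i => f (Pi.single i 1) with hp
  have hfp : ∀ v, f v = p ⬝ᵥ v := fun v => by
    conv_lhs => rw [pi_eq_sum_univ' v]
    rw [map_sum]
    refine Finset.sum_congr rfl fun i _ => ?_
    rw [map_smul, smul_eq_mul, mul_comm]
  set p₁ : Fin n → ℂ := fun i => (p (Sum.inl i) : ℂ) with hp₁
  -- pairing with a periodic regime
  have hpair : ∀ (w : ℝ) (x : Fin n → ℂ) (k : Fin N),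
      ((w : ℂ) * Complex.I) • x = toC A *ᵥ x + toC B *ᵥ (Pi.single k 1) →
      p₁ ⬝ᵥ x + (p (Sum.inr k) : ℂ) = 0 := by
    intro w x k h
    have h1 := lyapunovMap_periodic h
    have h2 := hle (Submodule.subset_span ⟨_, h1⟩)
    -- Exchanging the two vectors of a regime shows that its imaginary part lies in the spanning set
    -- too.
    have h3 := hle (Submodule.subset_span ⟨_, by rw [add_comm] at h1; exact h1⟩)
    rw [LinearMap.mem_ker, hfp] at h2 h3
    simp only [dotProduct, Fintype.sum_sum_type, Sum.elim_inl, Sum.elim_inr, Pi.single_apply] at h2 h3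
    apply Complex.ext
    · simp only [dotProduct, Complex.add_re, Complex.re_sum, hp₁, Complex.re_ofReal_mul,
        Complex.ofReal_re, Complex.zero_re]
      rw [← h2]
      congr 1
      rw [Finset.sum_eq_single k]
      · simp
      · intro b _ hb; simp [hb]
      · simp
    · simp only [dotProduct, Complex.add_im, Complex.im_sum, hp₁, Complex.im_ofReal_mul,
        Complex.ofReal_im, Complex.zero_im]
      have h4 : ∀ b, ((if b = k then 1 else 0 : ℂ)).im = 0 := fun b => by split_ifs <;> simp
      simpa only [h4, mul_zero, Finset.sum_const_zero] using h3
  have key : ∀ k : Fin N, p (Sum.inr k) = 0 ∧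
      ∀ j : ℕ, (p₁ ᵥ* toC A ^ j) ⬝ᵥ (toC B *ᵥ (Pi.single k 1)) = 0 := by
    intro k
    obtain ⟨hreg, hlim⟩ := tendsto_resolventMatrix_mulVec (toC A) (toC B *ᵥ (Pi.single k 1))
    set X : ℝ → Fin n → ℂ := fun w =>
      resolventMatrix (toC A) (w * Complex.I) *ᵥ (toC B *ᵥ (Pi.single k 1)) with hX
    have hXeq : ∀ᶠ w : ℝ in atTop,
        ((w : ℂ) * Complex.I) • X w = toC A *ᵥ X w + toC B *ᵥ (Pi.single k 1) := by
      filter_upwards [hreg] with w hw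
      rw [hX]
      simp only []
      rw [Matrix.mulVec_mulVec _ (toC A), mul_resolventMatrix hw, Matrix.sub_mulVec,
        Matrix.one_mulVec, Matrix.smul_mulVec]
      abel
    have hlimq : ∀ q : Fin n → ℂ, Tendsto (fun w => q ⬝ᵥ X w) atTop (𝓝 0) := fun q => by
      have hc : Continuous fun y : Fin n → ℂ => q ⬝ᵥ y := continuous_const.dotProduct continuous_id
      have := (hc.tendsto 0).comp hlim
      rw [dotProduct_zero] at this
      exact this
    -- At high frequency the state tends to 0, so only the input component survives in the pairing.
    have h0 : p (Sum.inr k) = 0 := by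
      have h1 := (hlimq p₁).add_const (p (Sum.inr k) : ℂ)
      have h2 : Tendsto (fun w => p₁ ⬝ᵥ X w + (p (Sum.inr k) : ℂ)) atTop (𝓝 0) := by
        refine tendsto_const_nhds.congr' ?_
        filter_upwards [hXeq] with w hw using (hpair w (X w) k hw).symm
      have h3 := tendsto_nhds_unique h1 h2
      rw [zero_add] at h3
      exact_mod_cast h3
    refine ⟨h0, ?_⟩
    -- Multiplying qX(ω) = 0 by jω and inserting the state equation gives qAX(ω) + qBu = 0. The
    -- limit ω → ∞ separates the two terms, and the argument iterates with qA.
    have hstep : ∀ q : Fin n → ℂ, (∀ᶠ w in atTop, q ⬝ᵥ X w = 0) →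
        q ⬝ᵥ (toC B *ᵥ (Pi.single k 1)) = 0 ∧ ∀ᶠ w in atTop, (q ᵥ* toC A) ⬝ᵥ X w = 0 := by
      intro q hq
      have h1 : ∀ᶠ w in atTop, (q ᵥ* toC A) ⬝ᵥ X w + q ⬝ᵥ (toC B *ᵥ (Pi.single k 1)) = 0 := by
        filter_upwards [hq, hXeq] with w hw hw'
        rw [← Matrix.dotProduct_mulVec, ← dotProduct_add, ← hw', dotProduct_smul, hw, smul_zero]
      have h2 := (hlimq (q ᵥ* toC A)).add_const (q ⬝ᵥ (toC B *ᵥ (Pi.single k 1)))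
      have h3 := tendsto_nhds_unique h2 (tendsto_const_nhds.congr' (h1.mono fun _ h => h.symm))
      rw [zero_add] at h3
      refine ⟨h3, h1.mono fun w hw => ?_⟩
      rwa [h3, add_zero] at hw
    have hall : ∀ j : ℕ, ∀ᶠ w in atTop, (p₁ ᵥ* toC A ^ j) ⬝ᵥ X w = 0 := by
      intro j
      induction j with
      | zero =>
        rw [pow_zero, Matrix.vecMul_one]
        filter_upwards [hXeq] with w hw
        have := hpair w (X w) k hw
        rwa [h0, Complex.ofReal_zero, add_zero] at this
      | succ j ih =>
        have := (hstep _ ih).2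
        rwa [Matrix.vecMul_vecMul, ← pow_succ] at this
    exact fun j => (hstep _ (hall j)).1
  have hp1 : p₁ = 0 := hctr p₁ fun j => by
    ext k
    have := (key k).2 j
    rw [Matrix.dotProduct_mulVec, Matrix.vecMul_vecMul, dotProduct_single_one] at this
    exact this
  have hp0 : p = 0 := by
    ext i
    rcases i with i | k
    · have := congrFun hp1 i
      simpa [hp₁] using this
    · exact (key k).1
  ext v
  simp [hp0] at hfp
  simp [hfp]

/-- There is a positive definite second moment matrix of periodic regimes. -/
theorem exists_posDef_lyapunovMap_eq_zero {A : Matrix (Fin n) (Fin n) ℝ}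
    {B : Matrix (Fin n) (Fin N) ℝ}
    (hctr : ∀ p : Fin n → ℂ, (∀ j : ℕ, p ᵥ* (toC A ^ j * toC B) = 0) → p = 0) :
    ∃ Z, Z.PosDef ∧ lyapunovMap A B Z = 0 := by
  have hspan := span_periodic_eq_top hctr
  set V := {v : Fin n ⊕ Fin N → ℝ | ∃ v', lyapunovMap A B
      (Matrix.vecMulVec v v + Matrix.vecMulVec v' v') = 0} with hV
  -- Finitely many regimes already span; a vector annihilated by the sum of their squares is
  -- orthogonal to the whole space.
  obtain ⟨s, hsV, hs⟩ := (Submodule.fg_span_iff_fg_span_finset_subset V).1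
    (IsNoetherian.noetherian (Submodule.span ℝ V))
  choose! g hg using fun v (hv : v ∈ V) => hv
  refine ⟨∑ v ∈ s, (Matrix.vecMulVec v v + Matrix.vecMulVec (g v) (g v)), ?_, ?_⟩
  · have hquad : ∀ v p : Fin n ⊕ Fin N → ℝ, p ⬝ᵥ (Matrix.vecMulVec v v *ᵥ p) = (p ⬝ᵥ v) ^ 2 :=
      fun v p => by
        rw [Matrix.vecMulVec_mulVec]
        simp [dotProduct_smul, dotProduct_comm, sq]
    refine .of_dotProduct_mulVec_pos ?_ fun p hp => ?_
    · unfold Matrix.IsHermitian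
      rw [Matrix.conjTranspose_eq_transpose_of_trivial, Matrix.transpose_sum]
      refine Finset.sum_congr rfl fun v _ => ?_
      rw [Matrix.transpose_add, Matrix.transpose_vecMulVec, Matrix.transpose_vecMulVec]
    · rw [star_trivial, Matrix.sum_mulVec, dotProduct_sum]
      have hterm : ∀ v, p ⬝ᵥ ((Matrix.vecMulVec v v + Matrix.vecMulVec (g v) (g v)) *ᵥ p) =
          (p ⬝ᵥ v) ^ 2 + (p ⬝ᵥ g v) ^ 2 := fun v => by
        rw [Matrix.add_mulVec, dotProduct_add, hquad, hquad]
      simp only [hterm]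
      refine lt_of_le_of_ne (Finset.sum_nonneg fun v _ => by positivity) fun h0 => hp ?_
      have h1 := (Finset.sum_eq_zero_iff_of_nonneg fun v _ => by positivity).1 h0.symm
      have h2 : ∀ y : Fin n ⊕ Fin N → ℝ, p ⬝ᵥ y = 0 := by
        intro y
        have hy : y ∈ Submodule.span ℝ (s : Set (Fin n ⊕ Fin N → ℝ)) := by
          rw [← hs, hspan]; trivial
        induction hy using Submodule.span_induction with
        | mem x hx =>
          have := h1 x hx
          nlinarith [sq_nonneg (p ⬝ᵥ x), sq_nonneg (p ⬝ᵥ g x)]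
        | zero => simp
        | add x y _ _ hx hy => rw [dotProduct_add, hx, hy, add_zero]
        | smul r x _ hx => rw [dotProduct_smul, hx, smul_zero]
      exact dotProduct_self_eq_zero.1 (h2 p)
  · rw [map_sum]
    exact Finset.sum_eq_zero fun v hv => hg v (hsV hv)

/-- **Kalman–Yakubovich–Popov lemma** for the supply rate `uᵀ ẏ`. -/
theorem exists_storage_matrix {A : Matrix (Fin n) (Fin n) ℝ} {B : Matrix (Fin n) (Fin N) ℝ}
    {C : Matrix (Fin N) (Fin n) ℝ}
    (hctr : ∀ p : Fin n → ℂ, (∀ j : ℕ, p ᵥ* (toC A ^ j * toC B) = 0) → p = 0)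
    (hfreq : ∀ (w : ℝ) (x : Fin n → ℂ) (u : Fin N → ℂ),
      ((w : ℂ) * Complex.I) • x = toC A *ᵥ x + toC B *ᵥ u →
      0 ≤ (star u ⬝ᵥ (toC C *ᵥ (((w : ℂ) * Complex.I) • x))).re)
    (hfeed : ∀ u, 0 ≤ u ⬝ᵥ (C *ᵥ (B *ᵥ u))) :
    ∃ P : Matrix (Fin n) (Fin n) ℝ, Pᵀ = P ∧
      ∀ x u, (P *ᵥ x) ⬝ᵥ (A *ᵥ x + B *ᵥ u) ≤ u ⬝ᵥ (C *ᵥ (A *ᵥ x + B *ᵥ u)) := by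
  obtain ⟨Z₀, hZ₀, hL₀⟩ := exists_posDef_lyapunovMap_eq_zero hctr
  have hZ₀t : Z₀ᵀ = Z₀ := by
    rw [← Matrix.conjTranspose_eq_transpose_of_trivial]; exact hZ₀.isHermitian
  have hS₀ : (Z₀ + Z₀ᵀ).PosDef := by rw [hZ₀t]; exact hZ₀.add hZ₀
  have hpd : ∀ Z, lyapunovMap A B Z = 0 → (Z + Zᵀ).PosDef → 0 ≤ supplyMap A B C Z :=
    fun Z hZ hpos => trace_nonneg_of_posDef hfreq hfeed hpos hZ
  -- A semidefinite moment matrix is perturbed by a small multiple of the positive definite `Z₀`,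
  -- the multiple being chosen so that the supply rate changes by at most `ε`.
  have hpsd : ∀ Z, lyapunovMap A B Z = 0 → (Z + Zᵀ).PosSemidef → 0 ≤ supplyMap A B C Z := by
    intro Z hZ hpos
    refine le_of_forall_pos_le_add fun ε hε => ?_
    set q := supplyMap A B C Z₀
    have hδ : 0 < ε / (|q| + 1) := by positivity
    have h1 := hpd (Z + (ε / (|q| + 1)) • Z₀) (by rw [map_add, map_smul, hZ, hL₀]; simp) (by
      have : Z + (ε / (|q| + 1)) • Z₀ + (Z + (ε / (|q| + 1)) • Z₀)ᵀ =
          (Z + Zᵀ) + (ε / (|q| + 1)) • (Z₀ + Z₀ᵀ) := by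
        rw [Matrix.transpose_add, Matrix.transpose_smul, smul_add]; abel
      rw [this]
      exact Matrix.PosDef.posSemidef_add hpos (hS₀.smul hδ))
    rw [map_add, map_smul, smul_eq_mul] at h1
    have h2 : ε / (|q| + 1) * q ≤ ε := by
      rw [div_mul_eq_mul_div, div_le_iff₀ (by positivity)]
      exact mul_le_mul_of_nonneg_left ((le_abs_self q).trans (by linarith)) hε.le
    linarith
  let s : PointedCone ℝ (Matrix (Fin n ⊕ Fin N) (Fin n ⊕ Fin N) ℝ) :=
    { carrier := {Z | (Z + Zᵀ).PosSemidef}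
      add_mem' := fun {Z Z'} hZ hZ' => by
        have : (Z + Z') + (Z + Z')ᵀ = (Z + Zᵀ) + (Z' + Z'ᵀ) := by
          rw [Matrix.transpose_add]; abel
        change ((Z + Z') + (Z + Z')ᵀ).PosSemidef
        rw [this]
        exact Matrix.PosSemidef.add hZ hZ'
      zero_mem' := by
        change ((0 : Matrix (Fin n ⊕ Fin N) (Fin n ⊕ Fin N) ℝ) + 0ᵀ).PosSemidef
        simpa using Matrix.PosSemidef.zero
      smul_mem' := fun r Z hZ => by
        change ((r : ℝ) • Z + ((r : ℝ) • Z)ᵀ).PosSemidef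
        rw [Matrix.transpose_smul, ← smul_add]
        exact Matrix.PosSemidef.smul hZ r.2 }
  have hmem : ∀ Z, Z ∈ s ↔ (Z + Zᵀ).PosSemidef := fun Z => Iff.rfl
  -- The supply rate is nonnegative on the part of the cone inside the kernel. The extension needs
  -- the kernel to meet every translate of the cone, which holds because `Z₀` lies in it and `Z₀ +
  -- Z₀ᵀ` is an order unit.
  obtain ⟨g, hgf, hgs⟩ := riesz_extension s
    ⟨LinearMap.ker (lyapunovMap A B), (supplyMap A B C).domRestrict _⟩
    (fun x hx => hpsd x.1 x.2 hx)
    (fun y => by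
      obtain ⟨r, hr⟩ := exists_smul_add_posSemidef hS₀ (M := y + yᵀ)
        (by rw [Matrix.transpose_add, Matrix.transpose_transpose, add_comm])
      refine ⟨⟨r • Z₀, by
        change r • Z₀ ∈ LinearMap.ker (lyapunovMap A B)
        rw [LinearMap.mem_ker, map_smul, hL₀, smul_zero]⟩, ?_⟩
      rw [hmem]
      have : r • Z₀ + y + (r • Z₀ + y)ᵀ = r • (Z₀ + Z₀ᵀ) + (y + yᵀ) := by
        rw [Matrix.transpose_add, Matrix.transpose_smul, smul_add]; abel
      change (r • Z₀ + y + (r • Z₀ + y)ᵀ).PosSemidef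
      rw [this]
      exact hr)
  -- The difference vanishes on the kernel of the Lyapunov map, hence factors through it; the factor
  -- `φ` is a Lagrange multiplier and yields `P`.
  have hker : g - supplyMap A B C ∈ (LinearMap.ker (lyapunovMap A B)).dualAnnihilator := by
    rw [Submodule.mem_dualAnnihilator]
    intro Z hZ
    have := hgf ⟨Z, hZ⟩
    change g Z = supplyMap A B C Z at this
    rw [LinearMap.sub_apply, this, sub_self]
  rw [← LinearMap.range_dualMap_eq_dualAnnihilator_ker] at hker
  obtain ⟨φ, hφ⟩ := hker
  have hφ' : ∀ Z, φ (lyapunovMap A B Z) = g Z - supplyMap A B C Z := fun Z =>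
    LinearMap.congr_fun hφ Z
  set P : Matrix (Fin n) (Fin n) ℝ := Matrix.of fun i j =>
    -φ (Matrix.single i j 1 + Matrix.single j i 1) with hP
  have hφP : ∀ ξ x : Fin n → ℝ, φ (Matrix.vecMulVec ξ x + Matrix.vecMulVec x ξ) =
      -((P *ᵥ x) ⬝ᵥ ξ) := by
    intro ξ x
    have h1 : Matrix.vecMulVec ξ x + Matrix.vecMulVec x ξ = ∑ i, ∑ j, (ξ i * x j) •
        (Matrix.single i j (1 : ℝ) + Matrix.single j i 1) := by
      ext k l
      simp only [Matrix.add_apply, Matrix.vecMulVec_apply, Matrix.sum_apply, Matrix.smul_apply,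
        Matrix.single_apply, smul_eq_mul, mul_add, mul_ite, mul_one, mul_zero, ite_and,
        Finset.sum_add_distrib, Finset.sum_ite_eq', Finset.mem_univ, if_true]
      rw [mul_comm (x k), Finset.sum_comm]
      simp
    rw [h1, map_sum]
    simp only [map_sum, map_smul, smul_eq_mul, dotProduct, Matrix.mulVec, hP, Matrix.of_apply,
      Finset.sum_mul, ← Finset.sum_neg_distrib]
    exact Finset.sum_congr rfl fun i _ => Finset.sum_congr rfl fun j _ => by ring
  refine ⟨P, by ext i j; simp only [hP, Matrix.transpose_apply, Matrix.of_apply, add_comm],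
    fun x u => ?_⟩
  -- At the rank-one moment matrix of (x, u), with ξ = Ax + Bu, nonnegativity of `g` reads 2uᵀCξ −
  -- 2(Px)ᵀξ ≥ 0.
  set v := Matrix.vecMulVec (Sum.elim x u) (Sum.elim x u) with hv
  have h1 : 0 ≤ g v := by
    apply hgs
    rw [hmem]
    have hv1 : v.PosSemidef := by
      have := Matrix.posSemidef_vecMulVec_self_star (R := ℝ) (Sum.elim x u)
      rwa [star_trivial] at this
    have hv2 : vᵀ = v := by
      rw [hv, Matrix.transpose_vecMulVec]
    rw [hv2]
    exact hv1.add hv1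
  have h2 := hφ' v
  rw [hv, lyapunovMap_vecMulVec, supplyMap_vecMulVec, map_smul, hφP, ← hv, smul_eq_mul] at h2
  linarith

end Riesz

/-! ### Spectral splitting into decaying motions and undamped modes -/

section StableSubspace

variable {n : ℕ}

/-- The states from which the free motion of `γ' = T γ` decays. -/
def stableSubspace (T : Module.End ℂ (Fin n → ℂ)) : Submodule ℂ (Fin n → ℂ) where
  carrier := {x | ∃ γ : ℝ → Fin n → ℂ,
    γ 0 = x ∧ (∀ t, HasDerivAt γ (T (γ t)) t) ∧ Tendsto γ atTop (𝓝 0)}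
  add_mem' := by
    rintro x y ⟨γ, h0, hd, hl⟩ ⟨γ', h0', hd', hl'⟩
    refine ⟨fun t => γ t + γ' t, by simp only [h0, h0'], fun t => ?_, ?_⟩
    · rw [map_add]; exact (hd t).add (hd' t)
    · simpa using hl.add hl'
  zero_mem' := ⟨fun _ => 0, rfl, fun t => by rw [map_zero]; exact hasDerivAt_const t 0,
    tendsto_const_nhds⟩
  smul_mem' := by
    rintro r x ⟨γ, h0, hd, hl⟩
    refine ⟨fun t => r • γ t, by simp only [h0], fun t => ?_, ?_⟩
    · rw [map_smul]; exact (hd t).const_smul r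
    · simpa using hl.const_smul r

theorem tendsto_pow_mul_cexp (j : ℕ) {μ : ℂ} (hμ : μ.re < 0) :
    Tendsto (fun t : ℝ => ((t : ℂ) ^ j / (j.factorial : ℂ)) * Complex.exp (μ * t)) atTop (𝓝 0) := by
  rw [tendsto_zero_iff_norm_tendsto_zero]
  have h := (tendsto_rpow_mul_exp_neg_mul_atTop_nhds_zero j (-μ.re) (by linarith)).div_const
    (j.factorial : ℝ)
  rw [zero_div] at h
  refine h.congr' ?_
  filter_upwards [eventually_ge_atTop 0] with t ht
  rw [norm_mul, norm_div, norm_pow, Complex.norm_real, Complex.norm_natCast, Complex.norm_exp,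
    Real.norm_of_nonneg ht, Real.rpow_natCast, Complex.re_mul_ofReal, neg_neg]
  ring

/-- The motion through x is e^{μt} Σ t^j/j! S^j x with S = T − μ. The sum is finite on a generalized
eigenvector, and the exponential beats its polynomial growth. -/
theorem maxGenEigenspace_le_stableSubspace (T : Module.End ℂ (Fin n → ℂ)) {μ : ℂ}
    (hμ : μ.re < 0) : T.maxGenEigenspace μ ≤ stableSubspace T := by
  intro x hx
  obtain ⟨k, hk⟩ := (Module.End.mem_maxGenEigenspace T μ x).1 hx
  set S := T - μ • (1 : Module.End ℂ (Fin n → ℂ)) with hS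
  have hT : ∀ y, T y = S y + μ • y := fun y => by simp [hS]
  set φ : ℕ → ℝ → Fin n → ℂ := fun k t =>
    ∑ j ∈ Finset.range k, ((t : ℂ) ^ j / (j.factorial : ℂ)) • (S ^ j) x with hφ
  have hg : ∀ (j : ℕ) (t : ℝ), HasDerivAt
      (fun t : ℝ => (t : ℂ) ^ (j + 1) / ((j + 1).factorial : ℂ)) ((t : ℂ) ^ j / (j.factorial : ℂ)) t := by
    intro j t
    have h := ((hasDerivAt_id t).ofReal_comp.pow (j + 1)).div_const ((j + 1).factorial : ℂ)
    refine h.congr_deriv ?_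
    have h1 : ((j : ℂ) + 1) ≠ 0 := by exact_mod_cast Nat.succ_ne_zero j
    have h2 : (j.factorial : ℂ) ≠ 0 := by exact_mod_cast j.factorial_ne_zero
    simp only [id, Nat.factorial_succ, Nat.cast_mul, Nat.cast_add, Nat.cast_one, Complex.ofReal_one,
      Nat.add_sub_cancel]
    field_simp
  have hφd : ∀ k t, HasDerivAt (φ (k + 1)) (S (φ k t)) t := by
    intro k t
    have h1 : φ (k + 1) = fun t : ℝ => (∑ j ∈ Finset.range k,
        ((t : ℂ) ^ (j + 1) / ((j + 1).factorial : ℂ)) • (S ^ (j + 1)) x) + x := by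
      ext1 t
      simp only [hφ]
      rw [Finset.sum_range_succ']
      simp
    rw [h1]
    have h2 : S (φ k t) = ∑ j ∈ Finset.range k, ((t : ℂ) ^ j / (j.factorial : ℂ)) • (S ^ (j + 1)) x := by
      simp only [hφ, map_sum, map_smul]
      refine Finset.sum_congr rfl fun j _ => ?_
      rw [pow_succ' S, Module.End.mul_apply]
    rw [h2]
    exact (HasDerivAt.fun_sum fun j _ => (hg j t).smul_const _).add_const x
  -- Since `(S ^ k) x = 0` the truncated series is stationary in `k`, so its derivative is `S`
  -- applied to itself.
  have hφk : φ (k + 1) = φ k := by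
    ext1 t
    simp only [hφ]
    rw [Finset.sum_range_succ, hk, smul_zero, add_zero]
  refine ⟨fun t => Complex.exp (μ * t) • φ (k + 1) t, ?_, fun t => ?_, ?_⟩
  · simp only [hφ]
    rw [Finset.sum_range_succ']
    simp
  · have he : HasDerivAt (fun t : ℝ => Complex.exp (μ * t)) (Complex.exp (μ * t) * μ) t := by
      have h := ((hasDerivAt_id t).ofReal_comp.const_mul μ).cexp
      simpa using h
    refine (he.smul (hφd k t)).congr_deriv ?_
    rw [map_smul, hT, ← hφk, smul_add, smul_smul]
  · have h : ∀ j, Tendsto (fun t : ℝ =>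
        (((t : ℂ) ^ j / (j.factorial : ℂ)) * Complex.exp (μ * t)) • (S ^ j) x) atTop (𝓝 0) :=
      fun j => by simpa using (tendsto_pow_mul_cexp j hμ).smul_const ((S ^ j) x)
    have h2 := tendsto_finsetSum (Finset.range (k + 1)) fun j _ => h j
    rw [Finset.sum_const_zero] at h2
    refine h2.congr fun t => ?_
    simp only [hφ, Finset.smul_sum, smul_smul]
    exact Finset.sum_congr rfl fun j _ => by rw [mul_comm]

/-- Spectral decomposition of an operator without eigenvalues in the open right half plane, and
with semisimple eigenvalues on the imaginary axis. -/
theorem stableSubspace_sup_iSup_eigenspace (T : Module.End ℂ (Fin n → ℂ))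
    (hright : ∀ μ : ℂ, 0 < μ.re → T.eigenspace μ = ⊥)
    (hsemi : ∀ (w : ℝ) x, (T - ((w : ℂ) * Complex.I) • (1 : Module.End ℂ (Fin n → ℂ)))
      ((T - ((w : ℂ) * Complex.I) • (1 : Module.End ℂ (Fin n → ℂ))) x) = 0 →
        (T - ((w : ℂ) * Complex.I) • (1 : Module.End ℂ (Fin n → ℂ))) x = 0) :
    stableSubspace T ⊔ ⨆ w : ℝ, T.eigenspace ((w : ℂ) * Complex.I) = ⊤ := by
  rw [eq_top_iff, ← Module.End.iSup_maxGenEigenspace_eq_top T]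
  refine iSup_le fun μ => ?_
  rcases lt_trichotomy μ.re 0 with h | h | h
  · exact (maxGenEigenspace_le_stableSubspace T h).trans le_sup_left
  · have hμ : μ = (μ.im : ℂ) * Complex.I := by
      apply Complex.ext <;> simp [h]
    refine le_trans ?_ le_sup_right
    refine le_trans ?_ (le_iSup (fun w : ℝ => T.eigenspace ((w : ℂ) * Complex.I)) μ.im)
    intro x hx
    obtain ⟨k, hk⟩ := (Module.End.mem_maxGenEigenspace T μ x).1 hx
    rw [hμ] at hk
    set S := T - ((μ.im : ℂ) * Complex.I) • (1 : Module.End ℂ (Fin n → ℂ)) with hS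
    -- Semisimplicity shortens a chain of generalized eigenvectors by one step at a time.
    have key : ∀ k : ℕ, (S ^ k) x = 0 → S x = 0 := by
      intro k
      induction k with
      | zero => intro h; rw [pow_zero, Module.End.one_apply] at h; rw [h, map_zero]
      | succ k ih =>
        intro h
        cases k with
        | zero => simpa using h
        | succ k =>
          refine ih ?_
          rw [pow_succ', Module.End.mul_apply]
          refine hsemi _ _ ?_
          rwa [pow_succ', Module.End.mul_apply, pow_succ', Module.End.mul_apply] at h
    have := key k hk
    rw [Module.End.mem_eigenspace_iff]
    simpa [hS, sub_eq_zero] using this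
  · intro x hx
    obtain ⟨k, hk⟩ := (Module.End.mem_maxGenEigenspace T μ x).1 hx
    have hinj : ∀ y, (T - μ • (1 : Module.End ℂ (Fin n → ℂ))) y = 0 → y = 0 := fun y hy => by
      rw [← Submodule.mem_bot ℂ, ← hright μ h, Module.End.mem_eigenspace_iff]
      simpa [sub_eq_zero] using hy
    have hx0 : x = 0 := by
      induction k with
      | zero => simpa using hk
      | succ k ih =>
        rw [pow_succ', Module.End.mul_apply] at hk
        exact ih (hinj _ hk)
    rw [hx0]
    exact zero_mem _

end StableSubspace

/-! ### Sign of a Lyapunov form -/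

section Lyapunov

variable {n : ℕ}

theorem star_dotProduct_mulVec_comm {p : Matrix (Fin n) (Fin n) ℂ} (hp : pᴴ = p) (x y : Fin n → ℂ) :
    star (star x ⬝ᵥ (p *ᵥ y)) = star y ⬝ᵥ (p *ᵥ x) := by
  rw [← Matrix.star_dotProduct, Matrix.star_mulVec, hp, Matrix.dotProduct_mulVec]

/-- A Lyapunov inequality whose form is positive on the undamped modes has a positive form. -/
theorem re_dotProduct_mulVec_nonneg {p : Matrix (Fin n) (Fin n) ℂ} {T : Module.End ℂ (Fin n → ℂ)}
    (hp : pᴴ = p) (htop : stableSubspace T ⊔ ⨆ w : ℝ, T.eigenspace ((w : ℂ) * Complex.I) = ⊤)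
    (hlyap : ∀ x, (star x ⬝ᵥ (p *ᵥ T x)).re ≤ 0)
    (horth : ∀ (w : ℝ) v, T v = ((w : ℂ) * Complex.I) • v → ∀ y,
      star v ⬝ᵥ (p *ᵥ T y) = ((w : ℂ) * Complex.I) * (star v ⬝ᵥ (p *ᵥ y)))
    (hpos : ∀ (w : ℝ) v, T v = ((w : ℂ) * Complex.I) • v → 0 ≤ (star v ⬝ᵥ (p *ᵥ v)).re)
    (x : Fin n → ℂ) : 0 ≤ (star x ⬝ᵥ (p *ᵥ x)).re := by
  have hderiv : ∀ {γ : ℝ → Fin n → ℂ} {γ' : Fin n → ℂ} {t : ℝ},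
      HasDerivAt γ γ' t → HasDerivAt (fun t => p *ᵥ γ t) (p *ᵥ γ') t := by
    intro γ γ' t h
    rw [hasDerivAt_pi] at h ⊢
    intro i
    simp only [Matrix.mulVec, dotProduct]
    exact HasDerivAt.fun_sum fun j _ => (h j).const_mul _
  -- decaying motions have nonnegative energy
  have hz : ∀ z ∈ stableSubspace T, 0 ≤ (star z ⬝ᵥ (p *ᵥ z)).re := by
    rintro z ⟨γ, h0, hd, hl⟩
    have hh : ∀ t, HasDerivAt (fun t => (star (γ t) ⬝ᵥ (p *ᵥ γ t)).re)
        (2 * (star (γ t) ⬝ᵥ (p *ᵥ T (γ t))).re) t := by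
      intro t
      have h1 : HasDerivAt (fun t => star (γ t) ⬝ᵥ (p *ᵥ γ t))
          (star (T (γ t)) ⬝ᵥ (p *ᵥ γ t) + star (γ t) ⬝ᵥ (p *ᵥ T (γ t))) t := by
        have ha := hderiv (hd t)
        have hb := (hd t).star
        rw [hasDerivAt_pi] at ha hb
        simp only [dotProduct, ← Finset.sum_add_distrib]
        exact HasDerivAt.fun_sum fun j _ => (hb j).mul (ha j)
      have h2 := (Complex.reCLM.hasFDerivAt.comp_hasDerivAt t h1)
      refine h2.congr_deriv ?_
      rw [Complex.reCLM_apply, Complex.add_re, ← star_dotProduct_mulVec_comm hp]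
      simp only [RCLike.star_def, Complex.conj_re]
      ring
    have hanti : Antitone fun t => (star (γ t) ⬝ᵥ (p *ᵥ γ t)).re :=
      antitone_of_hasDerivAt_nonpos hh fun t => by have := hlyap (γ t); simp only [Pi.zero_apply]; linarith
    have hc : Continuous fun y : Fin n → ℂ => (star y ⬝ᵥ (p *ᵥ y)).re := by
      simp only [Matrix.mulVec, dotProduct, Pi.star_apply]; fun_prop
    have hlim := (hc.tendsto 0).comp hl
    have := hanti.le_of_tendsto hlim 0
    simpa [h0] using this
  -- decaying motions are orthogonal to the undamped modes
  have hzv : ∀ z ∈ stableSubspace T, ∀ (w : ℝ) v, T v = ((w : ℂ) * Complex.I) • v →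
      star v ⬝ᵥ (p *ᵥ z) = 0 := by
    rintro z ⟨γ, h0, hd, hl⟩ w v hv
    set h : ℝ → ℂ := fun t => star v ⬝ᵥ (p *ᵥ γ t) with hh
    have h1 : ∀ t, HasDerivAt h (((w : ℂ) * Complex.I) * h t) t := by
      intro t
      rw [hh]
      simp only
      rw [← horth w v hv]
      have ha := hderiv (hd t)
      rw [hasDerivAt_pi] at ha
      simp only [dotProduct]
      exact HasDerivAt.fun_sum fun j _ => (ha j).const_mul _
    have h2 : ∀ t, HasDerivAt (fun t : ℝ => Complex.exp (-((w : ℂ) * Complex.I) * t) * h t) 0 t := by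
      intro t
      have he : HasDerivAt (fun t : ℝ => Complex.exp (-((w : ℂ) * Complex.I) * t))
          (Complex.exp (-((w : ℂ) * Complex.I) * t) * (-((w : ℂ) * Complex.I))) t := by
        have h := ((hasDerivAt_id t).ofReal_comp.const_mul (-((w : ℂ) * Complex.I))).cexp
        simpa using h
      refine (he.mul (h1 t)).congr_deriv ?_
      ring
    -- The pairing only rotates, so its modulus is constant; along a decaying motion it also tends
    -- to 0.
    have h3 : ∀ t, ‖h t‖ = ‖h 0‖ := by
      intro t
      have := is_const_of_deriv_eq_zero (fun t => (h2 t).differentiableAt) (fun t => (h2 t).deriv) t 0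
      have h4 := congrArg norm this
      simp only [norm_mul, Complex.norm_exp] at h4
      simpa using h4
    have hc : Continuous fun y : Fin n → ℂ => ‖star v ⬝ᵥ (p *ᵥ y)‖ := by
      simp only [Matrix.mulVec, dotProduct]; fun_prop
    have hlim := (hc.tendsto 0).comp hl
    have h4 : Tendsto (fun _ : ℝ => ‖h 0‖) atTop (𝓝 ‖star v ⬝ᵥ (p *ᵥ 0)‖) := hlim.congr h3
    have h5 := tendsto_nhds_unique h4 tendsto_const_nhds
    rw [← h0]
    rw [Matrix.mulVec_zero, dotProduct_zero, norm_zero] at h5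
    exact norm_eq_zero.1 h5.symm
  have hx : x ∈ stableSubspace T ⊔ ⨆ w : ℝ, T.eigenspace ((w : ℂ) * Complex.I) := by
    rw [htop]; trivial
  obtain ⟨z, hzs, y, hy, rfl⟩ := Submodule.mem_sup.1 hx
  rw [Submodule.mem_iSup_iff_exists_finsupp] at hy
  obtain ⟨f, hf, rfl⟩ := hy
  have hfe : ∀ w : ℝ, T (f w) = ((w : ℂ) * Complex.I) • f w := fun w =>
    Module.End.mem_eigenspace_iff.1 (hf w)
  have hff : ∀ w w' : ℝ, w ≠ w' → star (f w) ⬝ᵥ (p *ᵥ f w') = 0 := by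
    intro w w' hne
    have h1 := horth w (f w) (hfe w) (f w')
    rw [hfe w', Matrix.mulVec_smul, dotProduct_smul, smul_eq_mul, ← sub_eq_zero, ← sub_mul] at h1
    refine (mul_eq_zero.1 h1).resolve_left fun h2 => hne ?_
    rw [sub_eq_zero] at h2
    exact_mod_cast (mul_right_cancel₀ Complex.I_ne_zero h2).symm
  set y := f.sum fun _ v => v with hy
  have hyz : star y ⬝ᵥ (p *ᵥ z) = 0 := by
    rw [hy, Finsupp.sum, star_sum, sum_dotProduct]
    exact Finset.sum_eq_zero fun w _ => hzv z hzs w _ (hfe w)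
  have hzy : star z ⬝ᵥ (p *ᵥ y) = 0 := by
    rw [← star_dotProduct_mulVec_comm hp, hyz, star_zero]
  have hyy : 0 ≤ (star y ⬝ᵥ (p *ᵥ y)).re := by
    rw [hy, Finsupp.sum, star_sum, sum_dotProduct, Complex.re_sum]
    refine Finset.sum_nonneg fun w hw => ?_
    rw [Matrix.mulVec_sum, dotProduct_sum, Finset.sum_eq_single w (fun w' _ h => hff w w' h.symm)
      (fun h => absurd hw h)]
    exact hpos w _ (hfe w)
  rw [star_add, Matrix.mulVec_add, add_dotProduct, dotProduct_add, dotProduct_add, hyz, hzy]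
  simp only [Complex.add_re, add_zero, zero_add]
  have := hz z hzs
  positivity

end Lyapunov

/-! ### Polarization of a nonnegative dissipation form -/

section Polarization

variable {𝕜 : Type*} [RCLike 𝕜] {n N : ℕ} {a p : Matrix (Fin n) (Fin n) 𝕜}
  {b : Matrix (Fin n) (Fin N) 𝕜} {c : Matrix (Fin N) (Fin n) 𝕜}

theorem eq_zero_of_forall_nonneg_add_mul {α β : ℝ} (h : ∀ t : ℝ, 0 ≤ α + t * β) : β = 0 := by
  by_contra hne
  have := h (-(α + 1) / β)
  rw [div_mul_cancel₀ _ hne] at this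
  linarith

/-- Where a nonnegative dissipation vanishes, its polar form vanishes. -/
theorem re_polar_eq_zero
    (h : ∀ x u, 0 ≤ RCLike.re (star u ⬝ᵥ (c *ᵥ (a *ᵥ x + b *ᵥ u)) -
      star x ⬝ᵥ (p *ᵥ (a *ᵥ x + b *ᵥ u)))) {x : Fin n → 𝕜} {u : Fin N → 𝕜}
    (h0 : RCLike.re (star u ⬝ᵥ (c *ᵥ (a *ᵥ x + b *ᵥ u)) -
      star x ⬝ᵥ (p *ᵥ (a *ᵥ x + b *ᵥ u))) = 0) (y : Fin n → 𝕜) (v : Fin N → 𝕜) :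
    RCLike.re (star u ⬝ᵥ (c *ᵥ (a *ᵥ y + b *ᵥ v)) - star x ⬝ᵥ (p *ᵥ (a *ᵥ y + b *ᵥ v)) +
      (star v ⬝ᵥ (c *ᵥ (a *ᵥ x + b *ᵥ u)) - star y ⬝ᵥ (p *ᵥ (a *ᵥ x + b *ᵥ u)))) = 0 := by
  -- At (y, v) + t(x, u) the term quadratic in t vanishes by hypothesis, leaving an affine function
  -- of t that is nonnegative on the whole line; its slope is the polar form.
  refine eq_zero_of_forall_nonneg_add_mul (α := RCLike.re (star v ⬝ᵥ (c *ᵥ (a *ᵥ y + b *ᵥ v)) -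
      star y ⬝ᵥ (p *ᵥ (a *ᵥ y + b *ᵥ v)))) fun t => ?_
  have h1 := h (y + (t : 𝕜) • x) (v + (t : 𝕜) • u)
  have h2 : a *ᵥ (y + (t : 𝕜) • x) + b *ᵥ (v + (t : 𝕜) • u) =
      (a *ᵥ y + b *ᵥ v) + (t : 𝕜) • (a *ᵥ x + b *ᵥ u) := by
    rw [Matrix.mulVec_add, Matrix.mulVec_add, Matrix.mulVec_smul, Matrix.mulVec_smul, smul_add]
    abel
  rw [h2] at h1
  generalize a *ᵥ y + b *ᵥ v = η at h1 ⊢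
  generalize a *ᵥ x + b *ᵥ u = ξ at h1 h0 ⊢
  simp only [star_add, star_smul, Matrix.mulVec_add, Matrix.mulVec_smul, add_dotProduct,
    dotProduct_add, smul_dotProduct, dotProduct_smul, smul_eq_mul, map_add, map_sub, RCLike.star_def,
    RCLike.conj_ofReal, RCLike.re_ofReal_mul] at h1 h0 ⊢
  have h3 : t * (t * RCLike.re (star u ⬝ᵥ (c *ᵥ ξ))) - t * (t * RCLike.re (star x ⬝ᵥ (p *ᵥ ξ))) = 0 := by
    rw [← mul_sub, ← mul_sub, h0, mul_zero, mul_zero]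
  linarith

end Polarization

/-! ### Positive definiteness of the storage matrix -/

section Positivity

variable {n N : ℕ} {A P : Matrix (Fin n) (Fin n) ℝ} {B : Matrix (Fin n) (Fin N) ℝ}
  {C : Matrix (Fin N) (Fin n) ℝ}

theorem re_star_dotProduct_toC {m l : ℕ} (M : Matrix (Fin m) (Fin l) ℝ) (x : Fin m → ℂ) (y : Fin l → ℂ) :
    (star x ⬝ᵥ (toC M *ᵥ y)).re = (fun i => (x i).re) ⬝ᵥ (M *ᵥ fun i => (y i).re) +
      (fun i => (x i).im) ⬝ᵥ (M *ᵥ fun i => (y i).im) := by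
  simp only [dotProduct, Complex.re_sum, ← Finset.sum_add_distrib]
  refine Finset.sum_congr rfl fun i _ => ?_
  rw [Complex.mul_re, toC_mulVec_re, toC_mulVec_im]
  simp

theorem dissipation_complex (hPs : Pᵀ = P)
    (hdiss : ∀ x u, (P *ᵥ x) ⬝ᵥ (A *ᵥ x + B *ᵥ u) ≤ u ⬝ᵥ (C *ᵥ (A *ᵥ x + B *ᵥ u)))
    (x : Fin n → ℂ) (u : Fin N → ℂ) :
    0 ≤ RCLike.re (star u ⬝ᵥ (toC C *ᵥ (toC A *ᵥ x + toC B *ᵥ u)) -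
      star x ⬝ᵥ (toC P *ᵥ (toC A *ᵥ x + toC B *ᵥ u))) := by
  have hsymm : ∀ x ξ, x ⬝ᵥ (P *ᵥ ξ) = (P *ᵥ x) ⬝ᵥ ξ := fun x ξ => by
    rw [Matrix.dotProduct_mulVec, ← Matrix.mulVec_transpose, hPs]
  have hre : (fun i => ((toC A *ᵥ x + toC B *ᵥ u) i).re) =
      A *ᵥ (fun i => (x i).re) + B *ᵥ fun i => (u i).re := by
    ext i; rw [Pi.add_apply, Complex.add_re, toC_mulVec_re, toC_mulVec_re, Pi.add_apply]
  have him : (fun i => ((toC A *ᵥ x + toC B *ᵥ u) i).im) =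
      A *ᵥ (fun i => (x i).im) + B *ᵥ fun i => (u i).im := by
    ext i; rw [Pi.add_apply, Complex.add_im, toC_mulVec_im, toC_mulVec_im, Pi.add_apply]
  change 0 ≤ (_ - _ : ℂ).re
  rw [Complex.sub_re, re_star_dotProduct_toC, re_star_dotProduct_toC, hre, him, hsymm, hsymm]
  have h1 := hdiss (fun i => (x i).re) fun i => (u i).re
  have h2 := hdiss (fun i => (x i).im) fun i => (u i).im
  linarith

theorem eigenspace_toC_eq_bot {s : ℂ} (h : IsRegularPoint A s) :
    Module.End.eigenspace (toC A).mulVecLin s = ⊥ := by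
  rw [eq_bot_iff]
  intro x hx
  have hx' := Module.End.mem_eigenspace_iff.1 hx
  rw [Matrix.mulVecLin_apply] at hx'
  refine Matrix.eq_zero_of_mulVec_eq_zero h ?_
  rw [Matrix.sub_mulVec, Matrix.smul_mulVec, Matrix.one_mulVec, sub_eq_zero]
  exact hx'.symm

theorem not_isRegularPoint_of_mulVec_eq {s : ℂ} {v : Fin n → ℂ} (h : toC A *ᵥ v = s • v)
    (hv : v ≠ 0) : ¬ IsRegularPoint A s := fun hs => hv <| by
  have : v ∈ Module.End.eigenspace (toC A).mulVecLin s := Module.End.mem_eigenspace_iff.2 h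
  rwa [eigenspace_toC_eq_bot hs] at this

/-- The imaginary eigenvalues of a minimal negative imaginary system are semisimple. -/
theorem semisimple_of_negativeImaginary (hmin : IsMinimalRealization A B C)
    (hNI : IsNegativeImaginary (transferMatrix A B C)) (w : ℝ) (x : Fin n → ℂ)
    (h : toC A *ᵥ (toC A *ᵥ x - ((w : ℂ) * Complex.I) • x) =
      ((w : ℂ) * Complex.I) • (toC A *ᵥ x - ((w : ℂ) * Complex.I) • x)) :
    toC A *ᵥ x - ((w : ℂ) * Complex.I) • x = 0 := by
  have pos : ∀ (w : ℝ), 0 < w → ∀ (x : Fin n → ℂ),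
      toC A *ᵥ (toC A *ᵥ x - ((w : ℂ) * Complex.I) • x) =
        ((w : ℂ) * Complex.I) • (toC A *ᵥ x - ((w : ℂ) * Complex.I) • x) →
      toC A *ᵥ x - ((w : ℂ) * Complex.I) • x = 0 := by
    clear h x w
    intro w hw x h
    by_contra hne
    -- The residue fixes eigenvectors but annihilates the range of A − jω, so no nonzero eigenvector
    -- lies in that range.
    obtain ⟨F, hF, -⟩ := hmin.exists_residue hNI hw (not_isRegularPoint_of_mulVec_eq h hne)
    have h1 := residue_mulVec_eigenvector hF h
    have h2 : F *ᵥ (toC A *ᵥ x - ((w : ℂ) * Complex.I) • x) = 0 := by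
      rw [Matrix.mulVec_sub, Matrix.mulVec_mulVec, residue_mul_eq_smul hF, Matrix.mulVec_smul,
        Matrix.smul_mulVec, sub_self]
    exact hne (h1.symm.trans h2)
  rcases lt_trichotomy w 0 with hw | hw | hw
  · have hstar : ∀ y : Fin n → ℂ, toC A *ᵥ star y - (((-w : ℝ) : ℂ) * Complex.I) • star y =
        star (toC A *ᵥ y - ((w : ℂ) * Complex.I) • y) := fun y => by
      rw [toC_mulVec_star, star_sub, star_smul]
      simp
    have h1 := pos (-w) (by linarith) (star x) (by
      rw [← sub_eq_zero] at h ⊢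
      rw [hstar, hstar, h, star_zero])
    rwa [hstar, star_eq_zero] at h1
  · by_contra hne
    refine not_isRegularPoint_of_mulVec_eq h hne (hmin.isRegularPoint ?_)
    have := hNI.no_pole_zero
    simpa [hw] using this
  · exact pos w hw x h

/-- The complexified storage form is positive on undamped modes. -/
theorem undamped_mode_nonneg (hmin : IsMinimalRealization A B C)
    (hNI : IsNegativeImaginary (transferMatrix A B C)) (hPs : Pᵀ = P)
    (hdiss : ∀ x u, (P *ᵥ x) ⬝ᵥ (A *ᵥ x + B *ᵥ u) ≤ u ⬝ᵥ (C *ᵥ (A *ᵥ x + B *ᵥ u)))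
    {w : ℝ} {v : Fin n → ℂ} (hv : toC A *ᵥ v = ((w : ℂ) * Complex.I) • v) :
    (∀ y, star v ⬝ᵥ (toC P *ᵥ (toC A *ᵥ y)) =
      ((w : ℂ) * Complex.I) * (star v ⬝ᵥ (toC P *ᵥ y))) ∧
    0 ≤ (star v ⬝ᵥ (toC P *ᵥ v)).re := by
  have hp : (toC P)ᴴ = toC P := by rw [toC_conjTranspose, hPs]
  have hreal : ∀ y, (star y ⬝ᵥ (toC P *ᵥ y)).im = 0 := fun y => by
    have := congrArg Complex.im (star_dotProduct_mulVec_comm hp y y)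
    simp only [RCLike.star_def, Complex.conj_im] at this
    linarith
  -- Undamped free motion dissipates nothing: v*Pv is real, so Re(jω v*Pv) = 0 and the polar form
  -- vanishes at (v, 0).
  have hpolar : ∀ {w : ℝ} {v : Fin n → ℂ}, toC A *ᵥ v = ((w : ℂ) * Complex.I) • v →
      ∀ (y : Fin n → ℂ) (u : Fin N → ℂ),
      (-(star v ⬝ᵥ (toC P *ᵥ (toC A *ᵥ y + toC B *ᵥ u))) +
        (((w : ℂ) * Complex.I) * (star u ⬝ᵥ (toC C *ᵥ v)) -
          ((w : ℂ) * Complex.I) * (star y ⬝ᵥ (toC P *ᵥ v)))).re = 0 := by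
    intro w v hv y u
    have h0 := re_polar_eq_zero (dissipation_complex hPs hdiss) (x := v) (u := 0) (by
      simp only [star_zero, zero_dotProduct, Matrix.mulVec_zero, add_zero, hv, zero_sub]
      rw [Matrix.mulVec_smul, dotProduct_smul]
      simp [hreal]) y u
    simp only [star_zero, zero_dotProduct, Matrix.mulVec_zero, add_zero, hv, zero_sub,
      Matrix.mulVec_smul, dotProduct_smul, smul_eq_mul] at h0
    exact h0
  have horth : ∀ {w : ℝ} {v : Fin n → ℂ}, toC A *ᵥ v = ((w : ℂ) * Complex.I) • v →
      ∀ y, star v ⬝ᵥ (toC P *ᵥ (toC A *ᵥ y)) =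
        ((w : ℂ) * Complex.I) * (star v ⬝ᵥ (toC P *ᵥ y)) := by
    intro w v hv y
    have hre : ∀ y, (star v ⬝ᵥ (toC P *ᵥ (toC A *ᵥ y)) -
        ((w : ℂ) * Complex.I) * (star v ⬝ᵥ (toC P *ᵥ y))).re = 0 := by
      intro y
      have h1 := hpolar hv y 0
      rw [← star_dotProduct_mulVec_comm hp v y] at h1
      simp only [Matrix.mulVec_zero, add_zero, star_zero, zero_dotProduct, mul_zero, zero_sub,
        Complex.add_re, Complex.neg_re, Complex.sub_re, Complex.mul_re, Complex.mul_im,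
        Complex.ofReal_re, Complex.ofReal_im, Complex.I_re, Complex.I_im, RCLike.star_def,
        Complex.conj_re, Complex.conj_im] at h1 ⊢
      linarith
    have h1 := hre y
    -- Replacing y by jy turns the real part into the imaginary part.
    have h2 := hre (Complex.I • y)
    rw [Matrix.mulVec_smul, Matrix.mulVec_smul, Matrix.mulVec_smul, dotProduct_smul,
      dotProduct_smul, smul_eq_mul, smul_eq_mul, mul_left_comm, ← mul_sub, Complex.I_mul_re,
      neg_eq_zero] at h2
    exact sub_eq_zero.1 (Complex.ext h1 h2)
  have hpos : ∀ {w : ℝ}, 0 < w → ∀ {v : Fin n → ℂ}, toC A *ᵥ v = ((w : ℂ) * Complex.I) • v →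
      0 ≤ (star v ⬝ᵥ (toC P *ᵥ v)).re := by
    intro w hw v hv
    rcases eq_or_ne v 0 with rfl | hne
    · simp
    obtain ⟨F, hF, hK⟩ := hmin.exists_residue hNI hw (not_isRegularPoint_of_mulVec_eq hv hne)
    obtain ⟨u, hu⟩ := exists_residue_mulVec_eq hF hmin.controllable_complex v
    have hFv := residue_mulVec_eigenvector hF hv
    rw [hFv] at hu
    -- Writing Bu = (s − A)R(s)Bu and using `horth`, the left side equals v*P applied to (s −
    -- jω)R(s)Bu for s near jω, and this tends to v*PFBu = v*Pv.
    have h1 : star v ⬝ᵥ (toC P *ᵥ (toC B *ᵥ u)) = star v ⬝ᵥ (toC P *ᵥ v) := by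
      have hc : Continuous fun M : Matrix (Fin n) (Fin n) ℂ =>
          star v ⬝ᵥ (toC P *ᵥ (M *ᵥ (toC B *ᵥ u))) := by
        simp only [Matrix.mulVec, dotProduct]; fun_prop
      have h2 := (hc.tendsto F).comp hF
      rw [← hu] at h2
      refine tendsto_nhds_unique (tendsto_const_nhds.congr' ?_) h2
      filter_upwards [eventually_det_ne_zero (toC A) (w * Complex.I)] with s hs
      have h3 : toC B *ᵥ u = s • (resolventMatrix (toC A) s *ᵥ (toC B *ᵥ u)) -
          toC A *ᵥ (resolventMatrix (toC A) s *ᵥ (toC B *ᵥ u)) := by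
        rw [Matrix.mulVec_mulVec _ (toC A), mul_resolventMatrix hs, Matrix.sub_mulVec,
          Matrix.one_mulVec, Matrix.smul_mulVec]
        abel
      conv_lhs => rw [h3]
      simp only [Function.comp_apply]
      rw [Matrix.mulVec_sub, dotProduct_sub, horth hv, Matrix.mulVec_smul, dotProduct_smul,
        Matrix.smul_mulVec, Matrix.mulVec_smul, dotProduct_smul, smul_eq_mul, smul_eq_mul, sub_mul]
    have h2 := hpolar hv 0 u
    simp only [Matrix.mulVec_zero, zero_add, star_zero, zero_dotProduct, mul_zero, sub_zero, h1] at h2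
    have h3 := (Complex.le_def.1 (hK.dotProduct_mulVec_nonneg u)).1
    have h4 : star u ⬝ᵥ ((Complex.I • (toC C * F * toC B)) *ᵥ u) =
        Complex.I * (star u ⬝ᵥ (toC C *ᵥ v)) := by
      rw [Matrix.smul_mulVec, dotProduct_smul, smul_eq_mul, ← Matrix.mulVec_mulVec,
        ← Matrix.mulVec_mulVec, ← hu]
    rw [h4] at h3
    -- The polar identity at (0, u) expresses v*Pv through the residue form u*(jCFB)u, which is
    -- nonnegative.
    have h5 : (star v ⬝ᵥ (toC P *ᵥ v)).re = w * (Complex.I * (star u ⬝ᵥ (toC C *ᵥ v))).re := by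
      rw [mul_assoc, Complex.add_re, Complex.neg_re, Complex.re_ofReal_mul] at h2
      linarith
    rw [h5]
    exact mul_nonneg hw.le h3
  refine ⟨horth hv, ?_⟩
  rcases lt_trichotomy w 0 with hw | hw | hw
  · have h1 : toC A *ᵥ star v = (((-w : ℝ) : ℂ) * Complex.I) • star v := by
      rw [toC_mulVec_star, hv, star_smul]
      simp
    have h2 := hpos (by linarith) h1
    rw [toC_mulVec_star, Matrix.star_dotProduct_star] at h2
    rwa [dotProduct_comm, RCLike.star_def, Complex.conj_re] at h2
  · rcases eq_or_ne v 0 with rfl | hne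
    · simp
    refine absurd (hmin.isRegularPoint ?_) (not_isRegularPoint_of_mulVec_eq hv hne)
    have := hNI.no_pole_zero
    simpa [hw] using this
  · exact hpos hw hv

theorem storage_nonneg (hmin : IsMinimalRealization A B C)
    (hNI : IsNegativeImaginary (transferMatrix A B C)) (hPs : Pᵀ = P)
    (hdiss : ∀ x u, (P *ᵥ x) ⬝ᵥ (A *ᵥ x + B *ᵥ u) ≤ u ⬝ᵥ (C *ᵥ (A *ᵥ x + B *ᵥ u)))
    (x : Fin n → ℝ) : 0 ≤ x ⬝ᵥ (P *ᵥ x) := by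
  have hp : (toC P)ᴴ = toC P := by rw [toC_conjTranspose, hPs]
  have htop := stableSubspace_sup_iSup_eigenspace (toC A).mulVecLin
    (fun μ hμ => eigenspace_toC_eq_bot (hmin.isRegularPoint (hNI.no_pole_right μ hμ)))
    (fun w x hx => by
      have h1 : ∀ y, ((toC A).mulVecLin - ((w : ℂ) * Complex.I) •
          (1 : Module.End ℂ (Fin n → ℂ))) y = toC A *ᵥ y - ((w : ℂ) * Complex.I) • y := fun y => rfl
      rw [h1, h1, sub_eq_zero] at hx
      rw [h1]
      exact semisimple_of_negativeImaginary hmin hNI w x hx)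
  have h1 := re_dotProduct_mulVec_nonneg hp htop
    (fun x => by
      have := dissipation_complex hPs hdiss x 0
      simp only [star_zero, zero_dotProduct, Matrix.mulVec_zero, add_zero, zero_sub] at this
      change 0 ≤ (-_ : ℂ).re at this
      rw [Complex.neg_re] at this
      rw [Matrix.mulVecLin_apply]
      linarith)
    (fun w v hv => (undamped_mode_nonneg hmin hNI hPs hdiss hv).1)
    (fun w v hv => (undamped_mode_nonneg hmin hNI hPs hdiss hv).2)
    (fun i => (x i : ℂ))
  rw [re_star_dotProduct_toC] at h1
  simpa using h1

theorem storage_polar_eq_zero (hPs : Pᵀ = P)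
    (hdiss : ∀ x u, (P *ᵥ x) ⬝ᵥ (A *ᵥ x + B *ᵥ u) ≤ u ⬝ᵥ (C *ᵥ (A *ᵥ x + B *ᵥ u)))
    {x : Fin n → ℝ} {u : Fin N → ℝ}
    (h0 : u ⬝ᵥ (C *ᵥ (A *ᵥ x + B *ᵥ u)) - x ⬝ᵥ (P *ᵥ (A *ᵥ x + B *ᵥ u)) = 0)
    (y : Fin n → ℝ) (v : Fin N → ℝ) :
    u ⬝ᵥ (C *ᵥ (A *ᵥ y + B *ᵥ v)) - x ⬝ᵥ (P *ᵥ (A *ᵥ y + B *ᵥ v)) +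
      (v ⬝ᵥ (C *ᵥ (A *ᵥ x + B *ᵥ u)) - y ⬝ᵥ (P *ᵥ (A *ᵥ x + B *ᵥ u))) = 0 := by
  have hsymm : ∀ x ξ, x ⬝ᵥ (P *ᵥ ξ) = (P *ᵥ x) ⬝ᵥ ξ := fun x ξ => by
    rw [Matrix.dotProduct_mulVec, ← Matrix.mulVec_transpose, hPs]
  have := re_polar_eq_zero (𝕜 := ℝ) (a := A) (b := B) (c := C) (p := P) (x := x) (u := u)
    (fun x u => by
      simp only [star_trivial, RCLike.re_to_real, sub_nonneg, hsymm]
      exact hdiss x u) (by simpa only [star_trivial, RCLike.re_to_real] using h0) y v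
  simpa only [star_trivial, RCLike.re_to_real] using this

/-- A storage matrix of a minimal negative imaginary system is positive definite. -/
theorem storage_pos (hmin : IsMinimalRealization A B C)
    (hNI : IsNegativeImaginary (transferMatrix A B C)) (hPs : Pᵀ = P)
    (hdiss : ∀ x u, (P *ᵥ x) ⬝ᵥ (A *ᵥ x + B *ᵥ u) ≤ u ⬝ᵥ (C *ᵥ (A *ᵥ x + B *ᵥ u)))
    (hA : IsUnit A) {x : Fin n → ℝ} (hx : x ≠ 0) : 0 < x ⬝ᵥ (P *ᵥ x) := by
  have hnn := storage_nonneg hmin hNI hPs hdiss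
  have hpsd : P.PosSemidef := .of_dotProduct_mulVec_nonneg
    (by unfold Matrix.IsHermitian; rw [Matrix.conjTranspose_eq_transpose_of_trivial, hPs])
    fun x => by rw [star_trivial]; exact hnn x
  refine lt_of_le_of_ne (hnn x) fun h0 => hx ?_
  have hPx : P *ᵥ x = 0 := by
    rw [← hpsd.dotProduct_mulVec_zero_iff, star_trivial]; exact h0.symm
  -- On the kernel of P the free dissipation vanishes, hence so does its polar form. Testing with
  -- arbitrary y and v gives PAx = 0 and CAx = 0.
  have step : ∀ x, P *ᵥ x = 0 → P *ᵥ (A *ᵥ x) = 0 ∧ C *ᵥ (A *ᵥ x) = 0 := by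
    intro x hx
    have hxP : ∀ ξ, x ⬝ᵥ (P *ᵥ ξ) = 0 := fun ξ => by
      rw [Matrix.dotProduct_mulVec, ← Matrix.mulVec_transpose, hPs, hx, zero_dotProduct]
    have h1 := storage_polar_eq_zero hPs hdiss (x := x) (u := 0) (by simp only [zero_dotProduct, hxP, sub_zero])
    simp only [zero_dotProduct, hxP, Matrix.mulVec_zero, add_zero, sub_zero, zero_add] at h1
    constructor
    · refine dotProduct_self_eq_zero.1 ?_
      have := h1 (P *ᵥ (A *ᵥ x)) 0
      simpa using this
    · refine dotProduct_self_eq_zero.1 ?_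
      have := h1 0 (C *ᵥ (A *ᵥ x))
      simpa using this
  have hall : ∀ j : ℕ, P *ᵥ ((A ^ j) *ᵥ x) = 0 := by
    intro j
    induction j with
    | zero => simpa using hPx
    | succ j ih =>
      rw [pow_succ', ← Matrix.mulVec_mulVec]
      exact (step _ ih).1
  -- The supply rate involves only ẏ, so unobservability is obtained for Ax rather than x;
  -- invertibility of A closes the gap.
  refine Matrix.mulVec_injective_iff_isUnit.2 hA ((hmin.observable _ fun j => ?_).trans
    (Matrix.mulVec_zero A).symm)
  rw [Matrix.mulVec_mulVec x (A ^ j) A, ← pow_succ, pow_succ', ← Matrix.mulVec_mulVec]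
  exact (step _ (hall j)).2

theorem isUnit_of_isRegularPoint_zero (h : IsRegularPoint A 0) : IsUnit A := by
  rw [← Matrix.mulVec_injective_iff_isUnit]
  refine (injective_iff_map_eq_zero A.mulVecLin).2 fun x hx => ?_
  rw [Matrix.mulVecLin_apply] at hx
  by_contra hne
  refine not_isRegularPoint_of_mulVec_eq (v := fun i => (x i : ℂ)) ?_ ?_ h
  · rw [toC_mulVec_ofReal, hx, zero_smul]
    ext; simp
  · intro h0
    refine hne (funext fun i => ?_)
    have := congrFun h0 i
    simpa using this

/-- For small gains the closed loop in gain mode has no equilibrium other than the origin. -/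
theorem eq_zero_of_equilibrium {κ : ℝ} (hPs : Pᵀ = P)
    (hP : ∀ x, x ≠ 0 → 0 < x ⬝ᵥ (P *ᵥ x))
    (hdiss : ∀ x u, (P *ᵥ x) ⬝ᵥ (A *ᵥ x + B *ᵥ u) ≤ u ⬝ᵥ (C *ᵥ (A *ᵥ x + B *ᵥ u)))
    (hg : ∀ x, κ * ((C *ᵥ x) ⬝ᵥ (C *ᵥ x)) ≤ 1 / 4 * (x ⬝ᵥ (P *ᵥ x)))
    (hA : IsUnit A) {x : Fin n → ℝ}
    (hx : A *ᵥ x + B *ᵥ (κ • (C *ᵥ x)) = 0) : x = 0 := by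
  have h1 := storage_polar_eq_zero hPs hdiss (x := x) (u := κ • (C *ᵥ x)) (by simp [hx])
  -- At an equilibrium the dissipation vanishes. Testing the polar form with Ay = x gives κ|Cx|² =
  -- xᵀPx, against the bound ¼ xᵀPx.
  obtain ⟨y, hy⟩ := (Matrix.mulVec_surjective_iff_isUnit.2 hA) x
  have h2 := h1 y 0
  simp only [hx, Matrix.mulVec_zero, add_zero, dotProduct_zero, sub_zero] at h2
  rw [hy, smul_dotProduct, smul_eq_mul] at h2
  by_contra hne
  have := hP x hne
  have := hg x
  linarith

end Positivity

end MultiHIGS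

end

/-! ### Conclusion -/

theorem theorem4 {n N : ℕ} (A : Matrix (Fin n) (Fin n) ℝ) (B : Matrix (Fin n) (Fin N) ℝ)
    (C : Matrix (Fin N) (Fin n) ℝ)
    (hmin : MultiHIGS.IsMinimalRealization A B C)
    (hNI : MultiHIGS.IsNegativeImaginary (MultiHIGS.transferMatrix A B C)) :
    ∃ k w : Fin N → ℝ, (∀ i, 0 < k i) ∧ (∀ i, 0 ≤ w i) ∧
      MultiHIGS.IsAsymptoticallyStable A B C k w := by
  obtain ⟨P, hPs, hdiss⟩ := MultiHIGS.exists_storage_matrix hmin.controllable_complex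
    (fun w x u h => hmin.frequency_nonneg hNI h) (hmin.feedthrough_nonneg hNI)
  have hA : IsUnit A :=
    MultiHIGS.isUnit_of_isRegularPoint_zero (hmin.isRegularPoint hNI.no_pole_zero)
  have hP : ∀ x, x ≠ 0 → 0 < x ⬝ᵥ (P *ᵥ x) := fun x hx =>
    MultiHIGS.storage_pos hmin hNI hPs hdiss hA hx
  obtain ⟨κ, hκ, hg⟩ := MultiHIGS.exists_gain C hP
  exact ⟨fun _ => κ, fun _ => 1, fun _ => hκ, fun _ => zero_le_one,
    ⟨MultiHIGS.stable_of_storage hPs hκ hP hdiss hg, fun x Xh h =>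
      MultiHIGS.attractive_of_storage hPs hκ hP hdiss hg hmin.observable
        (fun x hx => MultiHIGS.eq_zero_of_equilibrium hPs hP hdiss hg hA hx) h⟩⟩
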